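/- A tropical (Laurent) polynomial in $n$ indeterminates is a function $f(x)=\max_{a\in\mathcal A}(\lambda_a+\langle a,x\rangle)$ on $\mathbb R^n$, with $\mathcal A\subset\mathbb Z^n$ finite and non-empty and $\lambda_a\in\mathbb R$; it is homogeneous of degree $d$ if $\sum_i a_i=d$ for all $a\in\mathcal A$. Its variety $V(f)$ is the set of points near which $f$ is not affine-linear. The tropical projective plane $\mathbb R^3/\mathbb R(1,1,1)$ is identified with $\mathbb R^2$ by setting the last coordinate to $0$. So a homogeneous $F$ in three indeterminates defines the plane curve $V(f)\subset\mathbb R^2$, where $f(x,y)=F(x,y,0)$. The edges of $V(f)$ are dual to edges of the subdivision of the Newton polygon $\Delta_f=\operatorname{conv}(\mathcal A)$ induced by the upper faces of the convex hull of the points $(a,\lambda_a)$, and the weight of an edge is the lattice length of its dual edge. The curve is smooth if every vertex has exactly three adjacent edges and multiplicity $1$, that is, $m_1m_2|\det(u_1,u_2)|=1$ for the weights $m_i$ and primitive direction vectors $u_i$ of two of these edges. The curve has degree $3$ if the Newton polygon of $F$ fits, up to a lattice translation, inside the triangle with vertices $(3,0,0),(0,3,0),(0,0,3)$, but not inside the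 corresponding triangle of smaller size. Its genus (for a smooth curve) is the number of lattice points in the interior of $\Delta_f$. A tropical elliptic curve is a smooth tropical curve $C=V(f)$ of degree $3$ and genus $1$. Such a curve contains a unique cycle $\overline C$ (a subset homeomorphic to a circle), and the connected components of $C\smallsetminus\overline C$ are called tentacles. Two tropical curves intersect transversally if no vertex of one lies on the other. An intersection point on edges with weights $m_1,m_2$ and primitive direction vectors $v,w$ then has multiplicity $m_1m_2|\det(v,w)|$. The stable intersection of two curves is the limit, counted with multiplicities, of the transversal intersections of arbitrarily small translates of the two curves. A divisor on $C$ is an element of the free abelian group on the points of $C$. For a homogeneous tropical polynomial $G$ in three indeterminates, $\operatorname{div}G$ is the divisor given by the stable intersection of $C$ with the plane curve of $G$. Two divisors $D_1,D_2$ on $C$ are linearly equivalent, $D_1\sim D_2$, if $D_1-D_2=\operatorname{div}G-\operatorname{div}H$ for homogeneous tropical polynomials $G,H$ of the same degree. **Proposition.** Let $C$ be a tropical elliptic curve, and let $P$ and $Q$ be points on the same tentacle of $C$. Then $P\sim Q$. -/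

import Mathlib

open Filter Topology

noncomputable section

/-- A tropical (Laurent) polynomial in `n` indeterminates: a nonempty finite set `support ⊆ ℤⁿ` of
exponents together with real coefficients (only the coefficients on the support matter). -/
structure TropPoly (n : ℕ) where
  support : Finset (Fin n → ℤ)
  support_nonempty : support.Nonempty
  coeff : (Fin n → ℤ) → ℝ

/-- An integer vector, regarded as a real vector. -/
def latticeVec {n : ℕ} (a : Fin n → ℤ) : Fin n → ℝ := fun i => (a i : ℝ)

/-- A vector of `ℤ²` is primitive if its coordinates are coprime. -/
def IsPrimitiveVec (v : Fin 2 → ℤ) : Prop := Int.gcd (v 0) (v 1) = 1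

/-- The determinant `|v w|` of two vectors of `ℤ²`. -/
def latticeDet (v w : Fin 2 → ℤ) : ℤ := v 0 * w 1 - v 1 * w 0

namespace TropPoly

variable {n : ℕ}

/-- The value at `x` of the tropical monomial with exponent `a`. -/
def term (f : TropPoly n) (a : Fin n → ℤ) (x : Fin n → ℝ) : ℝ :=
  f.coeff a + ∑ i, (a i : ℝ) * x i

/-- The function `ℝⁿ → ℝ` of a tropical polynomial: the maximum of its monomials. -/
def eval (f : TropPoly n) (x : Fin n → ℝ) : ℝ :=
  f.support.sup' f.support_nonempty (fun a => f.term a x)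

/-- All monomials have total degree `d`. -/
def IsHomogeneous (f : TropPoly n) (d : ℤ) : Prop :=
  ∀ a ∈ f.support, ∑ i, a i = d

/-- The tropical variety `V(f)`: the points where the function of `f` is not (locally affine)
linear. -/
def variety (f : TropPoly n) : Set (Fin n → ℝ) :=
  {x | ¬ ∃ (w : Fin n → ℝ) (c : ℝ), ∀ᶠ y in 𝓝 x, f.eval y = ∑ i, w i * y i + c}

/-- The Newton polytope. -/
def newtonPolytope (f : TropPoly n) : Set (Fin n → ℝ) :=
  convexHull ℝ (latticeVec '' (f.support : Set (Fin n → ℤ)))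

/-- The Newton polytope fits, up to a lattice translation `t`, inside the simplex
`Γ_d = {x | 0 ≤ xᵢ, ∑ xᵢ = d}`. -/
def FitsInSimplex (f : TropPoly n) (d : ℕ) : Prop :=
  ∃ t : Fin n → ℤ, f.newtonPolytope ⊆
    {x | (∀ i, (t i : ℝ) ≤ x i) ∧ ∑ i, (x i - (t i : ℝ)) = (d : ℝ)}

/-- The variety of the homogeneous polynomial `f` has degree `d`: the Newton polytope fits inside
`Γ_d`, but not inside a smaller `Γ_e`. -/
def HasCurveDegree (f : TropPoly n) (d : ℕ) : Prop :=
  f.FitsInSimplex d ∧ ∀ e < d, ¬ f.FitsInSimplex e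

/-- The dehomogenization `f(x, y) = F(x, y, 0)` of a polynomial `F`, homogeneous of degree `d`. -/
def dehomogenize (F : TropPoly 3) (d : ℤ) : TropPoly 2 where
  support := F.support.image (fun a => ![a 0, a 1])
  support_nonempty := F.support_nonempty.image _
  coeff := fun b => F.coeff ![b 0, b 1, d - b 0 - b 1]

/-- The polynomial `x ↦ f (x - v)`, whose variety is the translate `V(f) + v`. -/
def translate (f : TropPoly n) (v : Fin n → ℝ) : TropPoly n where
  support := f.support
  support_nonempty := f.support_nonempty
  coeff := fun a => f.coeff a - ∑ i, (a i : ℝ) * v i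

/-! ### Plane curves: vertices, edges, weights -/

/-- The exponents at which the maximum defining `f` is attained at `p`. -/
def activeSet (f : TropPoly 2) (p : Fin 2 → ℝ) : Set (Fin 2 → ℤ) :=
  {a | a ∈ f.support ∧ f.term a p = f.eval p}

/-- The cell, dual to `p`, of the subdivision of the Newton polygon. (The upper faces of the
convex hull of the points `(a, λ_a)` are the faces on which some functional `(p, 1)` is maximal;
the one belonging to `p` projects onto this set.) -/
def dualCell (f : TropPoly 2) (p : Fin 2 → ℝ) : Set (Fin 2 → ℝ) :=
  convexHull ℝ (latticeVec '' f.activeSet p)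

/-- `p` is a vertex of `V(f)`: its dual cell is two-dimensional. -/
def IsVertex (f : TropPoly 2) (p : Fin 2 → ℝ) : Prop :=
  ¬ Collinear ℝ (f.dualCell p)

/-- The weight of the edge of `V(f)` having `p` in its relative interior: the lattice length of
the dual segment, i.e. the number of its lattice points minus one. -/
def weight (f : TropPoly 2) (p : Fin 2 → ℝ) : ℕ :=
  {a : Fin 2 → ℤ | latticeVec a ∈ f.dualCell p}.ncard - 1

/-- `v` is a primitive integer vector such that `V(f)` contains a small segment starting at `p` in
direction `v`; i.e. an edge of `V(f)` leaves `p` in direction `v`. -/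
def IsEdgeDirection (f : TropPoly 2) (p : Fin 2 → ℝ) (v : Fin 2 → ℤ) : Prop :=
  IsPrimitiveVec v ∧ ∀ᶠ t in 𝓝[>] (0 : ℝ), p + t • latticeVec v ∈ f.variety

/-- The edge of `V(f)` leaving `p` in direction `v` has weight `m`. -/
def HasEdgeWeight (f : TropPoly 2) (p : Fin 2 → ℝ) (v : Fin 2 → ℤ) (m : ℕ) : Prop :=
  ∀ᶠ t in 𝓝[>] (0 : ℝ), f.weight (p + t • latticeVec v) = m

/-- Smoothness: every vertex is 3-valent and has multiplicity 1. -/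
def IsSmooth (f : TropPoly 2) : Prop :=
  ∀ p, f.IsVertex p →
    {v | f.IsEdgeDirection p v}.ncard = 3 ∧
    ∀ u v m₁ m₂, f.IsEdgeDirection p u → f.IsEdgeDirection p v → u ≠ v →
      f.HasEdgeWeight p u m₁ → f.HasEdgeWeight p v m₂ →
      m₁ * m₂ * (latticeDet u v).natAbs = 1

/-- The genus of a smooth curve: the number of interior lattice points of the Newton polygon. -/
def genus (f : TropPoly 2) : ℕ :=
  {a : Fin 2 → ℤ | latticeVec a ∈ interior f.newtonPolytope}.ncard

/-- `F`, homogeneous of degree `d` in three indeterminates, defines a tropical elliptic curve: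
a smooth tropical curve of degree 3 and genus 1. (The degree `d` of `F` may exceed the degree of
the curve, since multiplying by a monomial does not change the curve.) -/
structure IsElliptic (F : TropPoly 3) (d : ℤ) : Prop where
  homogeneous : F.IsHomogeneous d
  degree_three : F.HasCurveDegree 3
  smooth : (F.dehomogenize d).IsSmooth
  genus_one : (F.dehomogenize d).genus = 1

/-! ### Intersections -/

/-- `V(f)` and `V(g)` intersect transversally: no vertex of one lies on the other. -/
def Transversal (f g : TropPoly 2) : Prop :=
  (∀ p, f.IsVertex p → p ∉ g.variety) ∧ (∀ p, g.IsVertex p → p ∉ f.variety)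

/-- A primitive direction vector of `V(f)` at `p`. In the relative interior of an edge it is
determined up to sign. -/
def edgeDirection (f : TropPoly 2) (p : Fin 2 → ℝ) : Fin 2 → ℤ :=
  Classical.epsilon (fun v => f.IsEdgeDirection p v)

open scoped Classical in
/-- The multiplicity at `p` of a transversal intersection of `V(f)` and `V(g)`
(zero if `p` is not an intersection point). -/
def transversalMult (f g : TropPoly 2) (p : Fin 2 → ℝ) : ℕ :=
  if p ∈ f.variety ∩ g.variety then
    f.weight p * g.weight p * (latticeDet (f.edgeDirection p) (g.edgeDirection p)).natAbs
  else 0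

/-- The stable intersection `lim (V(f) + v₁) ∩ (V(g) + v₂)`, the limit being over all translations
`v₁, v₂ → 0` that make the intersection transversal, has multiplicity `m` at `p`: in each small
ball around `p`, the sum of the multiplicities is `m` for all sufficiently small such
translations. -/
def HasStableMult (f g : TropPoly 2) (p : Fin 2 → ℝ) (m : ℕ) : Prop :=
  ∀ᶠ r in 𝓝[>] (0 : ℝ), ∀ᶠ v in 𝓝 (0 : (Fin 2 → ℝ) × (Fin 2 → ℝ)),
    Transversal (f.translate v.1) (g.translate v.2) →
      ∑ᶠ q ∈ Metric.ball p r, transversalMult (f.translate v.1) (g.translate v.2) q = m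

/-! ### Divisors -/

/-- The group of divisors on `C = V(f)`: the free abelian group on the points of `C`. -/
abbrev Divisor (f : TropPoly 2) : Type := f.variety →₀ ℤ

/-- `D = div g` on the curve `V(f)`: the formal sum of the points of the stable intersection of
`V(f)` and `V(g)` with their multiplicities. -/
def IsDiv (f g : TropPoly 2) (D : Divisor f) : Prop :=
  ∀ p : f.variety, ∃ m : ℕ, HasStableMult f g p m ∧ D p = (m : ℤ)

/-- Principal divisors on `V(f)`: those of the form `div G - div H`, for `G` and `H` homogeneous of
the same degree in three indeterminates. -/
def IsPrincipal (f : TropPoly 2) (D : Divisor f) : Prop :=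
  ∃ (e : ℤ) (G H : TropPoly 3), G.IsHomogeneous e ∧ H.IsHomogeneous e ∧
    ∃ D₁ D₂ : Divisor f, IsDiv f (G.dehomogenize e) D₁ ∧ IsDiv f (H.dehomogenize e) D₂ ∧
      D = D₁ - D₂

/-- Linear equivalence of divisors on `V(f)`. -/
def LinearlyEquivalent (f : TropPoly 2) (D₁ D₂ : Divisor f) : Prop :=
  IsPrincipal f (D₁ - D₂)

end TropPoly

/-- `Z` is a cycle (simple closed curve) contained in `C`. -/
def IsCycleIn (C Z : Set (Fin 2 → ℝ)) : Prop :=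
  Z ⊆ C ∧ Nonempty (Z ≃ₜ Circle)

/-- `T` is a connected component of `C ∖ Z`. -/
def IsTentacle (C Z T : Set (Fin 2 → ℝ)) : Prop :=
  ∃ x ∈ C \ Z, T = connectedComponentIn (C \ Z) x

end

/-! Let o be the unique interior lattice point of the Newton polygon. Smoothness enters through
`IsUnimodular`: every edge has weight one, and the primitive edge directions at each point of C sum
to zero. This balancing makes the stable multiplicity of C and V(g) at p equal to the sum of the
slopes of g along the edges leaving p (`hasStableMult_of_isUnimodular`): after a small translation
the intersection points near p are kinks of g along those edges, and their contributions telescope.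
Hence a difference of two tropical polynomial functions has a principal divisor whose coefficient at
p is its sum of outgoing slopes (`mem_principalSubgroup`), and it remains to construct suitable
functions on the plane.

An edge of C that does not border the region of o lies between two regions whose exponents are on
the boundary of the Newton polygon. Each such region contains, with any of its points, a ray in the
direction of an integral outer normal. Two such rays starting at a point of the edge cut the plane
and meet C only at that point; if a normal is parallel to the edge, the edge itself is unbounded. In
both cases some tropical rational function has slope k > 0 along a given segment of the edge and
takes only two values on the rest of C (`exists_separator`), so k(P - P') is principal for the two
ends. To remove the factor k, tent functions (`exists_bump`) show that equally spaced points on an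
edge have equivalent successive differences. If a segment is cut into k steps, the difference of its
ends is k times the difference of one step, which is principal. So nearby points of C off the region
of o are equivalent (`eventually_sub_mem`).

Finally, the cycle is exactly the part of C bordering the region of o. It cannot use a separated
edge, since a function on a circle is not locally injective at a point where it takes a value only
once (`active_of_mem_cycle`). Conversely the boundary of the convex region of o is seen injectively
from an interior point, so a circle in it that missed a point would embed in a line
(`mem_cycle_of_active`). A tentacle therefore avoids the region of o, and local equivalence spreads
over it by connectedness. -/

noncomputable section

/-! ### Integer vectors in the plane -/

/-- The pairing of an integer vector with a point of the plane. -/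
def dot (a : Fin 2 → ℤ) (x : Fin 2 → ℝ) : ℝ := a 0 * x 0 + a 1 * x 1

/-- The pairing of two integer vectors. -/
def idot (a u : Fin 2 → ℤ) : ℤ := a 0 * u 0 + a 1 * u 1

/-- Rotation by a quarter turn. -/
def perp (v : Fin 2 → ℤ) : Fin 2 → ℤ := ![-(v 1), v 0]

@[simp] lemma perp_zero (v : Fin 2 → ℤ) : perp v 0 = -(v 1) := rfl
@[simp] lemma perp_one (v : Fin 2 → ℤ) : perp v 1 = v 0 := rfl
@[simp] lemma latticeVec_apply {n : ℕ} (a : Fin n → ℤ) (i : Fin n) :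
    latticeVec a i = (a i : ℝ) := rfl

lemma dot_add (a : Fin 2 → ℤ) (x y : Fin 2 → ℝ) : dot a (x + y) = dot a x + dot a y := by
  simp [dot]; ring

lemma dot_sub (a : Fin 2 → ℤ) (x y : Fin 2 → ℝ) : dot a (x - y) = dot a x - dot a y := by
  simp [dot]; ring

lemma dot_smul (a : Fin 2 → ℤ) (t : ℝ) (x : Fin 2 → ℝ) : dot a (t • x) = t * dot a x := by
  simp [dot]; ring

@[simp] lemma dot_zero (a : Fin 2 → ℤ) : dot a 0 = 0 := by simp [dot]

lemma dot_neg (a : Fin 2 → ℤ) (x : Fin 2 → ℝ) : dot a (-x) = -dot a x := by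
  simp [dot]; ring

lemma sub_dot (a b : Fin 2 → ℤ) (x : Fin 2 → ℝ) : dot (a - b) x = dot a x - dot b x := by
  simp [dot]; ring

@[simp] lemma dot_latticeVec (a u : Fin 2 → ℤ) : dot a (latticeVec u) = (idot a u : ℝ) := by
  simp [dot, idot]

@[fun_prop] lemma continuous_dot (a : Fin 2 → ℤ) : Continuous (dot a) := by
  unfold dot; fun_prop

lemma latticeVec_injective {n : ℕ} : Function.Injective (latticeVec (n := n)) := by
  intro a b h
  funext i
  have := congrFun h i
  simpa using this

lemma latticeVec_neg {n : ℕ} (a : Fin n → ℤ) : latticeVec (-a) = -latticeVec a := by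
  funext i; simp

lemma latticeVec_add {n : ℕ} (a b : Fin n → ℤ) :
    latticeVec (a + b) = latticeVec a + latticeVec b := by
  funext i; simp

lemma latticeVec_zsmul {n : ℕ} (k : ℤ) (a : Fin n → ℤ) :
    latticeVec (k • a) = (k : ℝ) • latticeVec a := by
  funext i; simp

lemma IsPrimitiveVec.neg {v : Fin 2 → ℤ} (hv : IsPrimitiveVec v) : IsPrimitiveVec (-v) := by
  simpa [IsPrimitiveVec] using hv

lemma IsPrimitiveVec.perp {v : Fin 2 → ℤ} (hv : IsPrimitiveVec v) : IsPrimitiveVec (perp v) := by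
  simpa [IsPrimitiveVec, Int.gcd_comm] using hv

lemma IsPrimitiveVec.ne_zero {v : Fin 2 → ℤ} (hv : IsPrimitiveVec v) : v ≠ 0 := by
  rintro rfl
  simp [IsPrimitiveVec] at hv

lemma IsPrimitiveVec.exists_idot {v : Fin 2 → ℤ} (hv : IsPrimitiveVec v) :
    ∃ w : Fin 2 → ℤ, idot w v = 1 := by
  refine ⟨![Int.gcdA (v 0) (v 1), Int.gcdB (v 0) (v 1)], ?_⟩
  have := Int.gcd_eq_gcd_ab (v 0) (v 1)
  rw [hv] at this
  simp only [idot, Matrix.cons_val_zero, Matrix.cons_val_one]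
  push_cast at this
  linarith

lemma exists_primitive {a : Fin 2 → ℤ} (ha : a ≠ 0) :
    ∃ (k : ℤ) (n : Fin 2 → ℤ), 0 < k ∧ IsPrimitiveVec n ∧ a = k • n := by
  have hg : Int.gcd (a 0) (a 1) ≠ 0 := by
    rw [Ne, Int.gcd_eq_zero_iff]
    rintro ⟨h0, h1⟩
    exact ha (by funext i; fin_cases i <;> simp [h0, h1])
  refine ⟨Int.gcd (a 0) (a 1), ![a 0 / Int.gcd (a 0) (a 1), a 1 / Int.gcd (a 0) (a 1)],
    by positivity, ?_, ?_⟩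
  · simpa [IsPrimitiveVec] using Int.gcd_ediv_gcd_ediv_gcd (Nat.pos_of_ne_zero hg)
  · funext i
    fin_cases i
    · simpa using (Int.mul_ediv_cancel' (Int.gcd_dvd_left (a := a 0) (b := a 1))).symm
    · simpa using (Int.mul_ediv_cancel' (Int.gcd_dvd_right (a := a 0) (b := a 1))).symm

/-- A real vector annihilated by the primitive vector `n` is a multiple of `perp n`. -/
lemma eq_smul_perp {n w : Fin 2 → ℤ} (hw : idot w (perp n) = 1) {y : Fin 2 → ℝ}
    (hy : dot n y = 0) : y = dot w y • latticeVec (perp n) := by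
  simp only [idot, perp_zero, perp_one] at hw
  have hw' : (w 0 : ℝ) * -(n 1) + w 1 * n 0 = 1 := by exact_mod_cast hw
  simp only [dot] at hy
  funext i
  fin_cases i
  · simp [dot]; linear_combination (-y 0) * hw' + w 1 * hy
  · simp [dot]; linear_combination (-y 1) * hw' - w 0 * hy

lemma exists_eq_smul_perp {n : Fin 2 → ℤ} (hn : IsPrimitiveVec n) {y : Fin 2 → ℝ}
    (hy : dot n y = 0) : ∃ c : ℝ, y = c • latticeVec (perp n) := by
  obtain ⟨w, hw⟩ := hn.perp.exists_idot
  exact ⟨_, eq_smul_perp hw hy⟩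

/-- An integer vector with vanishing determinant against a primitive one is a multiple of it. -/
lemma exists_eq_zsmul {n a : Fin 2 → ℤ} (hn : IsPrimitiveVec n) (h : latticeDet n a = 0) :
    ∃ k : ℤ, a = k • n := by
  obtain ⟨w, hw⟩ := hn.exists_idot
  refine ⟨idot w a, ?_⟩
  simp only [idot] at hw
  simp only [latticeDet] at h
  funext i
  fin_cases i
  · simp [idot]; linear_combination (-a 0) * hw - w 1 * h
  · simp [idot]; linear_combination (-a 1) * hw + w 0 * h

lemma idot_perp (v w : Fin 2 → ℤ) : idot (perp v) w = latticeDet v w := by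
  simp [idot, latticeDet]; ring

/-- Parallel primitive vectors agree up to sign, and positivity of both factors rules out the minus
sign. Thus points on rays in different edge directions are distinct. -/
lemma smul_latticeVec_inj {u v : Fin 2 → ℤ} (hu : IsPrimitiveVec u) (hv : IsPrimitiveVec v)
    {s t : ℝ} (hs : 0 < s) (ht : 0 < t) (h : s • latticeVec u = t • latticeVec v) :
    u = v ∧ s = t := by
  have h0 : s * u 0 = t * v 0 := by simpa using congrFun h 0
  have h1 : s * u 1 = t * v 1 := by simpa using congrFun h 1
  have hd : latticeDet u v = 0 := by
    have : (s * t) * ((u 0 : ℝ) * v 1 - u 1 * v 0) = 0 := by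
      linear_combination t * v 1 * h0 - t * v 0 * h1
    have h2 : ((u 0 : ℝ) * v 1 - u 1 * v 0) = 0 := by
      rcases mul_eq_zero.1 this with h | h
      · exact absurd h (by positivity)
      · exact h
    simp only [latticeDet]
    exact_mod_cast h2
  obtain ⟨k, rfl⟩ := exists_eq_zsmul hu hd
  have hk : k.natAbs = 1 := by
    have := hv
    simp only [IsPrimitiveVec, Pi.smul_apply, smul_eq_mul, Int.gcd_mul_left] at this
    exact Nat.eq_one_of_mul_eq_one_right this
  obtain ⟨w, hw⟩ := hu.exists_idot
  have key : s = t * k := by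
    have := congrArg (dot w) h
    simp only [dot_smul, latticeVec_zsmul, dot_latticeVec, hw] at this
    simpa using this
  rcases Int.natAbs_eq k with h' | h'
  · rw [hk] at h'
    subst h'
    simp at key ⊢
    exact key
  · rw [hk] at h'
    subst h'
    simp at key
    linarith

namespace TropPoly

/-! ### Active exponents and local structure -/

lemma term_eq (f : TropPoly 2) (a : Fin 2 → ℤ) (x : Fin 2 → ℝ) :
    f.term a x = f.coeff a + dot a x := by
  simp [term, dot, Fin.sum_univ_two]

lemma term_add (f : TropPoly 2) (a : Fin 2 → ℤ) (x y : Fin 2 → ℝ) :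
    f.term a (x + y) = f.term a x + dot a y := by
  rw [term_eq, term_eq, dot_add]; ring

@[fun_prop] lemma continuous_term (f : TropPoly 2) (a : Fin 2 → ℤ) : Continuous (f.term a) := by
  have : f.term a = fun x => f.coeff a + dot a x := funext (f.term_eq a)
  rw [this]; fun_prop

lemma term_le_eval (f : TropPoly 2) {a : Fin 2 → ℤ} (ha : a ∈ f.support) (x : Fin 2 → ℝ) :
    f.term a x ≤ f.eval x := Finset.le_sup' (fun a => f.term a x) ha

lemma mem_activeSet {f : TropPoly 2} {a : Fin 2 → ℤ} {p : Fin 2 → ℝ} :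
    a ∈ f.activeSet p ↔ a ∈ f.support ∧ ∀ b ∈ f.support, f.term b p ≤ f.term a p := by
  constructor
  · rintro ⟨h1, h2⟩
    exact ⟨h1, fun b hb => h2 ▸ f.term_le_eval hb p⟩
  · rintro ⟨h1, h2⟩
    exact ⟨h1, le_antisymm (f.term_le_eval h1 p) (Finset.sup'_le _ _ h2)⟩

lemma activeSet_nonempty (f : TropPoly 2) (p : Fin 2 → ℝ) : (f.activeSet p).Nonempty := by
  obtain ⟨a, ha, h⟩ := Finset.exists_mem_eq_sup' f.support_nonempty (fun a => f.term a p)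
  exact ⟨a, ha, h.symm⟩

lemma activeSet_finite (f : TropPoly 2) (p : Fin 2 → ℝ) : (f.activeSet p).Finite :=
  f.support.finite_toSet.subset fun _ h => h.1

lemma term_eq_of_active {f : TropPoly 2} {a b : Fin 2 → ℤ} {p : Fin 2 → ℝ}
    (ha : a ∈ f.activeSet p) (hb : b ∈ f.activeSet p) : f.term a p = f.term b p :=
  ha.2.trans hb.2.symm

lemma term_lt_of_not_active {f : TropPoly 2} {a b : Fin 2 → ℤ} {p : Fin 2 → ℝ}
    (ha : a ∈ f.activeSet p) (hb : b ∈ f.support) (hb' : b ∉ f.activeSet p) :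
    f.term b p < f.term a p := by
  rw [ha.2]
  exact lt_of_le_of_ne (f.term_le_eval hb p) fun h => hb' ⟨hb, h⟩

lemma eventually_term_lt (f : TropPoly 2) (p : Fin 2 → ℝ) :
    ∀ᶠ y in 𝓝 (0 : Fin 2 → ℝ), ∀ a ∈ f.activeSet p, ∀ c ∈ f.support, c ∉ f.activeSet p →
      f.term c (p + y) < f.term a (p + y) := by
  rw [(f.activeSet_finite p).eventually_all]
  intro a ha
  rw [Finset.eventually_all]
  intro c hc
  by_cases hc' : c ∈ f.activeSet p
  · exact Eventually.of_forall fun y h => absurd hc' h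
  have h1 : Continuous fun y : Fin 2 → ℝ => f.term c (p + y) := by fun_prop
  have h2 : Continuous fun y : Fin 2 → ℝ => f.term a (p + y) := by fun_prop
  have : f.term c (p + 0) < f.term a (p + 0) := by
    simpa using term_lt_of_not_active ha hc hc'
  filter_upwards [h1.continuousAt.eventually_lt h2.continuousAt this] with y hy _ using hy

/-- Near `p`, the active set at `p + y` is the face of the active set at `p` in direction `y`. -/
lemma eventually_mem_activeSet (f : TropPoly 2) (p : Fin 2 → ℝ) :
    ∀ᶠ y in 𝓝 (0 : Fin 2 → ℝ), ∀ a, a ∈ f.activeSet (p + y) ↔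
      a ∈ f.activeSet p ∧ ∀ b ∈ f.activeSet p, dot b y ≤ dot a y := by
  filter_upwards [f.eventually_term_lt p] with y hy a
  constructor
  · intro h
    obtain ⟨a0, ha0⟩ := f.activeSet_nonempty p
    have ha : a ∈ f.activeSet p := by
      by_contra hc
      exact absurd ((mem_activeSet.1 h).2 a0 ha0.1) (not_le.2 (hy a0 ha0 a h.1 hc))
    refine ⟨ha, fun b hb => ?_⟩
    have := (mem_activeSet.1 h).2 b hb.1
    rw [term_add, term_add, term_eq_of_active ha hb] at this
    linarith
  · rintro ⟨ha, h⟩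
    refine mem_activeSet.2 ⟨ha.1, fun b hb => ?_⟩
    by_cases hb' : b ∈ f.activeSet p
    · rw [term_add, term_add, term_eq_of_active ha hb']
      linarith [h b hb']
    · exact (hy a ha b hb hb').le

lemma exists_ball_activeSet (f : TropPoly 2) (p : Fin 2 → ℝ) :
    ∃ ε > 0, ∀ y : Fin 2 → ℝ, ‖y‖ < ε → ∀ a, a ∈ f.activeSet (p + y) ↔
      a ∈ f.activeSet p ∧ ∀ b ∈ f.activeSet p, dot b y ≤ dot a y := by
  obtain ⟨ε, hε, h⟩ := Metric.eventually_nhds_iff.1 (f.eventually_mem_activeSet p)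
  exact ⟨ε, hε, fun y hy => h (by simpa using hy)⟩

lemma tendsto_smul_nhdsGT (v : Fin 2 → ℝ) :
    Tendsto (fun t : ℝ => t • v) (𝓝[>] 0) (𝓝 0) := by
  have : Continuous fun t : ℝ => t • v := by fun_prop
  simpa using (this.tendsto 0).mono_left nhdsWithin_le_nhds

/-- The face of the active set at `p` in direction `v`. -/
def face (f : TropPoly 2) (p : Fin 2 → ℝ) (v : Fin 2 → ℤ) : Set (Fin 2 → ℤ) :=
  {a | a ∈ f.activeSet p ∧ ∀ b ∈ f.activeSet p, idot b v ≤ idot a v}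

lemma eventually_activeSet_eq_face (f : TropPoly 2) (p : Fin 2 → ℝ) (v : Fin 2 → ℤ) :
    ∀ᶠ t in 𝓝[>] (0 : ℝ), f.activeSet (p + t • latticeVec v) = f.face p v := by
  filter_upwards [(tendsto_smul_nhdsGT (latticeVec v)).eventually (f.eventually_mem_activeSet p),
    self_mem_nhdsWithin] with t ht ht0
  ext a
  rw [ht a]
  simp only [face, Set.mem_ofPred_eq, dot_smul, dot_latticeVec]
  refine and_congr_right fun _ => forall₂_congr fun b _ => ?_
  rw [mul_le_mul_iff_right₀ (Set.mem_Ioi.1 ht0)]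
  exact Int.cast_le

lemma eventually_eval_eq_term {f : TropPoly 2} {p : Fin 2 → ℝ} {a : Fin 2 → ℤ}
    (h : f.activeSet p = {a}) : ∀ᶠ y in 𝓝 p, f.eval y = f.term a y := by
  have h1 := f.eventually_mem_activeSet p
  have : Tendsto (fun y : Fin 2 → ℝ => y - p) (𝓝 p) (𝓝 0) := by
    have : Continuous fun y : Fin 2 → ℝ => y - p := by fun_prop
    simpa using this.tendsto p
  filter_upwards [this.eventually h1] with y hy
  have := (hy a).2 ⟨by simp [h], by simp [h]⟩
  rw [add_sub_cancel] at this
  exact this.2.symm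

/-- If the function is affine with slope `w` near `p`, every active monomial lies below it and
touches it at `p`, so its exponent must be `w`. Conversely a single active monomial dominates in a
neighbourhood. -/
lemma mem_variety_iff {f : TropPoly 2} {p : Fin 2 → ℝ} :
    p ∈ f.variety ↔ (f.activeSet p).Nontrivial := by
  rw [← not_iff_not, Set.not_nontrivial_iff]
  simp only [variety, Set.mem_ofPred_eq, not_not]
  constructor
  · rintro ⟨w, c, h⟩ a ha b hb
    have key : ∀ a ∈ f.activeSet p, ∀ i : Fin 2, (a i : ℝ) = w i := by
      intro a ha i
      have hp := h.self_of_nhds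
      have hc : ∀ s : ℝ, Tendsto (fun t : ℝ => p + t • (s • Pi.single i 1 : Fin 2 → ℝ))
          (𝓝[>] 0) (𝓝 p) := by
        intro s
        have : Continuous (fun t : ℝ => p + t • (s • Pi.single i 1 : Fin 2 → ℝ)) := by fun_prop
        simpa using (this.tendsto 0).mono_left nhdsWithin_le_nhds
      -- Taking both signs of `s` turns this inequality into the equality of the slopes.
      have hs : ∀ s : ℝ, s * a i ≤ s * w i := by
        intro s
        obtain ⟨t, ht, ht0⟩ := (((hc s).eventually h).and self_mem_nhdsWithin).exists
        have h1 := f.term_le_eval ha.1 (p + t • (s • Pi.single i 1 : Fin 2 → ℝ))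
        rw [ht, term_add, ha.2, hp] at h1
        have ht0 : 0 < t := ht0
        have h2 : t * (s * a i) ≤ t * (s * w i) := by
          fin_cases i <;> simp [dot, Fin.sum_univ_two] at h1 ⊢ <;> linarith
        exact le_of_mul_le_mul_left h2 ht0
      linarith [hs 1, hs (-1)]
    funext i
    exact_mod_cast (key a ha i).trans (key b hb i).symm
  · intro h
    obtain ⟨a, ha⟩ := f.activeSet_nonempty p
    have : f.activeSet p = {a} := h.eq_singleton_of_mem ha
    refine ⟨latticeVec a, f.coeff a, ?_⟩
    filter_upwards [eventually_eval_eq_term this] with y hy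
    rw [hy, term_eq]
    simp [dot, Fin.sum_univ_two, add_comm]

/-- The exponents active just beyond `p` in direction `v` form the face of the active set in that
direction; this makes the analytic notion of an edge combinatorial. -/
lemma isEdgeDirection_iff {f : TropPoly 2} {p : Fin 2 → ℝ} {v : Fin 2 → ℤ} :
    f.IsEdgeDirection p v ↔ IsPrimitiveVec v ∧ (f.face p v).Nontrivial := by
  refine and_congr_right fun _ => ?_
  constructor
  · intro h
    obtain ⟨t, h1, h2⟩ := (h.and (f.eventually_activeSet_eq_face p v)).exists
    rw [← h2]
    exact mem_variety_iff.1 h1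
  · intro h
    filter_upwards [f.eventually_activeSet_eq_face p v] with t ht
    exact mem_variety_iff.2 (ht ▸ h)

/-- Two distinct exponents equally active in direction `y` force `y` to lie on an edge. -/
lemma exists_isEdgeDirection {f : TropPoly 2} {p y : Fin 2 → ℝ} (hy : y ≠ 0) {a b : Fin 2 → ℤ}
    (hab : a ≠ b) (ha : a ∈ f.activeSet p) (hb : b ∈ f.activeSet p) (h : dot a y = dot b y)
    (hmax : ∀ c ∈ f.activeSet p, dot c y ≤ dot a y) :
    ∃ u, f.IsEdgeDirection p u ∧ ∃ t : ℝ, 0 < t ∧ y = t • latticeVec u := by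
  obtain ⟨k, n, hk, hn, hkn⟩ := exists_primitive (sub_ne_zero.2 hab)
  have h0 : dot n y = 0 := by
    have : dot (a - b) y = 0 := by rw [sub_dot, h, sub_self]
    rw [hkn] at this
    have h2 : (k : ℝ) * dot n y = 0 := by simpa [dot, mul_add, mul_assoc] using this
    rcases mul_eq_zero.1 h2 with h3 | h3
    · exact absurd (by exact_mod_cast h3 : k = 0) hk.ne'
    · exact h3
  have main : ∀ u : Fin 2 → ℤ, IsPrimitiveVec u → ∀ t : ℝ, 0 < t → y = t • latticeVec u →
      ∃ u, f.IsEdgeDirection p u ∧ ∃ t : ℝ, 0 < t ∧ y = t • latticeVec u := by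
    intro u hu t ht hyt
    refine ⟨u, isEdgeDirection_iff.2 ⟨hu, ?_⟩, t, ht, hyt⟩
    have hle : ∀ c ∈ f.activeSet p, idot c u ≤ idot a u := by
      intro c hc
      have := hmax c hc
      rw [hyt, dot_smul, dot_smul, dot_latticeVec, dot_latticeVec] at this
      exact_mod_cast le_of_mul_le_mul_left this ht
    have heq : idot a u = idot b u := by
      rw [hyt, dot_smul, dot_smul, dot_latticeVec, dot_latticeVec] at h
      exact_mod_cast mul_left_cancel₀ ht.ne' h
    exact ⟨a, ⟨ha, hle⟩, b, ⟨hb, fun c hc => heq ▸ hle c hc⟩, hab⟩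
  obtain ⟨c, hc⟩ := exists_eq_smul_perp hn h0
  rcases lt_trichotomy c 0 with h1 | h1 | h1
  · refine main (-perp n) hn.perp.neg (-c) (by linarith) ?_
    rw [latticeVec_neg, hc]; simp
  · exact absurd (by rw [hc, h1, zero_smul]) hy
  · exact main _ hn.perp c h1 hc

/-- Near a point, a curve consists of segments in the edge directions. -/
lemma exists_ball_conic (f : TropPoly 2) (p : Fin 2 → ℝ) :
    ∃ ε > 0, (∀ y : Fin 2 → ℝ, ‖y‖ < ε → y ≠ 0 → p + y ∈ f.variety →
        ∃ u, f.IsEdgeDirection p u ∧ ∃ t : ℝ, 0 < t ∧ y = t • latticeVec u) ∧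
      ∀ (u : Fin 2 → ℤ) (t : ℝ), 0 < t → ‖t • latticeVec u‖ < ε →
        f.activeSet (p + t • latticeVec u) = f.face p u := by
  obtain ⟨ε, hε, h⟩ := f.exists_ball_activeSet p
  refine ⟨ε, hε, fun y hy hy0 hp => ?_, fun u t ht htu => ?_⟩
  · obtain ⟨a, ha, b, hb, hab⟩ := mem_variety_iff.1 hp
    have ha' := (h y hy a).1 ha
    have hb' := (h y hy b).1 hb
    exact exists_isEdgeDirection hy0 hab ha'.1 hb'.1
      (le_antisymm (hb'.2 a ha'.1) (ha'.2 b hb'.1)) ha'.2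
  · ext a
    rw [h _ htu a]
    simp only [face, Set.mem_ofPred_eq, dot_smul, dot_latticeVec]
    refine and_congr_right fun _ => forall₂_congr fun b _ => ?_
    rw [mul_le_mul_iff_right₀ ht]
    exact Int.cast_le

lemma isClosed_setOf_active (f : TropPoly 2) (a : Fin 2 → ℤ) :
    IsClosed {x | a ∈ f.activeSet x} := by
  by_cases ha : a ∈ f.support
  · have : {x | a ∈ f.activeSet x} = ⋂ b ∈ f.support, {x | f.term b x ≤ f.term a x} := by
      ext x; simp [mem_activeSet, ha]
    rw [this]
    exact isClosed_biInter fun b _ => isClosed_le (by fun_prop) (by fun_prop)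
  · have : {x | a ∈ f.activeSet x} = ∅ := by
      ext x; simp [mem_activeSet, ha]
    rw [this]; exact isClosed_empty

/-- Off the curve a single exponent stays active along a preconnected set. -/
lemma active_of_isPreconnected {f : TropPoly 2} {S : Set (Fin 2 → ℝ)} (hS : IsPreconnected S)
    (hSV : ∀ x ∈ S, x ∉ f.variety) {x y : Fin 2 → ℝ} (hx : x ∈ S) (hy : y ∈ S) {a : Fin 2 → ℤ}
    (ha : a ∈ f.activeSet x) : a ∈ f.activeSet y := by
  have key : ∀ z ∈ S, ∀ᶠ w in 𝓝[S] z, (a ∈ f.activeSet z ↔ a ∈ f.activeSet w) := by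
    intro z hz
    obtain ⟨b, hb⟩ := f.activeSet_nonempty z
    have hs : f.activeSet z = {b} :=
      (Set.not_nontrivial_iff.1 fun h => hSV z hz (mem_variety_iff.2 h)).eq_singleton_of_mem hb
    have : Tendsto (fun y : Fin 2 → ℝ => y - z) (𝓝 z) (𝓝 0) := by
      have : Continuous fun y : Fin 2 → ℝ => y - z := by fun_prop
      simpa using this.tendsto z
    filter_upwards [nhdsWithin_le_nhds (this.eventually (f.eventually_mem_activeSet z))] with w hw
    have := hw a
    rw [add_sub_cancel] at this
    rw [this, hs]
    simp only [Set.mem_singleton_iff, forall_eq]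
    constructor
    · rintro rfl; exact ⟨rfl, le_rfl⟩
    · exact fun h => h.1
  exact (hS.induction₂ (fun z w => (a ∈ f.activeSet z ↔ a ∈ f.activeSet w)) key
    (fun _ _ _ _ _ _ h1 h2 => h1.trans h2) (fun _ _ _ _ h => h.symm) hx hy).1 ha

end TropPoly

/-! ### Orthogonality and determinants of integer vectors -/

lemma idot_comm (a b : Fin 2 → ℤ) : idot a b = idot b a := by simp [idot]; ring
lemma idot_neg (a b : Fin 2 → ℤ) : idot a (-b) = -idot a b := by simp [idot]; ring
lemma idot_add (a b c : Fin 2 → ℤ) : idot a (b + c) = idot a b + idot a c := by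
  simp [idot]; ring
lemma add_idot (a b c : Fin 2 → ℤ) : idot (a + b) c = idot a c + idot b c := by
  simp [idot]; ring
lemma sub_idot (a b c : Fin 2 → ℤ) : idot (a - b) c = idot a c - idot b c := by
  simp [idot]; ring
lemma zsmul_idot (k : ℤ) (a c : Fin 2 → ℤ) : idot (k • a) c = k * idot a c := by
  simp [idot]; ring
lemma idot_perp_self (u : Fin 2 → ℤ) : idot (perp u) u = 0 := by simp [idot]; ring

/-- A primitive vector orthogonal to the primitive vector `u` is a multiple of `perp u`. -/
lemma exists_eq_zsmul_perp {u a : Fin 2 → ℤ} (hu : IsPrimitiveVec u) (h : idot a u = 0) :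
    ∃ k : ℤ, a = k • perp u := by
  refine exists_eq_zsmul hu.perp ?_
  simp only [idot] at h
  simp only [latticeDet, perp_zero, perp_one]
  linarith

lemma eq_or_eq_neg_of_latticeDet {u v : Fin 2 → ℤ} (hu : IsPrimitiveVec u) (hv : IsPrimitiveVec v)
    (h : latticeDet u v = 0) : v = u ∨ v = -u := by
  obtain ⟨k, rfl⟩ := exists_eq_zsmul hu h
  have hk : k.natAbs = 1 := by
    have := hv
    simp only [IsPrimitiveVec, Pi.smul_apply, smul_eq_mul, Int.gcd_mul_left] at this
    exact Nat.eq_one_of_mul_eq_one_right this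
  rcases Int.natAbs_eq k with h' | h' <;> rw [hk] at h' <;> subst h' <;> simp

/-! ### Vertices, edges and weights -/

namespace TropPoly

/-- Taking the convex hull does not change the affine span. -/
lemma isVertex_iff {f : TropPoly 2} {p : Fin 2 → ℝ} :
    f.IsVertex p ↔ ¬ Collinear ℝ (latticeVec '' f.activeSet p) := by
  rw [IsVertex, dualCell, Collinear, Collinear, ← direction_affineSpan, affineSpan_convexHull,
    direction_affineSpan]

/-- `q` lies in the relative interior of an edge of `V(f)` with primitive direction `u`. -/
def OnEdge (f : TropPoly 2) (q : Fin 2 → ℝ) (u : Fin 2 → ℤ) : Prop :=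
  IsPrimitiveVec u ∧ (f.activeSet q).Nontrivial ∧
    ∀ b ∈ f.activeSet q, ∀ c ∈ f.activeSet q, idot b u = idot c u

variable {f : TropPoly 2} {p q : Fin 2 → ℝ} {u v : Fin 2 → ℤ}

lemma OnEdge.mem_variety (h : f.OnEdge q u) : q ∈ f.variety := mem_variety_iff.2 h.2.1

lemma OnEdge.neg (h : f.OnEdge q u) : f.OnEdge q (-u) :=
  ⟨h.1.neg, h.2.1, fun b hb c hc => by rw [idot_neg, idot_neg, h.2.2 b hb c hc]⟩

/-- A nonzero functional that is constant on the active exponents confines them to one of its level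
lines. -/
lemma not_isVertex_of_idot_eq {w : Fin 2 → ℤ} (hw : w ≠ 0)
    (h : ∀ b ∈ f.activeSet q, ∀ c ∈ f.activeSet q, idot b w = idot c w) : ¬ f.IsVertex q := by
  rw [isVertex_iff, not_not]
  obtain ⟨k, u, hk, hu, rfl⟩ := exists_primitive hw
  obtain ⟨a, ha⟩ := f.activeSet_nonempty q
  rw [collinear_iff_of_mem (Set.mem_image_of_mem latticeVec ha)]
  refine ⟨latticeVec (perp u), ?_⟩
  rintro _ ⟨c, hc, rfl⟩
  have h0 : idot (c - a) u = 0 := by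
    have := h c hc a ha
    rw [idot_comm c, idot_comm a, zsmul_idot, zsmul_idot] at this
    rw [sub_idot, idot_comm c, idot_comm a, mul_left_cancel₀ hk.ne' this, sub_self]
  obtain ⟨i, hi⟩ := exists_eq_zsmul_perp hu h0
  refine ⟨i, ?_⟩
  rw [← latticeVec_zsmul, ← hi, vadd_eq_add, ← latticeVec_add, sub_add_cancel]

lemma OnEdge.not_isVertex (h : f.OnEdge q u) : ¬ f.IsVertex q :=
  not_isVertex_of_idot_eq h.1.ne_zero h.2.2

/-- The active exponents are collinear and at least two in number; the edge runs perpendicular to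
their line. -/
lemma exists_onEdge (hq : q ∈ f.variety) (hv : ¬ f.IsVertex q) : ∃ u, f.OnEdge q u := by
  rw [isVertex_iff, not_not] at hv
  have hnt := mem_variety_iff.1 hq
  obtain ⟨a, ha, b, hb, hab⟩ := hnt
  obtain ⟨k, n, hk, hn, hkn⟩ := exists_primitive (sub_ne_zero.2 hab.symm)
  have hcol := (collinear_iff_of_mem (Set.mem_image_of_mem latticeVec ha)).1 hv
  obtain ⟨v, hv⟩ := hcol
  have key : ∀ c ∈ f.activeSet q, idot c (perp n) = idot a (perp n) := by
    intro c hc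
    obtain ⟨r, hr⟩ := hv _ (Set.mem_image_of_mem latticeVec hb)
    obtain ⟨s, hs⟩ := hv _ (Set.mem_image_of_mem latticeVec hc)
    have hr0 := congrFun hr 0
    have hr1 := congrFun hr 1
    have hs0 := congrFun hs 0
    have hs1 := congrFun hs 1
    have h0 := congrFun hkn 0
    have h1 := congrFun hkn 1
    simp at hr0 hr1 hs0 hs1 h0 h1
    have h0' : (b 0 : ℝ) - a 0 = k * n 0 := by exact_mod_cast h0
    have h1' : (b 1 : ℝ) - a 1 = k * n 1 := by exact_mod_cast h1
    have : (k : ℝ) * ((c 0 : ℝ) * -(n 1) + c 1 * n 0) = k * ((a 0 : ℝ) * -(n 1) + a 1 * n 0) := by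
      have e : ((c 1 : ℝ) - a 1) * (k * n 0) - (c 0 - a 0) * (k * n 1) = 0 := by
        rw [← h0', ← h1', hr0, hr1, hs0, hs1]; ring
      linarith
    have hk' : (k : ℝ) ≠ 0 := by exact_mod_cast hk.ne'
    have := mul_left_cancel₀ hk' this
    simp only [idot, perp_zero, perp_one]
    exact_mod_cast this
  exact ⟨perp n, hn.perp, ⟨a, ha, b, hb, hab⟩, fun b hb c hc => (key b hb).trans (key c hc).symm⟩

lemma OnEdge.face_eq (h : f.OnEdge q u) : f.face q u = f.activeSet q :=
  Set.ext fun _ => ⟨fun h => h.1, fun ha => ⟨ha, fun b hb => (h.2.2 b hb _ ha).le⟩⟩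

/-- All differences of active exponents are multiples of `perp u`, so two distinct ones pair equally
with `v` only if `v` is parallel to `u`. -/
lemma OnEdge.isEdgeDirection_iff (h : f.OnEdge q u) :
    f.IsEdgeDirection q v ↔ v = u ∨ v = -u := by
  rw [TropPoly.isEdgeDirection_iff]
  constructor
  · rintro ⟨hv, a, ha, b, hb, hab⟩
    have e : idot a v = idot b v := le_antisymm (hb.2 a ha.1) (ha.2 b hb.1)
    obtain ⟨k, hk⟩ := exists_eq_zsmul_perp h.1
      (show idot (a - b) u = 0 by rw [sub_idot, h.2.2 a ha.1 b hb.1, sub_self])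
    have hk0 : k ≠ 0 := by
      rintro rfl
      exact hab (sub_eq_zero.1 (by simpa using hk))
    have e2 : idot (a - b) v = 0 := by rw [sub_idot, e, sub_self]
    rw [hk, zsmul_idot, idot_perp] at e2
    exact eq_or_eq_neg_of_latticeDet h.1 hv ((mul_eq_zero.1 e2).resolve_left hk0)
  · rintro (rfl | rfl)
    · exact ⟨h.1, h.face_eq ▸ h.2.1⟩
    · exact ⟨h.1.neg, h.neg.face_eq ▸ h.2.1⟩

lemma onEdge_of_activeSet_eq_face (hu : f.IsEdgeDirection p u)
    (h : f.activeSet q = f.face p u) : f.OnEdge q u := by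
  rw [TropPoly.isEdgeDirection_iff] at hu
  refine ⟨hu.1, h ▸ hu.2, ?_⟩
  rw [h]
  exact fun b hb c hc => le_antisymm (hc.2 b hb.1) (hb.2 c hc.1)

/-- The active exponents on an edge, and its weight. -/
lemma OnEdge.exists_weight (h : f.OnEdge q u) :
    ∃ (A : Fin 2 → ℤ) (w : ℕ), 1 ≤ w ∧ f.weight q = w ∧ A ∈ f.activeSet q ∧
      A + (w : ℤ) • perp u ∈ f.activeSet q ∧
      ∀ c ∈ f.activeSet q, ∃ i : ℤ, 0 ≤ i ∧ i ≤ w ∧ c = A + i • perp u := by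
  obtain ⟨hu, hnt, heq⟩ := h
  obtain ⟨w0, hw0⟩ := hu.perp.exists_idot
  obtain ⟨A, hA, hmin⟩ := Set.exists_min_image (f.activeSet q) (fun a => idot a w0)
    (f.activeSet_finite q) (f.activeSet_nonempty q)
  obtain ⟨B, hB, hmax⟩ := Set.exists_max_image (f.activeSet q) (fun a => idot a w0)
    (f.activeSet_finite q) (f.activeSet_nonempty q)
  have hpar : ∀ c ∈ f.activeSet q, c = A + (idot c w0 - idot A w0) • perp u := by
    intro c hc
    obtain ⟨i, hi⟩ := exists_eq_zsmul_perp hu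
      (show idot (c - A) u = 0 by rw [sub_idot, heq c hc A hA, sub_self])
    have : idot c w0 - idot A w0 = i := by
      rw [← sub_idot, hi, zsmul_idot, idot_comm, hw0, mul_one]
    rw [this, ← hi]; abel
  have hAB : idot A w0 < idot B w0 := by
    refine lt_of_le_of_ne (hmin B hB) fun h => ?_
    obtain ⟨a, ha, b, hb, hab⟩ := hnt
    have ea : idot a w0 = idot A w0 := le_antisymm (h ▸ hmax a ha) (hmin a ha)
    have eb : idot b w0 = idot A w0 := le_antisymm (h ▸ hmax b hb) (hmin b hb)
    refine hab ((hpar a ha).trans ((hpar b hb).trans ?_).symm)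
    rw [ea, eb]
  obtain ⟨w, hw⟩ := Int.eq_ofNat_of_zero_le (sub_nonneg.2 hAB.le)
  have hw1 : 1 ≤ w := by omega
  have hBw : B = A + (w : ℤ) • perp u := by rw [← hw]; exact hpar B hB
  refine ⟨A, w, hw1, ?_, hA, hBw ▸ hB, fun c hc =>
    ⟨_, sub_nonneg.2 (hmin c hc), ?_, hpar c hc⟩⟩
  swap
  · have := hmax c hc
    omega
  have hdual : f.dualCell q = segment ℝ (latticeVec A) (latticeVec B) := by
    apply Set.Subset.antisymm
    · refine convexHull_min ?_ (convex_segment _ _)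
      rintro _ ⟨c, hc, rfl⟩
      rw [segment_eq_image']
      have hw' : (0 : ℝ) < w := by exact_mod_cast hw1
      have e1 : ((idot c w0 - idot A w0 : ℤ) : ℝ) ≤ w := by
        have := hmax c hc
        exact_mod_cast (by omega : idot c w0 - idot A w0 ≤ w)
      have e0 : (0 : ℝ) ≤ ((idot c w0 - idot A w0 : ℤ) : ℝ) := by
        exact_mod_cast sub_nonneg.2 (hmin c hc)
      refine ⟨((idot c w0 - idot A w0 : ℤ) : ℝ) / w, ⟨by positivity, ?_⟩, ?_⟩
      · rw [div_le_one hw']; exact e1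
      · conv_rhs => rw [hpar c hc]
        simp only [hBw]
        rw [latticeVec_add, latticeVec_add, latticeVec_zsmul, latticeVec_zsmul, add_sub_cancel_left,
          smul_smul]
        congr 2
        push_cast
        field_simp
    · exact segment_subset_convexHull (Set.mem_image_of_mem _ hA) (Set.mem_image_of_mem _ hB)
  have hset : {a : Fin 2 → ℤ | latticeVec a ∈ f.dualCell q} =
      (fun i : ℤ => A + i • perp u) '' (Finset.Icc (0 : ℤ) w : Set ℤ) := by
    ext a
    rw [Set.mem_ofPred_eq, hdual, segment_eq_image', hBw, latticeVec_add, add_sub_cancel_left]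
    simp only [Set.mem_image, Finset.coe_Icc, Set.mem_Icc]
    constructor
    · rintro ⟨θ, ⟨h0, h1⟩, hθ⟩
      have hd : dot u (latticeVec A + θ • latticeVec ((w : ℤ) • perp u)) = idot A u := by
        rw [dot_add, dot_smul, dot_latticeVec, dot_latticeVec, idot_comm u (_ • _), zsmul_idot,
          idot_perp_self, idot_comm]
        simp
      rw [hθ, dot_latticeVec, idot_comm] at hd
      have hd' : idot a u = idot A u := by exact_mod_cast hd
      obtain ⟨k, hk⟩ := exists_eq_zsmul_perp hu
        (show idot (a - A) u = 0 by rw [sub_idot, hd', sub_self])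
      refine ⟨k, ?_, by rw [← hk]; abel⟩
      have e := congrArg (dot w0) hθ
      rw [dot_add, dot_smul, dot_latticeVec, dot_latticeVec, dot_latticeVec,
        idot_comm w0 (_ • _), zsmul_idot, idot_comm _ w0, hw0,
        (by rw [← hk]; abel : a = A + k • perp u), idot_add, idot_comm w0 (_ • _), zsmul_idot,
        idot_comm _ w0, hw0] at e
      push_cast at e
      have e2 : (k : ℝ) = θ * w := by linarith
      have hw' : (0 : ℝ) < w := by exact_mod_cast hw1
      constructor
      · have : (0 : ℝ) ≤ k := by rw [e2]; positivity
        exact_mod_cast this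
      · have : (k : ℝ) ≤ w := by rw [e2]; nlinarith
        exact_mod_cast this
    · rintro ⟨k, ⟨h0, h1⟩, rfl⟩
      have hw' : (0 : ℝ) < w := by exact_mod_cast hw1
      have h0' : (0 : ℝ) ≤ k := by exact_mod_cast h0
      have h1' : (k : ℝ) ≤ w := by exact_mod_cast h1
      refine ⟨k / w, ⟨by positivity, by rw [div_le_one hw']; exact h1'⟩, ?_⟩
      rw [latticeVec_add, latticeVec_zsmul, latticeVec_zsmul, smul_smul]
      congr 2
      push_cast
      field_simp
  have hinj : Function.Injective (fun i : ℤ => A + i • perp u) := by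
    intro i j hij
    have := congrArg (idot w0) (add_left_cancel hij)
    rwa [idot_comm w0, idot_comm w0, zsmul_idot, zsmul_idot, idot_comm _ w0, hw0, mul_one,
      mul_one] at this
  rw [weight, hset, Set.ncard_image_of_injective _ hinj, Set.ncard_coe_finset, Int.card_Icc]
  omega

lemma weight_congr (h : f.activeSet p = f.activeSet q) : f.weight p = f.weight q := by
  simp only [weight, dualCell, h]

lemma exists_hasEdgeWeight (f : TropPoly 2) (p : Fin 2 → ℝ) (v : Fin 2 → ℤ) :
    ∃ m, f.HasEdgeWeight p v m := by
  obtain ⟨t, ht⟩ := (f.eventually_activeSet_eq_face p v).exists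
  refine ⟨f.weight (p + t • latticeVec v), ?_⟩
  filter_upwards [f.eventually_activeSet_eq_face p v] with s hs
  exact weight_congr (hs.trans ht.symm)

/-- Following an edge that is not a full line, one reaches a vertex. -/
lemma OnEdge.exists_vertex (h : f.OnEdge p u)
    (hflat : ∃ a ∈ f.support, ∃ b ∈ f.support, idot a u ≠ idot b u) :
    ∃ x v, f.IsVertex x ∧ f.IsEdgeDirection x v ∧ f.face x v = f.activeSet p := by
  -- If the exponents active at `p` stayed active along the whole line, comparing slopes would force
  -- every exponent of the support to have the same pairing with `u`, against `hflat`.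
  have hE : ∃ s : ℝ, ¬ f.activeSet p ⊆ f.activeSet (p + s • latticeVec u) := by
    by_contra! hcon
    obtain ⟨a0, ha0⟩ := f.activeSet_nonempty p
    have key : ∀ c ∈ f.support, idot c u = idot a0 u := by
      intro c hc
      have hs : ∀ s : ℝ, f.term c p + s * idot c u ≤ f.term a0 p + s * idot a0 u := by
        intro s
        have := (mem_activeSet.1 (hcon s ha0)).2 c hc
        rwa [term_add, term_add, dot_smul, dot_smul, dot_latticeVec, dot_latticeVec] at this
      by_contra hne
      have hne' : ((idot a0 u : ℝ) - idot c u) ≠ 0 := by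
        rw [sub_ne_zero]; exact_mod_cast (Ne.symm hne)
      have := hs ((f.term c p - f.term a0 p - 1) / (idot a0 u - idot c u))
      have e : (f.term c p - f.term a0 p - 1) / (idot a0 u - idot c u) *
          (idot a0 u - idot c u) = f.term c p - f.term a0 p - 1 := div_mul_cancel₀ _ hne'
      linarith
    obtain ⟨a, ha, b, hb, hab⟩ := hflat
    exact hab ((key a ha).trans (key b hb).symm)
  have main : ∀ u : Fin 2 → ℤ, f.OnEdge p u →
      (∃ s : ℝ, 0 ≤ s ∧ ¬ f.activeSet p ⊆ f.activeSet (p + s • latticeVec u)) →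
      ∃ x v, f.IsVertex x ∧ f.IsEdgeDirection x v ∧ f.face x v = f.activeSet p := by
    rintro u h ⟨s1, hs1, hns⟩
    set E : Set ℝ := {s | s ∈ Set.Icc 0 s1 ∧ f.activeSet p ⊆ f.activeSet (p + s • latticeVec u)}
    have hEc : IsCompact E := by
      refine isCompact_Icc.inter_right (s := Set.Icc 0 s1)
        (t := {s | f.activeSet p ⊆ f.activeSet (p + s • latticeVec u)}) ?_
      have : {s : ℝ | f.activeSet p ⊆ f.activeSet (p + s • latticeVec u)} =
          ⋂ a ∈ f.activeSet p, (fun s : ℝ => p + s • latticeVec u) ⁻¹' {x | a ∈ f.activeSet x} := by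
        ext s; simp [Set.subset_def]
      rw [this]
      exact isClosed_biInter fun a _ => (f.isClosed_setOf_active a).preimage (by fun_prop)
    obtain ⟨s, hsE, hmax⟩ := hEc.exists_isGreatest ⟨0, ⟨le_rfl, hs1⟩, by simp⟩
    have hlt : s < s1 := lt_of_le_of_ne hsE.1.2 fun h => hns (h ▸ hsE.2)
    set x := p + s • latticeVec u with hx
    -- If the last point were interior to an edge, that edge would again be parallel to `u`, and the
    -- exponents would remain active a little further.
    have hvx : f.IsVertex x := by
      by_contra hnv
      have hxV : x ∈ f.variety := mem_variety_iff.2 (h.2.1.mono hsE.2)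
      obtain ⟨w, hw⟩ := exists_onEdge hxV hnv
      have hwu : w = u ∨ w = -u := by
        have : f.OnEdge p w :=
          ⟨hw.1, h.2.1, fun b hb c hc => hw.2.2 b (hsE.2 hb) c (hsE.2 hc)⟩
        exact h.isEdgeDirection_iff.1 (this.isEdgeDirection_iff.2 (Or.inl rfl))
      have hxu : f.OnEdge x u := by
        rcases hwu with rfl | rfl
        · exact hw
        · simpa using hw.neg
      have hev := f.eventually_activeSet_eq_face x u
      rw [hxu.face_eq] at hev
      obtain ⟨t, ht, ht0, ht1⟩ := (hev.and (Ioo_mem_nhdsGT (sub_pos.2 hlt))).exists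
      have : s + t ∈ E := by
        refine ⟨⟨by linarith [hsE.1.1], by linarith⟩, ?_⟩
        have e : p + (s + t) • latticeVec u = x + t • latticeVec u := by rw [hx, add_smul, add_assoc]
        rw [e, ht]
        exact hsE.2
      linarith [hmax this]
    have hs0 : 0 < s := by
      refine lt_of_le_of_ne hsE.1.1 fun h0 => h.not_isVertex ?_
      have : x = p := by rw [hx, ← h0, zero_smul, add_zero]
      exact this ▸ hvx
    obtain ⟨t, ht, ht0, ht1⟩ :=
      ((f.eventually_activeSet_eq_face x (-u)).and (Ioo_mem_nhdsGT hs0)).exists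
    have hface : f.face x (-u) = f.activeSet p := by
      rw [← ht]
      have e : x + t • latticeVec (-u) = p + (s - t) • latticeVec u := by
        rw [hx, latticeVec_neg, sub_smul, smul_neg]; abel
      rw [e]
      have hterm : ∀ (a : Fin 2 → ℤ) (r : ℝ),
          f.term a (p + r • latticeVec u) = f.term a p + r * idot a u := fun a r => by
        rw [term_add, dot_smul, dot_latticeVec]
      -- Differences of monomials are affine along the line. An exponent tied with the maximum
      -- strictly between `p` and `x`, and not above it at either end, is tied at `p`; conversely,
      -- maximality at `p` and `x` persists in between.
      ext c
      constructor
      · intro hc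
        obtain ⟨a, ha⟩ := f.activeSet_nonempty p
        have h1 := (mem_activeSet.1 ha).2 c hc.1
        have h2 := (mem_activeSet.1 (hsE.2 ha)).2 c hc.1
        have h3 := (mem_activeSet.1 hc).2 a ha.1
        rw [hterm, hterm] at h2
        rw [hterm, hterm] at h3
        have h4 : f.term a p ≤ f.term c p := by
          have hst : 0 < s - t := by linarith
          by_contra! hlt
          nlinarith
        exact mem_activeSet.2 ⟨hc.1, fun b hb => ((mem_activeSet.1 ha).2 b hb).trans h4⟩
      · intro hc
        refine mem_activeSet.2 ⟨hc.1, fun b hb => ?_⟩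
        have h1 := (mem_activeSet.1 hc).2 b hb
        have h2 := (mem_activeSet.1 (hsE.2 hc)).2 b hb
        rw [hterm, hterm] at h2
        rw [hterm, hterm]
        have hst : 0 < s - t := by linarith
        have : 0 ≤ s * ((f.term c p + (s - t) * idot c u) - (f.term b p + (s - t) * idot b u)) := by
          nlinarith
        have := nonneg_of_mul_nonneg_right this hs0
        linarith
    exact ⟨x, -u, hvx, TropPoly.isEdgeDirection_iff.2 ⟨h.1.neg, hface ▸ h.2.1⟩, hface⟩
  obtain ⟨s, hs⟩ := hE
  rcases le_total 0 s with h0 | h0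
  · exact main u h ⟨s, h0, hs⟩
  · refine main (-u) h.neg ⟨-s, by linarith, ?_⟩
    simpa [latticeVec_neg] using hs

/-! ### Balancing: smooth curves are unimodular -/

/-- The edge directions at a vertex do not lie in a closed half plane. -/
lemma IsVertex.exists_idot_neg (h : f.IsVertex p) {n : Fin 2 → ℤ} (hn : n ≠ 0) :
    ∃ u, f.IsEdgeDirection p u ∧ idot n u < 0 := by
  by_contra! hcon
  obtain ⟨ε, hε, hcon1, -⟩ := f.exists_ball_conic p
  obtain ⟨ε', hε', hloc⟩ := f.exists_ball_activeSet p
  -- Under the contrary assumption this open half disc misses the curve; being convex, it has one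
  -- exponent `a` active throughout.
  set S : Set (Fin 2 → ℝ) := {x | dot n (x - p) < 0} ∩ Metric.ball p (min ε ε')
  have hconv : Convex ℝ S := by
    refine Convex.inter ?_ (convex_ball _ _)
    intro x hx y hy a b ha hb hab
    have : a • x + b • y - p = a • (x - p) + b • (y - p) := by
      have : p = (a + b) • p := by rw [hab, one_smul]
      conv_lhs => rw [this]
      rw [add_smul, smul_sub, smul_sub]; abel
    simp only [Set.mem_ofPred_eq] at hx hy ⊢
    rw [this, dot_add, dot_smul, dot_smul]
    rcases ha.eq_or_lt with rfl | ha
    · have : b = 1 := by linarith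
      subst this; simpa using hy
    · nlinarith
  have hSV : ∀ x ∈ S, x ∉ f.variety := by
    rintro x ⟨hx1, hx2⟩ hxV
    have hx1' : dot n (x - p) < 0 := hx1
    have hne : x - p ≠ 0 := by
      intro h0; rw [h0] at hx1'; simp at hx1'
    obtain ⟨u, hu, t, ht, htu⟩ := hcon1 (x - p)
      (lt_of_lt_of_le (by simpa [dist_eq_norm] using hx2) (min_le_left _ _)) hne (by simpa using hxV)
    rw [htu, dot_smul, dot_latticeVec] at hx1'
    have := hcon u hu
    have : (0 : ℝ) ≤ idot n u := by exact_mod_cast this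
    nlinarith
  have hsq : (0 : ℝ) < idot n n := by
    have : 0 < idot n n := by
      simp only [idot]
      by_contra! hc
      apply hn
      have h0 : n 0 = 0 := by nlinarith [mul_self_nonneg (n 0), mul_self_nonneg (n 1)]
      have h1 : n 1 = 0 := by nlinarith [mul_self_nonneg (n 0), mul_self_nonneg (n 1)]
      funext i; fin_cases i <;> simp [h0, h1]
    exact_mod_cast this
  have hsmall : ∀ y : Fin 2 → ℝ, dot n y < 0 → ∃ t : ℝ, 0 < t ∧ p + t • y ∈ S := by
    intro y hy
    have hev := (tendsto_smul_nhdsGT y).eventually (Metric.ball_mem_nhds 0 (lt_min hε hε'))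
    obtain ⟨t, ht, ht0⟩ := (hev.and self_mem_nhdsWithin).exists
    have ht0 : 0 < t := ht0
    refine ⟨t, ht0, ?_, ?_⟩
    · simp only [Set.mem_ofPred_eq, add_sub_cancel_left, dot_smul]
      nlinarith
    · simpa [dist_eq_norm] using ht
  have hy0 : ∀ s : ℝ, dot n (-latticeVec n + s • latticeVec (perp n)) < 0 := by
    intro s
    rw [dot_add, dot_neg, dot_smul, dot_latticeVec, dot_latticeVec, idot_comm n (perp n),
      idot_perp_self]
    simpa using hsq
  obtain ⟨t0, ht0, hS0⟩ := hsmall _ (hy0 0)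
  obtain ⟨a, ha⟩ := f.activeSet_nonempty (p + t0 • (-latticeVec n + (0 : ℝ) • latticeVec (perp n)))
  have hin : ∀ x ∈ S, ‖x - p‖ < ε' := fun x hx =>
    lt_of_lt_of_le (by simpa [dist_eq_norm] using hx.2) (min_le_right _ _)
  have hall : ∀ b ∈ f.activeSet p, ∀ s : ℝ,
      dot b (-latticeVec n + s • latticeVec (perp n)) ≤
        dot a (-latticeVec n + s • latticeVec (perp n)) := by
    intro b hb s
    obtain ⟨t, ht, hS⟩ := hsmall _ (hy0 s)
    have h1 := active_of_isPreconnected hconv.isPreconnected hSV hS0 hS ha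
    have h2 := ((hloc _ (by simpa using hin _ hS) a).1 h1).2 b hb
    rw [dot_smul, dot_smul] at h2
    exact le_of_mul_le_mul_left h2 ht
  have hperp : perp n ≠ 0 := by
    intro h0
    apply hn
    have e0 := congrFun h0 0
    have e1 := congrFun h0 1
    simp at e0 e1
    funext i; fin_cases i <;> simp [e0, e1]
  have key : ∀ b ∈ f.activeSet p, idot b (perp n) = idot a (perp n) := by
    intro b hb
    by_contra hne
    have hne' : ((idot b (perp n) : ℝ) - idot a (perp n)) ≠ 0 := by
      rw [sub_ne_zero]; exact_mod_cast hne
    -- This parameter makes the pairing of `b` exceed that of `a` by exactly 1: moving far along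
    -- `perp n` outweighs the component `-n`.
    have := hall b hb ((idot b n - idot a n + 1) / (idot b (perp n) - idot a (perp n)))
    have e : (idot b n - idot a n + 1) / (idot b (perp n) - idot a (perp n)) *
      ((idot b (perp n) : ℝ) - idot a (perp n)) = idot b n - idot a n + 1 := div_mul_cancel₀ _ hne'
    simp only [dot_add, dot_neg, dot_smul, dot_latticeVec] at this
    linarith
  exact not_isVertex_of_idot_eq hperp
    (fun b hb c hc => (key b hb).trans (key c hc).symm) h

/-- All edges have weight one, and the primitive edge directions at each point sum to zero. -/
structure IsUnimodular (f : TropPoly 2) : Prop where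
  weight_eq_one : ∀ p ∈ f.variety, ¬ f.IsVertex p → f.weight p = 1
  star : ∀ p ∈ f.variety, ∃ N : Finset (Fin 2 → ℤ),
    (∀ v, v ∈ N ↔ f.IsEdgeDirection p v) ∧ ∑ v ∈ N, v = 0

/-- Since `u` and `v` form a lattice basis, some integral functional takes the value 1 on both. If
`w` were their sum, it would be positive on all edge directions, contrary to
`IsVertex.exists_idot_neg`. -/
lemma IsVertex.sum_ne {u v w : Fin 2 → ℤ} (h : f.IsVertex p)
    (hall : ∀ x, f.IsEdgeDirection p x → x = u ∨ x = v ∨ x = w)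
    (hdet : (latticeDet u v).natAbs = 1) : w ≠ u + v := by
  rintro rfl
  have hd : latticeDet u v * latticeDet u v = 1 := by
    rcases Int.natAbs_eq (latticeDet u v) with h | h <;> rw [hdet] at h <;> rw [h] <;> norm_num
  set n : Fin 2 → ℤ := latticeDet u v • (perp u - perp v) with hn
  have h1 : idot n u = 1 := by
    rw [hn, zsmul_idot, sub_idot, idot_perp_self, idot_perp]
    simp only [latticeDet] at hd ⊢
    linarith
  have h2 : idot n v = 1 := by
    rw [hn, zsmul_idot, sub_idot, idot_perp_self, idot_perp]
    simp only [latticeDet] at hd ⊢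
    linarith
  have hn0 : n ≠ 0 := by
    rintro h0
    rw [h0] at h1
    simp [idot] at h1
  obtain ⟨x, hx, hneg⟩ := h.exists_idot_neg hn0
  rcases hall x hx with rfl | rfl | rfl
  · omega
  · omega
  · rw [idot_add] at hneg; omega

lemma isUnimodular_of_isSmooth (hs : f.IsSmooth)
    (hflat : ∀ u, IsPrimitiveVec u → ∃ a ∈ f.support, ∃ b ∈ f.support, idot a u ≠ idot b u) :
    f.IsUnimodular where
  weight_eq_one := by
    intro p hp hv
    obtain ⟨u, hu⟩ := exists_onEdge hp hv
    -- The weight at `p` is also the weight of an edge leaving the vertex `x`, and it divides a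
    -- multiplicity equal to 1.
    obtain ⟨x, v, hx, hxv, hface⟩ := hu.exists_vertex (hflat u hu.1)
    obtain ⟨hcard, hmul⟩ := hs x hx
    obtain ⟨w, hw, hwv⟩ : ∃ w, f.IsEdgeDirection x w ∧ w ≠ v := by
      by_contra! hcon
      have : {v | f.IsEdgeDirection x v} ⊆ {v} := fun w hw => hcon w hw
      have := Set.ncard_le_ncard this
      rw [hcard] at this
      simp at this
    obtain ⟨m, hm⟩ := f.exists_hasEdgeWeight x w
    have hpw : f.HasEdgeWeight x v (f.weight p) := by
      filter_upwards [f.eventually_activeSet_eq_face x v] with s hs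
      exact weight_congr (hs.trans hface)
    have := hmul v w _ _ hxv hw hwv.symm hpw hm
    rw [mul_assoc] at this
    exact Nat.eq_one_of_mul_eq_one_right this
  star := by
    intro p hp
    by_cases hv : f.IsVertex p
    swap
    · obtain ⟨u, hu⟩ := exists_onEdge hp hv
      refine ⟨{u, -u}, fun v => by rw [hu.isEdgeDirection_iff]; simp, ?_⟩
      rw [Finset.sum_pair, add_neg_cancel]
      intro h
      exact hu.1.ne_zero (self_eq_neg.1 h)
    obtain ⟨hcard, hmul⟩ := hs p hv
    obtain ⟨u, v, w, huv, huw, hvw, hset⟩ := Set.ncard_eq_three.1 hcard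
    have hmem : ∀ x, f.IsEdgeDirection p x ↔ x = u ∨ x = v ∨ x = w := by
      intro x
      have : x ∈ {v | f.IsEdgeDirection p v} ↔ x ∈ ({u, v, w} : Set (Fin 2 → ℤ)) := by rw [hset]
      simpa using this
    have hdet : ∀ x y, f.IsEdgeDirection p x → f.IsEdgeDirection p y → x ≠ y →
        (latticeDet x y).natAbs = 1 := by
      intro x y hx hy hxy
      obtain ⟨m, hm⟩ := f.exists_hasEdgeWeight p x
      obtain ⟨m', hm'⟩ := f.exists_hasEdgeWeight p y
      exact Nat.eq_one_of_mul_eq_one_left (hmul x y m m' hx hy hxy hm hm')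
    have hu := (hmem u).2 (by simp)
    have hv' := (hmem v).2 (by simp)
    have hw := (hmem w).2 (by simp)
    refine ⟨{u, v, w}, fun x => by rw [hmem]; simp, ?_⟩
    rw [Finset.sum_insert (by simp [huv, huw]), Finset.sum_pair hvw]
    have d1 := hdet u v hu hv' huv
    have d2 := hdet w v hw hv' hvw.symm
    have d3 := hdet u w hu hw huw
    have n1 := hv.sum_ne (fun x hx => (hmem x).1 hx) d1
    have n2 := hv.sum_ne (u := w) (v := v) (w := u)
      (fun x hx => by rcases (hmem x).1 hx with h | h | h <;> simp [h]) d2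
    have n3 := hv.sum_ne (u := u) (v := w) (w := v)
      (fun x hx => by rcases (hmem x).1 hx with h | h | h <;> simp [h]) d3
    -- Cramer's rule. All determinants are ±1, so `w` is `±u ± v`; the three bounds `n1`, `n2`, `n3`
    -- leave only two minus signs.
    have hlin : ∀ i, latticeDet u v * w i = latticeDet w v * u i + latticeDet u w * v i := by
      intro i
      fin_cases i <;> simp [latticeDet] <;> ring
    have sgn : ∀ z : ℤ, z.natAbs = 1 → z = 1 ∨ z = -1 := fun z hz => by omega
    have main : ∀ α β : ℤ, (α = 1 ∨ α = -1) → (β = 1 ∨ β = -1) →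
        (∀ i, w i = α * u i + β * v i) → u + (v + w) = 0 := by
      rintro α β (rfl | rfl) (rfl | rfl) h
      · exact absurd (funext fun i => by simp [h i]) n1
      · exact absurd (funext fun i => by simp [h i]) n2
      · exact absurd (funext fun i => by simp [h i]) n3
      · funext i; simp [h i]
    refine main (latticeDet u v * latticeDet w v) (latticeDet u v * latticeDet u w) ?_ ?_ ?_
    · exact sgn _ (by rw [Int.natAbs_mul, d1, d2])
    · exact sgn _ (by rw [Int.natAbs_mul, d1, d3])
    · intro i
      have := hlin i
      rcases sgn _ d1 with h | h <;> rw [h] at this ⊢ <;> linarith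

/-- Otherwise the Newton polygon would lie in a line. This ensures that every edge ends at a vertex,
where smoothness can be applied. -/
lemma exists_idot_ne_of_interior_nonempty (h : (interior f.newtonPolytope).Nonempty)
    (hu : IsPrimitiveVec u) : ∃ a ∈ f.support, ∃ b ∈ f.support, idot a u ≠ idot b u := by
  by_contra! hcon
  obtain ⟨a, ha⟩ := f.support_nonempty
  obtain ⟨x, hx⟩ := h
  have hsub : f.newtonPolytope ⊆ {y | dot u y = idot u a} := by
    refine convexHull_min ?_ ?_
    · rintro _ ⟨c, hc, rfl⟩
      simp only [Set.mem_ofPred_eq, dot_latticeVec]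
      rw [idot_comm, hcon c hc a ha, idot_comm]
    · intro y hy z hz s t _ _ hst
      simp only [Set.mem_ofPred_eq] at hy hz ⊢
      rw [dot_add, dot_smul, dot_smul, hy, hz, ← add_mul, hst, one_mul]
  have hc : Tendsto (fun t : ℝ => x + t • latticeVec u) (𝓝[>] 0) (𝓝 x) := by
    have : Continuous fun t : ℝ => x + t • latticeVec u := by fun_prop
    simpa using (this.tendsto 0).mono_left nhdsWithin_le_nhds
  obtain ⟨t, ht, ht0⟩ := ((hc.eventually (mem_interior_iff_mem_nhds.1 hx)).and
    self_mem_nhdsWithin).exists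
  have ht0 : 0 < t := ht0
  have h1 := hsub ht
  have h2 := hsub (interior_subset hx)
  simp only [Set.mem_ofPred_eq, dot_add, dot_smul, dot_latticeVec] at h1 h2
  have h3 : (idot u u : ℝ) = 0 := by
    have : t * (idot u u : ℝ) = 0 := by linarith
    exact (mul_eq_zero.1 this).resolve_left ht0.ne'
  have h4 : idot u u = 0 := by exact_mod_cast h3
  simp only [idot] at h4
  apply hu.ne_zero
  have h0 : u 0 = 0 := by nlinarith [mul_self_nonneg (u 0), mul_self_nonneg (u 1)]
  have h1 : u 1 = 0 := by nlinarith [mul_self_nonneg (u 0), mul_self_nonneg (u 1)]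
  funext i; fin_cases i <;> simp [h0, h1]

end TropPoly

lemma idot_sum (a : Fin 2 → ℤ) (N : Finset (Fin 2 → ℤ)) :
    ∑ v ∈ N, idot a v = idot a (∑ v ∈ N, v) := by
  simp [idot, Finset.sum_add_distrib, Finset.mul_sum, Finset.sum_apply]

lemma idot_zero (a : Fin 2 → ℤ) : idot a 0 = 0 := by simp [idot]

namespace TropPoly

/-! ### Directional slopes -/

/-- The slope of a tropical polynomial at `p` in direction `v`. -/
def slope (g : TropPoly 2) (p : Fin 2 → ℝ) (v : Fin 2 → ℤ) : ℤ :=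
  (g.activeSet_finite p).toFinset.sup'
    ((Set.Finite.toFinset_nonempty _).2 (g.activeSet_nonempty p)) (fun a => idot a v)

variable {f g : TropPoly 2} {p q : Fin 2 → ℝ} {u v : Fin 2 → ℤ}

lemma le_slope {a : Fin 2 → ℤ} (ha : a ∈ g.activeSet p) (v : Fin 2 → ℤ) :
    idot a v ≤ g.slope p v :=
  Finset.le_sup' (fun a => idot a v) ((Set.Finite.mem_toFinset _).2 ha)

lemma exists_slope (g : TropPoly 2) (p : Fin 2 → ℝ) (v : Fin 2 → ℤ) :
    ∃ a ∈ g.activeSet p, idot a v = g.slope p v := by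
  obtain ⟨a, ha, h⟩ := Finset.exists_mem_eq_sup'
    ((Set.Finite.toFinset_nonempty (g.activeSet_finite p)).2 (g.activeSet_nonempty p))
    (fun a => idot a v)
  exact ⟨a, (Set.Finite.mem_toFinset _).1 ha, h.symm⟩

lemma slope_eq {a : Fin 2 → ℤ} (ha : a ∈ g.activeSet p)
    (h : ∀ b ∈ g.activeSet p, idot b v ≤ idot a v) : g.slope p v = idot a v := by
  obtain ⟨b, hb, hb'⟩ := g.exists_slope p v
  exact le_antisymm (hb' ▸ h b hb) (le_slope ha v)

lemma slope_eq_of_forall {k : ℤ} (h : ∀ b ∈ g.activeSet p, idot b v = k) : g.slope p v = k := by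
  obtain ⟨b, hb, hb'⟩ := g.exists_slope p v
  exact hb' ▸ h b hb

lemma eventually_eval_eq_slope (g : TropPoly 2) (p : Fin 2 → ℝ) (v : Fin 2 → ℤ) :
    ∀ᶠ t in 𝓝[>] (0 : ℝ), g.eval (p + t • latticeVec v) = g.eval p + t * g.slope p v := by
  obtain ⟨a, ha, hs⟩ := g.exists_slope p v
  filter_upwards [g.eventually_activeSet_eq_face p v] with t ht
  have : a ∈ g.activeSet (p + t • latticeVec v) := by
    rw [ht]
    exact ⟨ha, fun b hb => hs ▸ le_slope hb v⟩
  rw [← this.2, ← ha.2, term_add, dot_smul, dot_latticeVec, hs]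

/-! ### Translations -/

lemma term_translate (f : TropPoly 2) (w : Fin 2 → ℝ) (a : Fin 2 → ℤ) (x : Fin 2 → ℝ) :
    (f.translate w).term a x = f.term a (x - w) := by
  rw [term_eq, term_eq, dot_sub]
  simp [translate, dot, Fin.sum_univ_two]; ring

lemma activeSet_translate (f : TropPoly 2) (w q : Fin 2 → ℝ) :
    (f.translate w).activeSet q = f.activeSet (q - w) := by
  ext a
  simp only [mem_activeSet, term_translate]
  rfl

lemma mem_variety_translate {w : Fin 2 → ℝ} :
    q ∈ (f.translate w).variety ↔ q - w ∈ f.variety := by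
  rw [mem_variety_iff, mem_variety_iff, activeSet_translate]

lemma isVertex_translate {w : Fin 2 → ℝ} :
    (f.translate w).IsVertex q ↔ f.IsVertex (q - w) := by
  rw [isVertex_iff, isVertex_iff, activeSet_translate]

lemma isEdgeDirection_translate {w : Fin 2 → ℝ} :
    (f.translate w).IsEdgeDirection q v ↔ f.IsEdgeDirection (q - w) v := by
  rw [isEdgeDirection_iff, isEdgeDirection_iff, face, face, activeSet_translate]

lemma slope_translate (g : TropPoly 2) (w q : Fin 2 → ℝ) (v : Fin 2 → ℤ) :
    (g.translate w).slope q v = g.slope (q - w) v := by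
  obtain ⟨a, ha, h⟩ := (g.translate w).exists_slope q v
  rw [← h]
  refine (slope_eq (by rwa [activeSet_translate] at ha) fun b hb => ?_).symm
  rw [h]
  exact le_slope (by rwa [activeSet_translate]) v

lemma IsUnimodular.translate (hf : f.IsUnimodular) (w : Fin 2 → ℝ) :
    (f.translate w).IsUnimodular where
  weight_eq_one q hq hv := by
    have := hf.weight_eq_one (q - w) (mem_variety_translate.1 hq)
      (fun h => hv (isVertex_translate.2 h))
    rw [← this]
    simp only [weight, dualCell, activeSet_translate]
  star q hq := by
    obtain ⟨N, hN, h0⟩ := hf.star (q - w) (mem_variety_translate.1 hq)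
    exact ⟨N, fun v => by rw [hN, isEdgeDirection_translate], h0⟩

/-! ### The divisor cut out on a unimodular curve -/

open scoped Classical in
/-- The edge directions of `V(f)` at `p`. -/
def star (f : TropPoly 2) (p : Fin 2 → ℝ) : Finset (Fin 2 → ℤ) :=
  if h : {v | f.IsEdgeDirection p v}.Finite then h.toFinset else ∅

lemma IsUnimodular.mem_star (hf : f.IsUnimodular) (hp : p ∈ f.variety) :
    v ∈ f.star p ↔ f.IsEdgeDirection p v := by
  obtain ⟨N, hN, -⟩ := hf.star p hp
  have hfin : {v | f.IsEdgeDirection p v}.Finite :=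
    N.finite_toSet.subset fun v hv => (hN v).2 hv
  rw [TropPoly.star, dif_pos hfin, Set.Finite.mem_toFinset]
  rfl

lemma IsUnimodular.sum_star (hf : f.IsUnimodular) (hp : p ∈ f.variety) :
    ∑ v ∈ f.star p, v = 0 := by
  obtain ⟨N, hN, h0⟩ := hf.star p hp
  have : f.star p = N := by ext v; rw [hf.mem_star hp, hN]
  rw [this, h0]

lemma OnEdge.star_eq (hf : f.IsUnimodular) (h : f.OnEdge q u) : f.star q = {u, -u} := by
  ext v
  rw [hf.mem_star h.mem_variety, h.isEdgeDirection_iff]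
  simp

lemma ne_neg_of_isPrimitiveVec (hu : IsPrimitiveVec u) : u ≠ -u :=
  fun h => hu.ne_zero (self_eq_neg.1 h)

lemma OnEdge.sum_star (hf : f.IsUnimodular) (h : f.OnEdge q u) {M : Type*} [AddCommMonoid M]
    (k : (Fin 2 → ℤ) → M) : ∑ v ∈ f.star q, k v = k u + k (-u) := by
  rw [h.star_eq hf, Finset.sum_pair (ne_neg_of_isPrimitiveVec h.1)]

/-- Off V(g) the slope is linear in the direction, so balancing cancels it. -/
lemma sum_slope_eq_zero (hf : f.IsUnimodular) (hp : p ∈ f.variety) (hq : q ∉ g.variety) :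
    ∑ v ∈ f.star p, g.slope q v = 0 := by
  obtain ⟨a, ha⟩ := g.activeSet_nonempty q
  have hs : g.activeSet q = {a} :=
    (Set.not_nontrivial_iff.1 fun h => hq (mem_variety_iff.2 h)).eq_singleton_of_mem ha
  rw [Finset.sum_congr rfl fun v _ => slope_eq_of_forall (k := idot a v) (by simp [hs]),
    idot_sum, hf.sum_star hp, idot_zero]

/-- The slope dominates the pairing with any one active exponent, whose sum over the star vanishes.
Hence the coefficients of the divisor can be natural numbers. -/
lemma sum_slope_nonneg (hf : f.IsUnimodular) (hp : p ∈ f.variety) (g : TropPoly 2)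
    (q : Fin 2 → ℝ) : 0 ≤ ∑ v ∈ f.star p, g.slope q v := by
  obtain ⟨a, ha⟩ := g.activeSet_nonempty q
  calc 0 = ∑ v ∈ f.star p, idot a v := by rw [idot_sum, hf.sum_star hp, idot_zero]
    _ ≤ _ := Finset.sum_le_sum fun v _ => le_slope ha v

/-- The multiplicity of a transversal intersection is the sum of the slopes. -/
lemma transversalMult_eq (hf : f.IsUnimodular) (hq : q ∈ f.variety)
    (h1 : f.IsVertex q → q ∉ g.variety) (h2 : g.IsVertex q → q ∉ f.variety) :
    (transversalMult f g q : ℤ) = ∑ v ∈ f.star q, g.slope q v := by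
  by_cases hg : q ∈ g.variety
  swap
  · rw [sum_slope_eq_zero hf hq hg, transversalMult, if_neg fun h => hg h.2]
    rfl
  have hv : ¬ f.IsVertex q := fun h => h1 h hg
  have hv' : ¬ g.IsVertex q := fun h => h2 h hq
  obtain ⟨u, hu⟩ := exists_onEdge hq hv
  obtain ⟨u', hu'⟩ := exists_onEdge hg hv'
  obtain ⟨A, w, -, hw, hA, hB, hall⟩ := hu'.exists_weight
  have e1 : f.edgeDirection q = u ∨ f.edgeDirection q = -u :=
    hu.isEdgeDirection_iff.1 (Classical.epsilon_spec (p := fun v => f.IsEdgeDirection q v)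
      ⟨u, hu.isEdgeDirection_iff.2 (Or.inl rfl)⟩)
  have e2 : g.edgeDirection q = u' ∨ g.edgeDirection q = -u' :=
    hu'.isEdgeDirection_iff.1 (Classical.epsilon_spec (p := fun v => g.IsEdgeDirection q v)
      ⟨u', hu'.isEdgeDirection_iff.2 (Or.inl rfl)⟩)
  have hdet : (latticeDet (f.edgeDirection q) (g.edgeDirection q)).natAbs =
      (latticeDet u' u).natAbs := by
    rw [Int.natAbs_eq_natAbs_iff]
    rcases e1 with h | h <;> rcases e2 with h' | h' <;> rw [h, h'] <;> simp only [latticeDet,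
      Pi.neg_apply]
    · right; ring
    · left; ring
    · left; ring
    · right; ring
  rw [transversalMult, if_pos ⟨hq, hg⟩, hf.weight_eq_one q hq hv, hw, hdet, hu.sum_star hf]
  -- The extreme exponents `A` and `A + w • perp u'` realise the slopes in directions `-v` and `v`.
  -- Their sum is weight times determinant; the sign of the determinant decides whether `v` is `u`
  -- or `-u`.
  have key : ∀ v : Fin 2 → ℤ, 0 ≤ latticeDet u' v → g.slope q v = idot A v + w * latticeDet u' v ∧
      g.slope q (-v) = - idot A v := by
    intro v hv
    have hval : ∀ i : ℤ, idot (A + i • perp u') v = idot A v + i * latticeDet u' v := by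
      intro i
      rw [add_idot, zsmul_idot, idot_perp]
    constructor
    · rw [← hval]
      refine slope_eq hB fun b hb => ?_
      obtain ⟨i, h0, hi, rfl⟩ := hall b hb
      rw [hval, hval]
      have := mul_le_mul_of_nonneg_right hi hv
      linarith
    · rw [← idot_neg]
      refine slope_eq hA fun b hb => ?_
      obtain ⟨i, h0, hi, rfl⟩ := hall b hb
      rw [idot_neg, idot_neg, hval]
      have := mul_nonneg h0 hv
      linarith
  rcases le_total 0 (latticeDet u' u) with h | h
  · obtain ⟨k1, k2⟩ := key u h
    rw [k1, k2]
    push_cast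
    rw [abs_of_nonneg h]
    ring
  · have h' : 0 ≤ latticeDet u' (-u) := by
      simp only [latticeDet, Pi.neg_apply] at h ⊢; linarith
    obtain ⟨k1, k2⟩ := key (-u) h'
    rw [neg_neg] at k2
    rw [k1, k2]
    push_cast
    rw [abs_of_nonpos h]
    simp only [latticeDet, Pi.neg_apply]
    ring

/-! ### Kinks along a line -/

/-- The change of slope of `g` at the point `z + s v` of a line in direction `v`. -/
def kink (g : TropPoly 2) (z : Fin 2 → ℝ) (v : Fin 2 → ℤ) (s : ℝ) : ℤ :=
  g.slope (z + s • latticeVec v) v + g.slope (z + s • latticeVec v) (-v)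

lemma kink_eq_zero {s : ℝ} {z : Fin 2 → ℝ} {k : ℤ}
    (h : ∀ a ∈ g.activeSet (z + s • latticeVec v), idot a v = k) : g.kink z v s = 0 := by
  rw [kink, slope_eq_of_forall h, slope_eq_of_forall (k := -k), add_neg_cancel]
  intro a ha
  rw [idot_neg, h a ha]

/-- An active exponent bounds both one-sided slopes from below, with bounds adding up to zero; a
vanishing kink makes both bounds sharp. -/
lemma idot_eq_of_kink_eq_zero {s : ℝ} {z : Fin 2 → ℝ} (h : g.kink z v s = 0) {a : Fin 2 → ℤ}
    (ha : a ∈ g.activeSet (z + s • latticeVec v)) :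
    idot a v = g.slope (z + s • latticeVec v) v := by
  have h1 := le_slope ha v
  have h2 := le_slope ha (-v)
  rw [idot_neg] at h2
  rw [kink] at h
  omega

lemma exists_of_kink_ne_zero {s : ℝ} {z : Fin 2 → ℝ} (h : g.kink z v s ≠ 0) :
    ∃ a ∈ g.activeSet (z + s • latticeVec v), ∃ b ∈ g.activeSet (z + s • latticeVec v),
      idot a v ≠ idot b v := by
  obtain ⟨b, hb⟩ := g.activeSet_nonempty (z + s • latticeVec v)
  by_contra! hcon
  exact h (kink_eq_zero fun a ha => hcon a ha b hb)

/-- A kink needs two active exponents with different pairings with `v`, and equality of their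
monomials determines `s`. -/
lemma finite_kink (g : TropPoly 2) (z : Fin 2 → ℝ) (v : Fin 2 → ℤ) :
    {s | g.kink z v s ≠ 0}.Finite := by
  refine ((g.support ×ˢ g.support).image fun ab : (Fin 2 → ℤ) × (Fin 2 → ℤ) =>
    (g.term ab.2 z - g.term ab.1 z) / ((idot ab.1 v : ℝ) - idot ab.2 v)).finite_toSet.subset ?_
  intro s hs
  obtain ⟨a, ha, b, hb, hab⟩ := exists_of_kink_ne_zero hs
  refine Finset.mem_coe.2 (Finset.mem_image.2 ⟨(a, b), Finset.mem_product.2 ⟨ha.1, hb.1⟩, ?_⟩)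
  have h := term_eq_of_active ha hb
  rw [term_add, term_add, dot_smul, dot_smul, dot_latticeVec, dot_latticeVec] at h
  have : ((idot a v : ℝ) - idot b v) ≠ 0 := sub_ne_zero.2 (by exact_mod_cast hab)
  simp only
  rw [div_eq_iff this]
  linarith

/-- Without kinks the forward slope is locally constant, hence constant, on the open interval; near
the ends it agrees with the one-sided slopes there. -/
lemma slope_eq_of_kink_eq_zero {z : Fin 2 → ℝ} {α β : ℝ} (hαβ : α < β)
    (h : ∀ s ∈ Set.Ioo α β, g.kink z v s = 0) :
    g.slope (z + α • latticeVec v) v = -g.slope (z + β • latticeVec v) (-v) := by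
  have hloc : ∀ s ∈ Set.Ioo α β, ∀ᶠ s' in 𝓝[Set.Ioo α β] s,
      g.slope (z + s • latticeVec v) v = g.slope (z + s' • latticeVec v) v := by
    intro s hs
    have hc : Tendsto (fun s' : ℝ => (s' - s) • latticeVec v) (𝓝 s) (𝓝 0) := by
      have : Continuous fun s' : ℝ => (s' - s) • latticeVec v := by fun_prop
      simpa using this.tendsto s
    filter_upwards [nhdsWithin_le_nhds (hc.eventually
      (g.eventually_mem_activeSet (z + s • latticeVec v)))] with s' hs'
    refine (slope_eq_of_forall fun b hb => ?_).symm
    have e : z + s' • latticeVec v = z + s • latticeVec v + (s' - s) • latticeVec v := by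
      rw [add_assoc, ← add_smul, add_sub_cancel]
    rw [e] at hb
    exact idot_eq_of_kink_eq_zero (h s hs) ((hs' b).1 hb).1
  obtain ⟨t, ht, ht0, ht1⟩ := ((g.eventually_activeSet_eq_face (z + α • latticeVec v) v).and
    (Ioo_mem_nhdsGT (sub_pos.2 hαβ))).exists
  obtain ⟨t', ht', ht0', ht1'⟩ := ((g.eventually_activeSet_eq_face (z + β • latticeVec v) (-v)).and
    (Ioo_mem_nhdsGT (sub_pos.2 hαβ))).exists
  have e : z + α • latticeVec v + t • latticeVec v = z + (α + t) • latticeVec v := by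
    rw [add_smul, add_assoc]
  have e' : z + β • latticeVec v + t' • latticeVec (-v) = z + (β - t') • latticeVec v := by
    rw [latticeVec_neg, sub_smul, smul_neg, add_assoc, sub_eq_add_neg]
  rw [e] at ht
  rw [e'] at ht'
  have h1 : g.slope (z + (α + t) • latticeVec v) v = g.slope (z + α • latticeVec v) v := by
    obtain ⟨a, ha, hs⟩ := g.exists_slope (z + α • latticeVec v) v
    refine slope_eq_of_forall fun b hb => ?_
    rw [ht] at hb
    exact le_antisymm (le_slope hb.1 v) (hs ▸ hb.2 a ha)
  have h2 : g.slope (z + (β - t') • latticeVec v) v = -g.slope (z + β • latticeVec v) (-v) := by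
    obtain ⟨a, ha, hs⟩ := g.exists_slope (z + β • latticeVec v) (-v)
    refine slope_eq_of_forall fun b hb => ?_
    rw [ht'] at hb
    have h3 := le_slope hb.1 (-v)
    have h4 := hb.2 a ha
    rw [hs] at h4
    rw [idot_neg] at h3 h4
    omega
  rw [← h1, ← h2]
  exact isPreconnected_Ioo.induction₂ (fun s s' => g.slope (z + s • latticeVec v) v =
    g.slope (z + s' • latticeVec v) v) hloc (fun _ _ _ _ _ _ h h' => h.trans h')
    (fun _ _ _ _ h => h.symm) ⟨by linarith, by linarith⟩ ⟨by linarith, by linarith⟩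

/-- The kinks between two points of a line add up to the total change of slope. -/
lemma sum_kink (g : TropPoly 2) (z : Fin 2 → ℝ) (v : Fin 2 → ℤ) {α β : ℝ} (hαβ : α < β) :
    ∑ s ∈ (g.finite_kink z v).toFinset with α < s ∧ s < β, g.kink z v s =
      -g.slope (z + β • latticeVec v) (-v) - g.slope (z + α • latticeVec v) v := by
  set K := (g.finite_kink z v).toFinset with hK
  have hmem : ∀ s, s ∈ K ↔ g.kink z v s ≠ 0 := fun s => by
    rw [hK, Set.Finite.mem_toFinset]; rfl
  -- Induction on the number of kinks between the two ends, splitting the interval at one of them.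
  induction hn : (K.filter fun s => α < s ∧ s < β).card using Nat.strong_induction_on
    generalizing α β with
  | _ n ih =>
    rcases (K.filter fun s => α < s ∧ s < β).eq_empty_or_nonempty with h0 | ⟨s0, hs0⟩
    · rw [h0, Finset.sum_empty, slope_eq_of_kink_eq_zero hαβ, sub_self]
      intro s hs
      by_contra hne
      have : s ∈ K.filter fun s => α < s ∧ s < β :=
        Finset.mem_filter.2 ⟨(hmem s).2 hne, hs.1, hs.2⟩
      rw [h0] at this
      simp at this
    · obtain ⟨hs0K, hα, hβ⟩ := Finset.mem_filter.1 hs0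
      have hsplit : (K.filter fun s => α < s ∧ s < β) = insert s0
          ((K.filter fun s => α < s ∧ s < s0) ∪ (K.filter fun s => s0 < s ∧ s < β)) := by
        ext s
        simp only [Finset.mem_filter, Finset.mem_insert, Finset.mem_union]
        constructor
        · rintro ⟨h1, h2, h3⟩
          rcases lt_trichotomy s s0 with h | h | h
          · exact Or.inr (Or.inl ⟨h1, h2, h⟩)
          · exact Or.inl h
          · exact Or.inr (Or.inr ⟨h1, h, h3⟩)
        · rintro (rfl | ⟨h1, h2, h3⟩ | ⟨h1, h2, h3⟩)
          · exact ⟨hs0K, hα, hβ⟩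
          · exact ⟨h1, h2, h3.trans hβ⟩
          · exact ⟨h1, hα.trans h2, h3⟩
      have hnot : s0 ∉ (K.filter fun s => α < s ∧ s < s0) ∪ (K.filter fun s => s0 < s ∧ s < β) := by
        simp
      have hdisj : Disjoint (K.filter fun s => α < s ∧ s < s0)
          (K.filter fun s => s0 < s ∧ s < β) := by
        rw [Finset.disjoint_left]
        intro s h1 h2
        have := (Finset.mem_filter.1 h1).2.2
        have := (Finset.mem_filter.1 h2).2.1
        linarith
      have hcard := congrArg Finset.card hsplit
      rw [hn, Finset.card_insert_of_notMem hnot, Finset.card_union_of_disjoint hdisj] at hcard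
      rw [hsplit, Finset.sum_insert hnot, Finset.sum_union hdisj,
        ih _ (by omega) hα rfl, ih _ (by omega) hβ rfl, kink]
      ring

/-! ### Stable intersections with a unimodular curve -/

/-- The stable intersection multiplicity is the sum of the outgoing slopes. -/
theorem hasStableMult_of_isUnimodular (hf : f.IsUnimodular) (hp : p ∈ f.variety) {m : ℕ}
    (hm : (m : ℤ) = ∑ v ∈ f.star p, g.slope p v) : HasStableMult f g p m := by
  obtain ⟨ε₀, hε₀, hcon, hface⟩ := f.exists_ball_conic p
  obtain ⟨ε₁, hε₁, hloc⟩ := g.exists_ball_activeSet p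
  have hr : ∀ᶠ r in 𝓝[>] (0 : ℝ), r ∈ Set.Ioo 0 (min ε₀ ε₁ / 2) :=
    Ioo_mem_nhdsGT (by positivity)
  filter_upwards [hr] with r hr
  have hr0 : 0 < r := hr.1
  have hrε₀ : r + r < ε₀ := by linarith [hr.2, min_le_left ε₀ ε₁]
  have hrε₁ : r + r < ε₁ := by linarith [hr.2, min_le_right ε₀ ε₁]
  set N := f.star p with hN
  obtain ⟨U, hU⟩ : ∃ U : ℝ, ∀ u ∈ N, ‖latticeVec u‖ ≤ U := by
    obtain ⟨U, hU⟩ := (N.finite_toSet.image fun u => ‖latticeVec u‖).bddAbove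
    exact ⟨U, fun u hu => hU ⟨u, hu, rfl⟩⟩
  -- A displacement by at most `β` along any edge direction at `p` has norm at most `r / 2`, so
  -- together with the translation it stays inside the ball.
  set β : ℝ := r / (2 * (|U| + 1)) with hβ
  have hβ0 : 0 < β := by positivity
  have hβU : ∀ u ∈ N, ∀ s : ℝ, 0 ≤ s → s ≤ β → ‖s • latticeVec u‖ ≤ r / 2 := by
    intro u hu s hs hsβ
    rw [norm_smul, Real.norm_eq_abs, abs_of_nonneg hs]
    have h1 : ‖latticeVec u‖ ≤ |U| + 1 := (hU u hu).trans (by linarith [le_abs_self U])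
    calc s * ‖latticeVec u‖ ≤ β * (|U| + 1) := by gcongr
      _ = r / 2 := by rw [hβ]; field_simp
  have hδ : ∀ᶠ δ in 𝓝 (0 : Fin 2 → ℝ), ∀ a ∈ g.activeSet p, ∀ b ∈ g.activeSet p,
      dot a δ - dot b δ < β := by
    rw [(g.activeSet_finite p).eventually_all]
    intro a _
    rw [(g.activeSet_finite p).eventually_all]
    intro b _
    have : Continuous fun δ => dot a δ - dot b δ := by fun_prop
    exact this.continuousAt.eventually_lt continuousAt_const (by simpa using hβ0)
  have hδ' : Tendsto (fun v : (Fin 2 → ℝ) × (Fin 2 → ℝ) => v.1 - v.2) (𝓝 0) (𝓝 0) := by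
    have : Continuous fun v : (Fin 2 → ℝ) × (Fin 2 → ℝ) => v.1 - v.2 := by fun_prop
    simpa using this.tendsto 0
  filter_upwards [hδ'.eventually hδ, Metric.ball_mem_nhds (0 : (Fin 2 → ℝ) × (Fin 2 → ℝ))
    (half_pos hr0)] with v hvδ hv htr
  have hv1 : ‖v.1‖ < r / 2 := lt_of_le_of_lt (norm_fst_le v) (by simpa using hv)
  have hv2 : ‖v.2‖ < r / 2 := lt_of_le_of_lt (norm_snd_le v) (by simpa using hv)
  -- Only the relative translation matters: following the translated edge from `p + v.1` in the
  -- translate of V(g) is following the line from `z` in V(g).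
  set z := p + (v.1 - v.2) with hz
  have hfv := hf.translate v.1
  have hstar : ∀ q, q - v.1 ∈ f.variety → (f.translate v.1).star q = f.star (q - v.1) := by
    intro q hq
    ext w
    rw [hfv.mem_star (mem_variety_translate.2 hq), hf.mem_star hq, isEdgeDirection_translate]
  have htm : ∀ q, q - v.1 ∈ f.variety →
      (transversalMult (f.translate v.1) (g.translate v.2) q : ℤ) =
        ∑ w ∈ f.star (q - v.1), g.slope (q - v.2) w := by
    intro q hq
    rw [transversalMult_eq hfv (mem_variety_translate.2 hq) (htr.1 q) (htr.2 q), hstar q hq]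
    exact Finset.sum_congr rfl fun w _ => slope_translate _ _ _ _
  have hedge : ∀ u ∈ N, ∀ s : ℝ, 0 < s → ‖s • latticeVec u‖ < ε₀ →
      f.OnEdge (p + s • latticeVec u) u := fun u hu s hs hsu =>
    onEdge_of_activeSet_eq_face ((hf.mem_star hp).1 hu) (hface u s hs hsu)
  have htmu : ∀ u ∈ N, ∀ s : ℝ, 0 < s → ‖s • latticeVec u‖ < ε₀ →
      (transversalMult (f.translate v.1) (g.translate v.2) (p + v.1 + s • latticeVec u) : ℤ) =
        g.kink z u s := by
    intro u hu s hs hsu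
    have e1 : p + v.1 + s • latticeVec u - v.1 = p + s • latticeVec u := by abel
    have e2 : p + v.1 + s • latticeVec u - v.2 = z + s • latticeVec u := by rw [hz]; abel
    have he := hedge u hu s hs hsu
    rw [htm _ (by rw [e1]; exact he.mem_variety), e1, e2, he.sum_star hf, kink]
  -- Pairings with `u` are integers, so an exponent of smaller pairing loses at least `s ≥ β`, more
  -- than the perturbation can compensate. Beyond `β` the slope is therefore the one at `p`.
  have hfar : ∀ u ∈ N, ∀ s : ℝ, β ≤ s → ‖v.1 - v.2 + s • latticeVec u‖ < ε₁ →
      ∀ a ∈ g.activeSet (z + s • latticeVec u), idot a u = g.slope p u := by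
    intro u hu s hs hsu a ha
    rw [hz, add_assoc] at ha
    obtain ⟨ha1, ha2⟩ := (hloc _ hsu a).1 ha
    refine le_antisymm (le_slope ha1 u) ?_
    obtain ⟨b, hb, hbs⟩ := g.exists_slope p u
    rw [← hbs]
    by_contra! hlt
    have h1 := ha2 b hb
    have h2 := hvδ a ha1 b hb
    rw [dot_add, dot_add, dot_smul, dot_smul, dot_latticeVec, dot_latticeVec] at h1
    have h3 : (idot a u : ℝ) + 1 ≤ idot b u := by exact_mod_cast hlt
    nlinarith
  set K : (Fin 2 → ℤ) → Finset ℝ := fun u =>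
    (g.finite_kink z u).toFinset.filter fun s => 0 < s ∧ s < β with hK
  have hKmem : ∀ u s, s ∈ K u ↔ g.kink z u s ≠ 0 ∧ 0 < s ∧ s < β := by
    intro u s
    rw [hK, Finset.mem_filter, Set.Finite.mem_toFinset]
    rfl
  set φ : (Σ _ : (Fin 2 → ℤ), ℝ) → (Fin 2 → ℝ) := fun us => p + v.1 + us.2 • latticeVec us.1 with hφ
  classical
  -- All points of the ball with nonzero multiplicity are among these: the displaced centre and the
  -- kinks on the displaced edges.
  set Q : Finset (Fin 2 → ℝ) := insert (p + v.1) ((N.sigma K).image φ) with hQ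
  have hQball : ∀ q ∈ Q, q ∈ Metric.ball p r := by
    intro q hq
    rw [Metric.mem_ball, dist_eq_norm]
    rcases Finset.mem_insert.1 hq with rfl | hq
    · rw [add_sub_cancel_left]; linarith
    · obtain ⟨⟨u, s⟩, hus, rfl⟩ := Finset.mem_image.1 hq
      obtain ⟨hu, hs⟩ := Finset.mem_sigma.1 hus
      obtain ⟨-, hs0, hsβ⟩ := (hKmem u s).1 hs
      have e : φ ⟨u, s⟩ - p = v.1 + s • latticeVec u := by simp only [hφ]; abel
      rw [e]
      calc _ ≤ ‖v.1‖ + ‖s • latticeVec u‖ := norm_add_le _ _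
        _ < r := by linarith [hβU u hu s hs0.le hsβ.le]
  have hsupp : ∀ q ∈ Metric.ball p r,
      transversalMult (f.translate v.1) (g.translate v.2) q ≠ 0 → q ∈ Q := by
    intro q hq hne
    have hqV : q - v.1 ∈ f.variety := by
      by_contra hcon
      apply hne
      rw [transversalMult, if_neg fun h => hcon (mem_variety_translate.1 h.1)]
    have hqp : ‖q - p‖ < r := by rwa [Metric.mem_ball, dist_eq_norm] at hq
    have hy : ‖q - v.1 - p‖ < r + r / 2 := by
      have e : q - v.1 - p = (q - p) - v.1 := by abel
      rw [e]
      exact (norm_sub_le _ _).trans_lt (by linarith)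
    by_cases hy0 : q - v.1 - p = 0
    · refine Finset.mem_insert.2 (Or.inl ?_)
      rw [sub_sub, sub_eq_zero] at hy0
      rw [hy0, add_comm]
    obtain ⟨u, hu, t, ht, htu⟩ := hcon (q - v.1 - p) (by linarith) hy0
      (by rwa [add_sub_cancel])
    have huN : u ∈ N := (hf.mem_star hp).2 hu
    have hqe : q = p + v.1 + t • latticeVec u := by rw [← htu]; abel
    have hk : g.kink z u t ≠ 0 := by
      intro h0
      apply hne
      have := htmu u huN t ht (by rw [← htu]; linarith)
      rw [← hqe, h0] at this
      exact_mod_cast this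
    refine Finset.mem_insert.2 (Or.inr (Finset.mem_image.2 ⟨⟨u, t⟩, Finset.mem_sigma.2
      ⟨huN, (hKmem u t).2 ⟨hk, ht, ?_⟩⟩, hqe.symm⟩))
    by_contra! hge
    refine hk (kink_eq_zero (hfar u huN t hge ?_))
    rw [← htu]
    have e : v.1 - v.2 + (q - v.1 - p) = (q - p) - v.2 := by abel
    rw [e]
    exact (norm_sub_le _ _).trans_lt (by linarith)
  rw [finsum_mem_eq_sum_of_inter_support_eq _ (t := Q) (by
    ext q
    constructor
    · rintro ⟨h1, h2⟩; exact ⟨hsupp q h1 h2, h2⟩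
    · rintro ⟨h1, h2⟩; exact ⟨hQball q h1, h2⟩)]
  have hnot : p + v.1 ∉ (N.sigma K).image φ := by
    intro h
    obtain ⟨⟨u, s⟩, hus, he⟩ := Finset.mem_image.1 h
    obtain ⟨hu, hs⟩ := Finset.mem_sigma.1 hus
    obtain ⟨-, hs0, -⟩ := (hKmem u s).1 hs
    have h0 : s • latticeVec u = 0 := by simpa [hφ] using he
    rcases smul_eq_zero.1 h0 with h | h
    · exact hs0.ne' h
    · refine ((hf.mem_star hp).1 hu).1.ne_zero (latticeVec_injective (h.trans ?_))
      funext i; simp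
  have hinj : Set.InjOn φ (N.sigma K : Set (Σ _ : (Fin 2 → ℤ), ℝ)) := by
    rintro ⟨u, s⟩ hus ⟨u', s'⟩ hus' he
    obtain ⟨hu, hs⟩ := Finset.mem_sigma.1 (Finset.mem_coe.1 hus)
    obtain ⟨hu', hs'⟩ := Finset.mem_sigma.1 (Finset.mem_coe.1 hus')
    obtain ⟨h1, h2⟩ := smul_latticeVec_inj ((hf.mem_star hp).1 hu).1 ((hf.mem_star hp).1 hu').1
      ((hKmem u s).1 hs).2.1 ((hKmem u' s').1 hs').2.1 (add_left_cancel he)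
    simp only at h1 h2
    subst h1 h2
    rfl
  zify
  rw [hm, Finset.sum_insert hnot, Finset.sum_image hinj, Finset.sum_sigma,
    htm (p + v.1) (by rwa [add_sub_cancel_right]), add_sub_cancel_right, ← hN,
    ← Finset.sum_add_distrib]
  -- For each edge, the slope at the displaced centre plus the kinks up to `β` telescopes to the
  -- slope beyond `β`, which is `g.slope p u`.
  refine Finset.sum_congr rfl fun u hu => ?_
  have h1 : ∑ s ∈ K u, (transversalMult (f.translate v.1) (g.translate v.2) (φ ⟨u, s⟩) : ℤ) =
      ∑ s ∈ K u, g.kink z u s := by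
    refine Finset.sum_congr rfl fun s hs => ?_
    obtain ⟨-, hs0, hsβ⟩ := (hKmem u s).1 hs
    exact htmu u hu s hs0 (by linarith [hβU u hu s hs0.le hsβ.le])
  have h2 : g.slope (z + β • latticeVec u) (-u) = -g.slope p u := by
    refine slope_eq_of_forall fun a ha => ?_
    rw [idot_neg, hfar u hu β le_rfl ?_ a ha]
    have := norm_sub_le v.1 v.2
    exact (norm_add_le _ _).trans_lt (by linarith [hβU u hu β hβ0.le le_rfl])
  rw [h1, sum_kink g z u hβ0, h2, zero_smul, add_zero, hz, add_sub_assoc]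
  ring

/-! ### Finiteness -/

/-- Each quadruple of exponents with nonzero determinant imposes two independent linear equations,
which have at most one solution. -/
lemma finite_crossings (f g : TropPoly 2) :
    {p | ∃ a ∈ f.activeSet p, ∃ b ∈ f.activeSet p, ∃ c ∈ g.activeSet p, ∃ d ∈ g.activeSet p,
      latticeDet (a - b) (c - d) ≠ 0}.Finite := by
  refine Set.Finite.subset (s := ⋃ a ∈ f.support, ⋃ b ∈ f.support, ⋃ c ∈ g.support,
    ⋃ d ∈ g.support, {p | f.term a p = f.term b p ∧ g.term c p = g.term d p ∧
      latticeDet (a - b) (c - d) ≠ 0}) ?_ ?_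
  · refine Set.Finite.biUnion f.support.finite_toSet fun a _ =>
      Set.Finite.biUnion f.support.finite_toSet fun b _ =>
      Set.Finite.biUnion g.support.finite_toSet fun c _ =>
      Set.Finite.biUnion g.support.finite_toSet fun d _ => Set.Subsingleton.finite ?_
    rintro x ⟨hx1, hx2, hd⟩ y ⟨hy1, hy2, -⟩
    rw [term_eq, term_eq] at hx1 hx2 hy1 hy2
    have e1 : dot (a - b) (x - y) = 0 := by rw [sub_dot, dot_sub, dot_sub]; linarith
    have e2 : dot (c - d) (x - y) = 0 := by rw [sub_dot, dot_sub, dot_sub]; linarith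
    have hd' : (latticeDet (a - b) (c - d) : ℝ) ≠ 0 := by exact_mod_cast hd
    simp only [dot] at e1 e2
    simp only [latticeDet] at hd'
    push_cast at hd'
    have h0 : (x - y) 0 = 0 := by
      refine (mul_eq_zero.1 ?_).resolve_left hd'
      linear_combination ((c - d) 1 : ℝ) * e1 - ((a - b) 1 : ℝ) * e2
    have h1 : (x - y) 1 = 0 := by
      refine (mul_eq_zero.1 ?_).resolve_left hd'
      linear_combination ((a - b) 0 : ℝ) * e2 - ((c - d) 0 : ℝ) * e1
    refine sub_eq_zero.1 (funext fun i => ?_)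
    fin_cases i
    · exact h0
    · exact h1
  · rintro p ⟨a, ha, b, hb, c, hc, d, hd, h⟩
    simp only [Set.mem_iUnion]
    exact ⟨a, ha.1, b, hb.1, c, hc.1, d, hd.1, term_eq_of_active ha hb, term_eq_of_active hc hd, h⟩

lemma IsVertex.exists_latticeDet_ne (h : f.IsVertex p) :
    ∃ a ∈ f.activeSet p, ∃ b ∈ f.activeSet p, ∃ c ∈ f.activeSet p, ∃ d ∈ f.activeSet p,
      latticeDet (a - b) (c - d) ≠ 0 := by
  by_contra! hcon
  by_cases hnt : (f.activeSet p).Nontrivial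
  · obtain ⟨a, ha, b, hb, hab⟩ := hnt
    have hw : perp (a - b) ≠ 0 := by
      intro h0
      apply hab
      have e0 := congrFun h0 0
      have e1 := congrFun h0 1
      simp at e0 e1
      funext i; fin_cases i <;> simp <;> linarith
    refine not_isVertex_of_idot_eq hw (fun c hc d hd => ?_) h
    have := hcon a ha b hb c hc d hd
    rw [← idot_perp, idot_comm, sub_idot] at this
    linarith
  · rw [Set.not_nontrivial_iff] at hnt
    have hw : (![1, 0] : Fin 2 → ℤ) ≠ 0 := fun h0 => by simpa using congrFun h0 0
    exact not_isVertex_of_idot_eq hw (fun c hc d hd => by rw [hnt hc hd]) h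

/-- A vertex is a crossing of the curve with itself. -/
lemma finite_setOf_isVertex (f : TropPoly 2) : {p | f.IsVertex p}.Finite :=
  (finite_crossings f f).subset fun _ hp => IsVertex.exists_latticeDet_ne hp

/-- Away from the vertices a nonzero sum is a kink of `g` along the edge, so some difference of
active exponents of `g` is not parallel to those of `f`. -/
lemma finite_sum_slope_ne_zero (hf : f.IsUnimodular) (g : TropPoly 2) :
    {p : f.variety | ∑ v ∈ f.star p, g.slope p v ≠ 0}.Finite := by
  refine Set.Finite.of_finite_image (f := Subtype.val) ?_ Subtype.val_injective.injOn
  refine ((finite_setOf_isVertex f).union (finite_crossings f g)).subset ?_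
  rintro _ ⟨⟨p, hp⟩, hne, rfl⟩
  by_cases hv : f.IsVertex p
  · exact Or.inl hv
  right
  obtain ⟨u, hu⟩ := exists_onEdge hp hv
  have hk : g.kink p u 0 ≠ 0 := by
    have : ∑ v ∈ f.star p, g.slope p v ≠ 0 := hne
    rw [hu.sum_star hf] at this
    simpa [kink] using this
  obtain ⟨c, hc, d, hd, hcd⟩ := exists_of_kink_ne_zero hk
  rw [zero_smul, add_zero] at hc hd
  obtain ⟨a, ha, b, hb, hab⟩ := hu.2.1
  refine ⟨a, ha, b, hb, c, hc, d, hd, fun h0 => hcd ?_⟩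
  obtain ⟨k, hk⟩ := exists_eq_zsmul_perp hu.1
    (show idot (a - b) u = 0 by rw [sub_idot, hu.2.2 a ha b hb, sub_self])
  have hk0 : k ≠ 0 := by
    rintro rfl
    exact hab (sub_eq_zero.1 (by simpa using hk))
  rw [hk] at h0
  have : k * idot (c - d) u = 0 := by
    simp only [latticeDet, idot, Pi.smul_apply, smul_eq_mul, perp_zero, perp_one] at h0 ⊢
    linarith
  have := (mul_eq_zero.1 this).resolve_left hk0
  rw [sub_idot] at this
  linarith

/-- The divisor cut out by `g` on a unimodular curve `V(f)`. -/
def divOf (hf : f.IsUnimodular) (g : TropPoly 2) : Divisor f :=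
  Finsupp.ofSupportFinite (fun p => ∑ v ∈ f.star p, g.slope p v) (finite_sum_slope_ne_zero hf g)

lemma divOf_apply (hf : f.IsUnimodular) (g : TropPoly 2) (p : f.variety) :
    divOf hf g p = ∑ v ∈ f.star p, g.slope p v := rfl

theorem isDiv_divOf (hf : f.IsUnimodular) (g : TropPoly 2) : IsDiv f g (divOf hf g) := by
  intro p
  obtain ⟨m, hm⟩ := Int.eq_ofNat_of_zero_le (sum_slope_nonneg hf p.2 g p)
  exact ⟨m, hasStableMult_of_isUnimodular hf p.2 hm.symm, by rw [divOf_apply, hm]⟩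

/-! ### Tropical rational functions -/

/-- Indices sharing an exponent are merged by taking the largest constant; the default 0 is used
only outside the support. -/
lemma exists_eval_eq_sup' {ι : Type*} (I : Finset ι) (hI : I.Nonempty) (a : ι → Fin 2 → ℤ)
    (l : ι → ℝ) : ∃ g : TropPoly 2, ∀ x, g.eval x = I.sup' hI fun i => l i + dot (a i) x := by
  classical
  have hne : ∀ b ∈ I.image a, (I.filter fun i => a i = b).Nonempty := by
    intro b hb
    obtain ⟨i, hi, rfl⟩ := Finset.mem_image.1 hb
    exact ⟨i, Finset.mem_filter.2 ⟨hi, rfl⟩⟩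
  refine ⟨⟨I.image a, hI.image a, fun b => if h : (I.filter fun i => a i = b).Nonempty then
    (I.filter fun i => a i = b).sup' h l else 0⟩, fun x => ?_⟩
  apply le_antisymm
  · refine Finset.sup'_le _ _ fun b hb => ?_
    rw [term_eq]
    simp only
    rw [dif_pos (hne b hb)]
    obtain ⟨i, hi, he⟩ := Finset.exists_mem_eq_sup' (hne b hb) l
    rw [he, ← (Finset.mem_filter.1 hi).2]
    exact Finset.le_sup' (fun i => l i + dot (a i) x) (Finset.mem_filter.1 hi).1
  · refine Finset.sup'_le _ _ fun i hi => ?_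
    have hb : a i ∈ I.image a := Finset.mem_image_of_mem a hi
    refine le_trans ?_ (term_le_eval _ hb x)
    rw [term_eq]
    simp only
    rw [dif_pos (hne _ hb)]
    gcongr
    exact Finset.le_sup' l (s := I.filter fun j => a j = a i) (Finset.mem_filter.2 ⟨hi, rfl⟩)

lemma eval_eq (g : TropPoly 2) (x : Fin 2 → ℝ) :
    g.eval x = g.support.sup' g.support_nonempty fun a => g.coeff a + dot a x := by
  simp only [eval, term_eq]

lemma exists_eval_eq_add (g h : TropPoly 2) :
    ∃ k : TropPoly 2, ∀ x, k.eval x = g.eval x + h.eval x := by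
  obtain ⟨k, hk⟩ := exists_eval_eq_sup' (g.support ×ˢ h.support)
    (g.support_nonempty.product h.support_nonempty) (fun ab => ab.1 + ab.2)
    (fun ab => g.coeff ab.1 + h.coeff ab.2)
  refine ⟨k, fun x => ?_⟩
  have e : ∀ ab : (Fin 2 → ℤ) × (Fin 2 → ℤ), g.coeff ab.1 + h.coeff ab.2 + dot (ab.1 + ab.2) x =
      (g.coeff ab.1 + dot ab.1 x) + (h.coeff ab.2 + dot ab.2 x) := by
    intro ab
    simp [dot]; ring
  rw [hk, eval_eq, eval_eq]
  simp only [e]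
  apply le_antisymm
  · refine Finset.sup'_le _ _ fun ab hab => ?_
    obtain ⟨h1, h2⟩ := Finset.mem_product.1 hab
    exact add_le_add (Finset.le_sup' (fun a => g.coeff a + dot a x) h1)
      (Finset.le_sup' (fun a => h.coeff a + dot a x) h2)
  · obtain ⟨a, ha, hae⟩ := Finset.exists_mem_eq_sup' g.support_nonempty
      (fun a => g.coeff a + dot a x)
    obtain ⟨b, hb, hbe⟩ := Finset.exists_mem_eq_sup' h.support_nonempty
      (fun a => h.coeff a + dot a x)
    rw [hae, hbe]
    exact Finset.le_sup' (fun ab : (Fin 2 → ℤ) × (Fin 2 → ℤ) =>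
      (g.coeff ab.1 + dot ab.1 x) + (h.coeff ab.2 + dot ab.2 x)) (Finset.mk_mem_product ha hb)

lemma exists_eval_eq_max (g h : TropPoly 2) :
    ∃ k : TropPoly 2, ∀ x, k.eval x = max (g.eval x) (h.eval x) := by
  obtain ⟨k, hk⟩ := exists_eval_eq_sup' (g.support.disjSum h.support)
    (by
      obtain ⟨a, ha⟩ := g.support_nonempty
      exact ⟨Sum.inl a, Finset.inl_mem_disjSum.2 ha⟩)
    (Sum.elim id id) (Sum.elim g.coeff h.coeff)
  refine ⟨k, fun x => ?_⟩
  rw [hk, eval_eq, eval_eq]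
  apply le_antisymm
  · refine Finset.sup'_le _ _ fun i hi => ?_
    rcases Finset.mem_disjSum.1 hi with ⟨a, ha, rfl⟩ | ⟨a, ha, rfl⟩
    · exact le_max_of_le_left (Finset.le_sup' (fun a => g.coeff a + dot a x) ha)
    · exact le_max_of_le_right (Finset.le_sup' (fun a => h.coeff a + dot a x) ha)
  · refine max_le (Finset.sup'_le _ _ fun a ha => ?_) (Finset.sup'_le _ _ fun a ha => ?_)
    · exact Finset.le_sup' (fun i => Sum.elim g.coeff h.coeff i + dot (Sum.elim id id i) x)
        (Finset.inl_mem_disjSum.2 ha)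
    · exact Finset.le_sup' (fun i => Sum.elim g.coeff h.coeff i + dot (Sum.elim id id i) x)
        (Finset.inr_mem_disjSum.2 ha)

lemma exists_eval_eq_affine (a : Fin 2 → ℤ) (c : ℝ) :
    ∃ k : TropPoly 2, ∀ x, k.eval x = dot a x + c := by
  refine ⟨⟨{a}, by simp, fun _ => c⟩, fun x => ?_⟩
  rw [eval_eq]
  simp [add_comm]

/-- A difference of two tropical polynomial functions. -/
def IsTropRational (φ : (Fin 2 → ℝ) → ℝ) : Prop :=
  ∃ g h : TropPoly 2, ∀ x, φ x = g.eval x - h.eval x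

namespace IsTropRational

variable {φ ψ : (Fin 2 → ℝ) → ℝ}

lemma affine (a : Fin 2 → ℤ) (c : ℝ) : IsTropRational fun x => dot a x + c := by
  obtain ⟨g, hg⟩ := exists_eval_eq_affine a c
  obtain ⟨h, hh⟩ := exists_eval_eq_affine 0 0
  exact ⟨g, h, fun x => by rw [hg, hh]; simp [dot]⟩

lemma const (c : ℝ) : IsTropRational fun _ => c := by
  simpa [dot] using affine 0 c

lemma dot_sub (a : Fin 2 → ℤ) (p : Fin 2 → ℝ) : IsTropRational fun x => dot a (x - p) := by
  have e : (fun x => dot a (x - p)) = fun x => dot a x + -dot a p :=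
    funext fun x => by rw [_root_.dot_sub, sub_eq_add_neg]
  rw [e]
  exact affine a (-dot a p)

lemma neg (hφ : IsTropRational φ) : IsTropRational fun x => -φ x := by
  obtain ⟨g, h, e⟩ := hφ
  exact ⟨h, g, fun x => by simp only [e]; ring⟩

lemma add (hφ : IsTropRational φ) (hψ : IsTropRational ψ) : IsTropRational fun x => φ x + ψ x := by
  obtain ⟨g, h, e⟩ := hφ
  obtain ⟨g', h', e'⟩ := hψ
  obtain ⟨k, hk⟩ := exists_eval_eq_add g g'
  obtain ⟨l, hl⟩ := exists_eval_eq_add h h'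
  exact ⟨k, l, fun x => by simp only [e, e', hk, hl]; ring⟩

lemma sub (hφ : IsTropRational φ) (hψ : IsTropRational ψ) : IsTropRational fun x => φ x - ψ x := by
  simpa only [sub_eq_add_neg] using hφ.add hψ.neg

/-- max(g - h, g' - h') = max(g + h', g' + h) - (h + h'). -/
lemma max (hφ : IsTropRational φ) (hψ : IsTropRational ψ) :
    IsTropRational fun x => Max.max (φ x) (ψ x) := by
  obtain ⟨g, h, e⟩ := hφ
  obtain ⟨g', h', e'⟩ := hψ
  obtain ⟨k, hk⟩ := exists_eval_eq_add g h'
  obtain ⟨l, hl⟩ := exists_eval_eq_add g' h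
  obtain ⟨m, hm⟩ := exists_eval_eq_max k l
  obtain ⟨n, hn⟩ := exists_eval_eq_add h h'
  refine ⟨m, n, fun x => ?_⟩
  simp only [e, e', hm, hn, hk, hl, ← max_sub_sub_right]
  congr 1 <;> ring

lemma min (hφ : IsTropRational φ) (hψ : IsTropRational ψ) :
    IsTropRational fun x => Min.min (φ x) (ψ x) := by
  have := (hφ.neg.max hψ.neg).neg
  simpa only [max_neg_neg, neg_neg] using this

lemma abs (hφ : IsTropRational φ) : IsTropRational fun x => |φ x| := hφ.max hφ.neg

lemma zsmul (hφ : IsTropRational φ) (n : ℤ) : IsTropRational fun x => (n : ℝ) * φ x := by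
  induction n using Int.induction_on with
  | zero => simpa using const 0
  | succ n ih =>
    have e : (fun x => (((n : ℤ) + 1 : ℤ) : ℝ) * φ x) = fun x => ((n : ℤ) : ℝ) * φ x + φ x :=
      funext fun x => by push_cast; ring
    rw [e]
    exact ih.add hφ
  | pred n ih =>
    have e : (fun x => ((-(n : ℤ) - 1 : ℤ) : ℝ) * φ x) = fun x => ((-(n : ℤ) : ℤ) : ℝ) * φ x - φ x :=
      funext fun x => by push_cast; ring
    rw [e]
    exact ih.sub hφ

lemma continuous (hφ : IsTropRational φ) : Continuous φ := by
  obtain ⟨g, h, e⟩ := hφ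
  have key : ∀ g : TropPoly 2, Continuous g.eval := fun g =>
    Continuous.finset_sup'_apply _ fun a _ => continuous_term g a
  rw [show φ = fun x => g.eval x - h.eval x from funext e]
  exact (key g).sub (key h)

end IsTropRational

/-! ### Principal divisors from tropical rational functions -/

/-- The exponents of the homogenization of degree zero. -/
def homogenizeExp (b : Fin 2 → ℤ) : Fin 3 → ℤ := ![b 0, b 1, -b 0 - b 1]

/-- The homogenization of degree zero. -/
def homogenize (g : TropPoly 2) : TropPoly 3 where
  support := g.support.image homogenizeExp
  support_nonempty := g.support_nonempty.image _
  coeff := fun a => g.coeff ![a 0, a 1]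

lemma homogenize_isHomogeneous (g : TropPoly 2) : g.homogenize.IsHomogeneous 0 := by
  intro a ha
  obtain ⟨b, -, rfl⟩ := Finset.mem_image.1 ha
  simp [homogenizeExp, Fin.sum_univ_three]

lemma dehomogenize_homogenize (g : TropPoly 2) : g.homogenize.dehomogenize 0 = g := by
  have e : ∀ b : Fin 2 → ℤ, ![b 0, b 1] = b := fun b => by
    funext i; fin_cases i <;> rfl
  obtain ⟨s, hs, c⟩ := g
  simp only [dehomogenize, homogenize, mk.injEq]
  constructor
  · rw [Finset.image_image]
    have : ((fun a : Fin 3 → ℤ => ![a 0, a 1]) ∘ homogenizeExp) = id := funext e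
    rw [this, Finset.image_id]
  · funext b
    exact congrArg c (e b)

variable {f : TropPoly 2} {p : Fin 2 → ℝ}

/-- The divisors of tropical rational functions on a unimodular curve. -/
def principalSubgroup (hf : f.IsUnimodular) : AddSubgroup (Divisor f) where
  carrier := {D | ∃ g h : TropPoly 2, D = divOf hf g - divOf hf h}
  zero_mem' := by
    obtain ⟨g, -⟩ := exists_eval_eq_affine 0 0
    exact ⟨g, g, (sub_self _).symm⟩
  add_mem' := by
    -- Outgoing slopes are additive under addition of functions, so a tropical product realises the
    -- sum of two divisors.
    have key : ∀ g h : TropPoly 2, ∃ k, divOf hf k = divOf hf g + divOf hf h := by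
      intro g h
      obtain ⟨k, hk⟩ := exists_eval_eq_add g h
      refine ⟨k, Finsupp.ext fun p => ?_⟩
      rw [Finsupp.add_apply, divOf_apply, divOf_apply, divOf_apply, ← Finset.sum_add_distrib]
      refine Finset.sum_congr rfl fun v _ => ?_
      obtain ⟨t, ⟨⟨h1, h2⟩, h3⟩, ht⟩ := (((g.eventually_eval_eq_slope p v).and
        (h.eventually_eval_eq_slope p v)).and (k.eventually_eval_eq_slope p v)).and
        self_mem_nhdsWithin |>.exists
      rw [hk, hk, h1, h2] at h3
      have ht : 0 < t := ht
      have h4 : (t : ℝ) * k.slope p v = t * (g.slope p v + h.slope p v) := by linarith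
      exact_mod_cast mul_left_cancel₀ ht.ne' h4
    rintro D E ⟨g, h, rfl⟩ ⟨g', h', rfl⟩
    obtain ⟨k, hk⟩ := key g g'
    obtain ⟨l, hl⟩ := key h h'
    exact ⟨k, l, by rw [hk, hl]; abel⟩
  neg_mem' := by
    rintro D ⟨g, h, rfl⟩
    exact ⟨h, g, neg_sub _ _⟩

lemma isPrincipal_of_mem (hf : f.IsUnimodular) {D : Divisor f} (hD : D ∈ principalSubgroup hf) :
    IsPrincipal f D := by
  obtain ⟨g, h, rfl⟩ := hD
  refine ⟨0, g.homogenize, h.homogenize, g.homogenize_isHomogeneous, h.homogenize_isHomogeneous,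
    divOf hf g, divOf hf h, ?_, ?_, rfl⟩
  · rw [dehomogenize_homogenize]; exact isDiv_divOf hf g
  · rw [dehomogenize_homogenize]; exact isDiv_divOf hf h

/-- `φ` has slope `k` at `p` in direction `v`. -/
def HasSlope (φ : (Fin 2 → ℝ) → ℝ) (p : Fin 2 → ℝ) (v : Fin 2 → ℤ) (k : ℤ) : Prop :=
  ∀ᶠ t in 𝓝[>] (0 : ℝ), φ (p + t • latticeVec v) = φ p + t * k

/-- A divisor whose coefficients are the sums of outgoing slopes of a tropical rational function
is principal. -/
lemma mem_principalSubgroup (hf : f.IsUnimodular) {D : Divisor f} {φ : (Fin 2 → ℝ) → ℝ}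
    (hφ : IsTropRational φ) (h : ∀ p : f.variety, ∃ k : (Fin 2 → ℤ) → ℤ,
      (∀ v, f.IsEdgeDirection p v → HasSlope φ p v (k v)) ∧ ∑ v ∈ f.star p, k v = D p) :
    D ∈ principalSubgroup hf := by
  obtain ⟨g, l, e⟩ := hφ
  refine ⟨g, l, Finsupp.ext fun p => ?_⟩
  obtain ⟨k, hk, hD⟩ := h p
  rw [Finsupp.sub_apply, divOf_apply, divOf_apply, ← Finset.sum_sub_distrib, ← hD]
  refine Finset.sum_congr rfl fun v hv => ?_
  obtain ⟨t, ⟨⟨h1, h2⟩, h3⟩, ht⟩ := (((g.eventually_eval_eq_slope p v).and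
    (l.eventually_eval_eq_slope p v)).and (hk v ((hf.mem_star p.2).1 hv))).and
    self_mem_nhdsWithin |>.exists
  rw [e, e, h1, h2] at h3
  have ht : 0 < t := ht
  have h4 : (t : ℝ) * k v = t * (g.slope p v - l.slope p v) := by linarith
  exact_mod_cast mul_left_cancel₀ ht.ne' h4

/-! ### Principal divisors supported on a single edge -/

variable {f : TropPoly 2} {p : Fin 2 → ℝ} {u : Fin 2 → ℤ}

open scoped Classical in
/-- The divisor of a single point (zero if the point is not on the curve). -/
def pointDiv (f : TropPoly 2) (x : Fin 2 → ℝ) : Divisor f :=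
  if h : x ∈ f.variety then Finsupp.single ⟨x, h⟩ 1 else 0

open scoped Classical in
lemma pointDiv_apply (x : Fin 2 → ℝ) (p : f.variety) :
    pointDiv f x p = if (p : Fin 2 → ℝ) = x then 1 else 0 := by
  rw [pointDiv]
  split_ifs with h h1 h1
  · have : p = ⟨x, h⟩ := Subtype.ext h1
    rw [this, Finsupp.single_eq_same]
  · rw [Finsupp.single_eq_of_ne]
    exact fun h2 => h1 (congrArg Subtype.val h2)
  · exact absurd (h1 ▸ p.2) h
  · rfl

lemma pointDiv_coe (p : f.variety) : pointDiv f p = Finsupp.single p 1 := by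
  rw [pointDiv, dif_pos p.2]

lemma smul_latticeVec_left_inj (hu : IsPrimitiveVec u) {s t : ℝ}
    (h : s • latticeVec u = t • latticeVec u) : s = t := by
  obtain ⟨w, hw⟩ := hu.exists_idot
  have := congrArg (dot w) h
  simpa [dot_smul, hw] using this

/-- Expansion of a vector in the basis `u, perp w`. -/
lemma eq_smul_add_smul {u w : Fin 2 → ℤ} (hw : idot w u = 1) (y : Fin 2 → ℝ) :
    y = dot w y • latticeVec u + dot (perp u) y • latticeVec (perp w) := by
  have hw' : (w 0 : ℝ) * u 0 + w 1 * u 1 = 1 := by exact_mod_cast hw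
  funext i
  fin_cases i
  · simp [dot]; linear_combination (-y 0) * hw'
  · simp [dot]; linear_combination (-y 1) * hw'

lemma eventually_max_add (d : ℝ) :
    ∀ᶠ t in 𝓝[>] (0 : ℝ), max 0 (d + t) = max 0 d + t * (if 0 ≤ d then 1 else 0) := by
  split_ifs with h
  · filter_upwards [self_mem_nhdsWithin] with t ht
    have ht : 0 < t := ht
    rw [max_eq_right h, max_eq_right (by linarith)]; ring
  · filter_upwards [Ioo_mem_nhdsGT (show 0 < -d by linarith)] with t ht
    rw [max_eq_left (by linarith [ht.2] : d + t ≤ 0), max_eq_left (by linarith : d ≤ 0)]; ring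

lemma eventually_max_sub (d : ℝ) :
    ∀ᶠ t in 𝓝[>] (0 : ℝ), max 0 (d - t) = max 0 d - t * (if 0 < d then 1 else 0) := by
  split_ifs with h
  · filter_upwards [Ioo_mem_nhdsGT h] with t ht
    rw [max_eq_right h.le, max_eq_right (by linarith [ht.2])]; ring
  · filter_upwards [self_mem_nhdsWithin] with t ht
    have ht : 0 < t := ht
    rw [max_eq_left (by linarith), max_eq_left (by linarith)]; ring

open scoped Classical in
/-- A tropical rational function which is locally constant on the curve away from a segment of an
edge, and piecewise linear on the segment, gives a principal divisor supported on the segment. -/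
lemma sum_pointDiv_mem {ι : Type*} [Fintype ι] (hf : f.IsUnimodular) {x₀ : Fin 2 → ℝ}
    (hu : f.IsEdgeDirection x₀ u) {β γ : ℝ} (hγβ : γ < β)
    (hedge : ∀ τ, 0 < τ → τ < β → f.OnEdge (x₀ + τ • latticeVec u) u)
    {φ : (Fin 2 → ℝ) → ℝ} (hφ : IsTropRational φ) (c : ι → ℝ) (n : ι → ℤ)
    (hc : ∀ i, 0 ≤ c i ∧ c i ≤ γ)
    (hline : ∀ τ, 0 ≤ τ → τ < β → φ (x₀ + τ • latticeVec u) = ∑ i, (n i : ℝ) * max 0 (τ - c i))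
    (hconst : ∀ p ∈ f.variety, (∀ τ, 0 ≤ τ → τ ≤ γ → p ≠ x₀ + τ • latticeVec u) →
      ∀ᶠ y in 𝓝[f.variety] p, φ y = φ p)
    (hother : ∀ v, f.IsEdgeDirection x₀ v → v ≠ u → HasSlope φ x₀ v 0) :
    ∑ i, n i • pointDiv f (x₀ + c i • latticeVec u) ∈ principalSubgroup hf := by
  have hup := hu.1
  have hD : ∀ p : f.variety, (∑ i, n i • pointDiv f (x₀ + c i • latticeVec u)) p =
      ∑ i, n i * (if (p : Fin 2 → ℝ) = x₀ + c i • latticeVec u then 1 else 0) := by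
    intro p
    rw [Finsupp.finsetSum_apply]
    refine Finset.sum_congr rfl fun i _ => ?_
    rw [Finsupp.smul_apply, pointDiv_apply, smul_eq_mul]
  -- The slope forwards counts the breakpoints `c i ≤ τ`, the slope backwards those with `c i < τ`,
  -- with opposite sign; their sum retains exactly the breakpoints at `τ`.
  have hright : ∀ τ, 0 ≤ τ → τ < β → HasSlope φ (x₀ + τ • latticeVec u) u
      (∑ i, n i * (if c i ≤ τ then 1 else 0)) := by
    intro τ h0 h1
    have hev : ∀ᶠ t in 𝓝[>] (0 : ℝ), ∀ i, max 0 ((τ - c i) + t) =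
        max 0 (τ - c i) + t * (if 0 ≤ τ - c i then 1 else 0) :=
      eventually_all.2 fun i => eventually_max_add _
    filter_upwards [hev, Ioo_mem_nhdsGT (sub_pos.2 h1)] with t ht ht1
    rw [add_assoc, ← add_smul, hline _ (by linarith [ht1.1]) (by linarith [ht1.2]),
      hline _ h0 h1]
    push_cast
    rw [Finset.mul_sum, ← Finset.sum_add_distrib]
    refine Finset.sum_congr rfl fun i _ => ?_
    rw [add_sub_right_comm, ht i]
    simp only [sub_nonneg]
    ring
  have hleft : ∀ τ, 0 < τ → τ < β → HasSlope φ (x₀ + τ • latticeVec u) (-u)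
      (-∑ i, n i * (if c i < τ then 1 else 0)) := by
    intro τ h0 h1
    have hev : ∀ᶠ t in 𝓝[>] (0 : ℝ), ∀ i, max 0 ((τ - c i) - t) =
        max 0 (τ - c i) - t * (if 0 < τ - c i then 1 else 0) :=
      eventually_all.2 fun i => eventually_max_sub _
    filter_upwards [hev, Ioo_mem_nhdsGT h0] with t ht ht1
    rw [latticeVec_neg, smul_neg, add_assoc, ← sub_eq_add_neg, ← sub_smul,
      hline _ (by linarith [ht1.2]) (by linarith [ht1.1]), hline _ h0.le h1]
    push_cast
    rw [mul_neg, ← sub_eq_add_neg, Finset.mul_sum, ← Finset.sum_sub_distrib]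
    refine Finset.sum_congr rfl fun i _ => ?_
    rw [sub_right_comm, ht i]
    simp only [sub_pos]
    ring
  have hinj : ∀ τ i, x₀ + τ • latticeVec u = x₀ + c i • latticeVec u ↔ c i = τ := fun τ i =>
    ⟨fun h => (smul_latticeVec_left_inj hup (add_left_cancel h)).symm, fun h => by rw [h]⟩
  refine mem_principalSubgroup hf hφ fun p => ?_
  rw [hD]
  by_cases hp : ∃ τ, 0 ≤ τ ∧ τ ≤ γ ∧ (p : Fin 2 → ℝ) = x₀ + τ • latticeVec u
  · obtain ⟨τ, h0, h1, he⟩ := hp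
    -- The end `x₀` may be a vertex; there only the edge `u` contributes, the other slopes vanishing
    -- by `hother`.
    rcases h0.eq_or_lt with rfl | h0
    · rw [zero_smul, add_zero] at he
      refine ⟨fun v => if v = u then ∑ i, n i * (if c i ≤ 0 then 1 else 0) else 0, ?_, ?_⟩
      · intro v hv
        rw [he] at hv ⊢
        dsimp only
        split_ifs with h
        · subst h
          simpa using hright 0 le_rfl (by linarith)
        · exact hother v hv h
      · rw [Finset.sum_ite_eq', if_pos ((hf.mem_star p.2).2 (he ▸ hu))]
        refine Finset.sum_congr rfl fun i _ => ?_
        have := hinj 0 i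
        rw [zero_smul, add_zero] at this
        rw [he]
        simp only [this]
        have : c i ≤ 0 ↔ c i = 0 := ⟨fun h => le_antisymm h (hc i).1, fun h => h.le⟩
        simp only [this]
    · have hE := hedge τ h0 (by linarith)
      refine ⟨fun v => if v = u then ∑ i, n i * (if c i ≤ τ then 1 else 0) else
        -∑ i, n i * (if c i < τ then 1 else 0), ?_, ?_⟩
      · intro v hv
        rw [he] at hv ⊢
        dsimp only
        rcases hE.isEdgeDirection_iff.1 hv with rfl | rfl
        · rw [if_pos rfl]
          exact hright τ h0.le (by linarith)
        · rw [if_neg (ne_neg_of_isPrimitiveVec hup).symm]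
          exact hleft τ h0 (by linarith)
      · rw [he, hE.sum_star hf, if_pos rfl, if_neg (ne_neg_of_isPrimitiveVec hup).symm,
          ← sub_eq_add_neg, ← Finset.sum_sub_distrib]
        refine Finset.sum_congr rfl fun i _ => ?_
        simp only [hinj]
        rcases lt_trichotomy (c i) τ with h | h | h
        · simp [h, h.le, h.ne]
        · simp [h]
        · simp [h.not_ge, h.not_gt, h.ne']
  · push Not at hp
    refine ⟨fun _ => 0, ?_, ?_⟩
    · intro v hv
      have hev := hconst p p.2 fun τ h0 h1 => hp τ h0 h1
      have ht : Tendsto (fun t : ℝ => (p : Fin 2 → ℝ) + t • latticeVec v) (𝓝[>] 0)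
          (𝓝[f.variety] p) := by
        refine tendsto_nhdsWithin_iff.2 ⟨?_, hv.2⟩
        simpa using (tendsto_smul_nhdsGT (latticeVec v)).const_add (p : Fin 2 → ℝ)
      filter_upwards [ht.eventually hev] with t ht
      rw [ht]; simp
    · rw [Finset.sum_const_zero]
      refine (Finset.sum_eq_zero fun i _ => ?_).symm
      rw [if_neg (hp (c i) (hc i).1 (hc i).2), mul_zero]

lemma isClosed_segment_image (x₀ y : Fin 2 → ℝ) (γ : ℝ) :
    IsClosed ((fun τ : ℝ => x₀ + τ • y) '' Set.Icc 0 γ) :=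
  (isCompact_Icc.image (by fun_prop)).isClosed

lemma eventually_not_mem_segment {x₀ y p : Fin 2 → ℝ} {γ : ℝ} (V : Set (Fin 2 → ℝ))
    (h : ∀ τ, 0 ≤ τ → τ ≤ γ → p ≠ x₀ + τ • y) :
    ∀ᶠ q in 𝓝[V] p, ∀ τ, 0 ≤ τ → τ ≤ γ → q ≠ x₀ + τ • y := by
  have : p ∈ ((fun τ : ℝ => x₀ + τ • y) '' Set.Icc 0 γ)ᶜ := by
    rintro ⟨τ, ⟨h0, h1⟩, he⟩
    exact h τ h0 h1 he.symm
  filter_upwards [nhdsWithin_le_nhds ((isClosed_segment_image x₀ y γ).isOpen_compl.mem_nhds this)]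
    with q hq τ h0 h1 he
  exact hq ⟨τ, ⟨h0, h1⟩, he.symm⟩

/-- Points in arithmetic progression along an edge satisfy a second order relation. -/
lemma exists_bump (hf : f.IsUnimodular) {x₀ : Fin 2 → ℝ} (hx : x₀ ∈ f.variety)
    (hu : f.IsEdgeDirection x₀ u) : ∃ ε > 0, ∀ s e : ℝ, 0 < e → e ≤ s → s + e < ε →
      pointDiv f (x₀ + (s - e) • latticeVec u) - (2 : ℤ) • pointDiv f (x₀ + s • latticeVec u) +
        pointDiv f (x₀ + (s + e) • latticeVec u) ∈ principalSubgroup hf := by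
  obtain ⟨ε₀, hε₀, hcon, hface⟩ := f.exists_ball_conic x₀
  obtain ⟨w, hw⟩ := hu.1.exists_idot
  -- On another edge `v` transverse to `u`, the penalty `N * |dot (perp u) _|` is at least the
  -- possible gain in `dot w`, so the tent below has argument at most `e - s ≤ 0` there.
  obtain ⟨N, hN⟩ : ∃ N : ℤ, ∀ v ∈ f.star x₀, |idot w v| ≤ N := by
    obtain ⟨N, hN⟩ := ((f.star x₀).finite_toSet.image fun v => |idot w v|).bddAbove
    exact ⟨N, fun v hv => hN ⟨v, hv, rfl⟩⟩
  have hN1 : 1 ≤ N := by simpa [hw] using hN u ((hf.mem_star hx).2 hu)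
  have hN1' : (1 : ℝ) ≤ N := by exact_mod_cast hN1
  set L := ‖latticeVec u‖ + ‖latticeVec (perp w)‖ + 1 with hL
  have hL0 : 0 < L := by positivity
  refine ⟨ε₀ / L, by positivity, fun s e he hes hse => ?_⟩
  have hnorm : ∀ y : Fin 2 → ℝ, |dot w y| < ε₀ / L → |dot (perp u) y| < ε₀ / L → ‖y‖ < ε₀ := by
    intro y h1 h2
    conv_lhs => rw [eq_smul_add_smul hw y]
    calc _ ≤ |dot w y| * ‖latticeVec u‖ + |dot (perp u) y| * ‖latticeVec (perp w)‖ := by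
          refine (norm_add_le _ _).trans ?_
          rw [norm_smul, norm_smul, Real.norm_eq_abs, Real.norm_eq_abs]
      _ ≤ ε₀ / L * ‖latticeVec u‖ + ε₀ / L * ‖latticeVec (perp w)‖ := by gcongr
      _ < ε₀ / L * L := by
          rw [← mul_add]
          exact mul_lt_mul_of_pos_left (by rw [hL]; linarith) (by positivity)
      _ = ε₀ := by field_simp
  have hedge : ∀ τ, 0 < τ → τ < ε₀ / L → f.OnEdge (x₀ + τ • latticeVec u) u := by
    intro τ h0 h1
    refine onEdge_of_activeSet_eq_face hu (hface u τ h0 (hnorm _ ?_ ?_))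
    · rw [dot_smul, dot_latticeVec, hw, abs_of_pos (by simpa using h0)]; simpa using h1
    · rw [dot_smul, dot_latticeVec, idot_perp_self]; simpa using by positivity
  -- A tent of height `e` centred at `x₀ + s • latticeVec u`. On the curve it is positive only on
  -- the edge `u`; when `e = s` its foot is exactly `x₀`.
  set φ : (Fin 2 → ℝ) → ℝ := fun x => max 0 (e - |dot w (x - (x₀ + s • latticeVec u))| -
    (N : ℝ) * |dot (perp u) (x - (x₀ + s • latticeVec u))|) with hφ
  have hφt : IsTropRational φ :=
    (IsTropRational.const 0).max (((IsTropRational.const e).sub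
      (IsTropRational.dot_sub w _).abs).sub ((IsTropRational.dot_sub (perp u) _).abs.zsmul N))
  have hφy : ∀ y, φ (x₀ + y) = max 0 (e - |dot w y - s| - (N : ℝ) * |dot (perp u) y|) := by
    intro y
    rw [hφ]
    simp only [add_sub_add_left_eq_sub, dot_sub, dot_smul, dot_latticeVec, hw, idot_perp_self]
    simp
  have hpos : ∀ q ∈ f.variety, 0 < φ q → ∃ τ, 0 < τ ∧ τ < s + e ∧ q = x₀ + τ • latticeVec u := by
    intro q hq hpos
    obtain ⟨y, rfl⟩ : ∃ y, q = x₀ + y := ⟨q - x₀, by abel⟩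
    rw [hφy] at hpos
    have hpos : 0 < e - |dot w y - s| - (N : ℝ) * |dot (perp u) y| :=
      (lt_max_iff.1 hpos).resolve_left (lt_irrefl 0)
    have hNa : |dot (perp u) y| ≤ N * |dot (perp u) y| :=
      le_mul_of_one_le_left (abs_nonneg _) hN1'
    have ha := abs_nonneg (dot (perp u) y)
    have hb := abs_nonneg (dot w y - s)
    have h1 : |dot w y - s| < e := by linarith
    rw [abs_lt] at h1
    by_cases hy0 : y = 0
    · rw [hy0, dot_zero] at h1
      linarith
    obtain ⟨v, hv, τ, hτ, hyτ⟩ := hcon y (hnorm y (by rw [abs_lt]; constructor <;> linarith)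
      (by linarith)) hy0 hq
    by_cases hvu : v = u
    · subst hvu
      rw [hyτ, dot_smul, dot_latticeVec, hw] at h1
      push_cast at h1
      exact ⟨τ, hτ, by linarith, by rw [hyτ]⟩
    exfalso
    rw [hyτ, dot_smul, dot_smul, dot_latticeVec, dot_latticeVec] at hpos
    by_cases hd : latticeDet u v = 0
    · rcases eq_or_eq_neg_of_latticeDet hu.1 hv.1 hd with h | h
      · exact hvu h
      · rw [h, idot_neg, idot_neg, hw, idot_perp_self] at hpos
        simp only [Int.cast_neg, Int.cast_one, neg_zero, Int.cast_zero, mul_zero, abs_zero,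
          sub_zero] at hpos
        have := neg_abs_le (τ * (-1) - s)
        linarith
    · have h2 : (1 : ℝ) ≤ |(idot (perp u) v : ℝ)| := by
        rw [idot_perp]
        exact_mod_cast Int.one_le_abs hd
      have h3 : |(idot w v : ℝ)| ≤ N := by
        exact_mod_cast hN v ((hf.mem_star hx).2 hv)
      rw [abs_mul, abs_of_pos hτ] at hpos
      have h4 : s - τ * |(idot w v : ℝ)| ≤ |τ * idot w v - s| := by
        have h5 : τ * (idot w v : ℝ) ≤ τ * |(idot w v : ℝ)| :=
          mul_le_mul_of_nonneg_left (le_abs_self _) hτ.le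
        have := neg_abs_le (τ * (idot w v : ℝ) - s)
        linarith
      have h5 : τ * |(idot w v : ℝ)| ≤ N * (τ * |(idot (perp u) v : ℝ)|) := by
        calc τ * |(idot w v : ℝ)| ≤ τ * N := by gcongr
          _ = N * (τ * 1) := by ring
          _ ≤ _ := by gcongr
      linarith
  have hzero : ∀ q ∈ f.variety, (∀ τ, 0 ≤ τ → τ ≤ s + e → q ≠ x₀ + τ • latticeVec u) → φ q = 0 := by
    intro q hq hn
    by_contra hne
    obtain ⟨τ, h0, h1, he⟩ := hpos q hq (lt_of_le_of_ne (le_max_left _ _) (Ne.symm hne))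
    exact hn τ h0.le h1.le he
  have hx0 : φ x₀ = 0 := by
    have := hφy 0
    rw [add_zero, dot_zero, dot_zero, zero_sub, abs_neg, abs_of_pos (by linarith : 0 < s)] at this
    rw [this, max_eq_left]
    simp; linarith
  -- Along the edge the tent is the second difference of `max 0` at the three equally spaced
  -- breakpoints.
  have key := sum_pointDiv_mem hf hu hse hedge hφt ![s - e, s, s + e] ![1, -2, 1] ?_ ?_ ?_ ?_
  · rw [Fin.sum_univ_three] at key
    simpa [sub_eq_add_neg] using key
  · intro i
    fin_cases i
    · constructor <;> simp <;> linarith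
    · constructor <;> simp <;> linarith
    · exact ⟨by simp; linarith, by simp⟩
  · intro τ h0 h1
    rw [hφy, Fin.sum_univ_three, dot_smul, dot_smul, dot_latticeVec, dot_latticeVec, hw,
      idot_perp_self]
    simp only [Matrix.cons_val_zero, Matrix.cons_val_one, Matrix.cons_val]
    push_cast
    simp only [mul_zero, abs_zero, sub_zero, mul_one, one_mul]
    rcases le_total τ (s - e) with h2 | h2
    · rw [abs_of_nonpos (by linarith), max_eq_left (by linarith), max_eq_left (by linarith),
        max_eq_left (by linarith), max_eq_left (by linarith)]
      ring
    rcases le_total τ s with h3 | h3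
    · rw [abs_of_nonpos (by linarith), max_eq_right (by linarith), max_eq_right (by linarith),
        max_eq_left (by linarith), max_eq_left (by linarith)]
      ring
    rcases le_total τ (s + e) with h4 | h4
    · rw [abs_of_nonneg (by linarith), max_eq_right (by linarith), max_eq_right (by linarith),
        max_eq_right (by linarith), max_eq_left (by linarith)]
      ring
    · rw [abs_of_nonneg (by linarith), max_eq_left (by linarith), max_eq_right (by linarith),
        max_eq_right (by linarith), max_eq_right (by linarith)]
      ring
  · intro q hq hn
    filter_upwards [eventually_not_mem_segment f.variety hn, self_mem_nhdsWithin] with y hy hyV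
    rw [hzero y hyV hy, hzero q hq hn]
  · intro v hv hvu
    filter_upwards [hv.2, self_mem_nhdsWithin] with t ht ht0
    have ht0 : 0 < t := ht0
    rw [hx0, hzero _ ht]
    · simp
    · intro τ h0 _ he
      have he := add_left_cancel he
      rcases h0.eq_or_lt with rfl | h0
      · rw [zero_smul] at he
        rcases smul_eq_zero.1 he with h | h
        · exact ht0.ne' h
        · refine hv.1.ne_zero (latticeVec_injective (h.trans ?_))
          funext i; simp
      · exact hvu (smul_latticeVec_inj hv.1 hu.1 ht0 h0 he).1

/-! ### Functions separating the two sides of an edge -/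

/-- `φ` takes values in `[0, kt]`, increases with slope `k` along the segment from `P` to
`P + tu`, and on the curve takes intermediate values on this segment only. -/
structure IsSeparator (f : TropPoly 2) (P : Fin 2 → ℝ) (u : Fin 2 → ℤ) (t : ℝ) (k : ℤ)
    (φ : (Fin 2 → ℝ) → ℝ) : Prop where
  isTropRational : IsTropRational φ
  nonneg : ∀ x, 0 ≤ φ x
  le : ∀ x, φ x ≤ k * t
  line : ∀ s : ℝ, φ (P + s • latticeVec u) = max 0 (min (k * s) (k * t))
  eq_of_mem : ∀ x ∈ f.variety, 0 < φ x → φ x < k * t →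
    ∃ s ∈ Set.Ioo 0 t, x = P + s • latticeVec u

/-- Reversing the segment exchanges the two constant values. This reduces recession in direction
`-u` to recession in direction `u`. -/
lemma IsSeparator.reverse {P : Fin 2 → ℝ} {t : ℝ} {k : ℤ} {φ : (Fin 2 → ℝ) → ℝ} (ht : 0 ≤ t)
    (hk : 0 ≤ k) (h : IsSeparator f P u t k φ) :
    IsSeparator f (P + t • latticeVec u) (-u) t k fun x => k * t - φ x where
  isTropRational := (IsTropRational.const _).sub h.isTropRational
  nonneg x := sub_nonneg.2 (h.le x)
  le x := by linarith [h.nonneg x]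
  line s := by
    have hk' : (0 : ℝ) ≤ k := by exact_mod_cast hk
    have hkt : (0 : ℝ) ≤ k * t := by positivity
    rw [latticeVec_neg, smul_neg, add_assoc, ← sub_eq_add_neg, ← sub_smul, h.line, mul_sub]
    rcases le_total (k * s : ℝ) 0 with h1 | h1
    · rw [min_eq_right (by linarith), max_eq_right hkt, min_eq_left (by linarith), max_eq_left h1,
        sub_self]
    rcases le_total (k * s : ℝ) (k * t) with h2 | h2
    · rw [min_eq_left (by linarith), max_eq_right (by linarith), min_eq_left h2, max_eq_right h1]
      ring
    · rw [min_eq_left (by linarith), max_eq_left (by linarith), min_eq_right h2, max_eq_right hkt]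
      ring
  eq_of_mem x hx h0 h1 := by
    obtain ⟨s, ⟨hs0, hs1⟩, he⟩ := h.eq_of_mem x hx (by linarith) (by linarith)
    refine ⟨t - s, ⟨by linarith, by linarith⟩, ?_⟩
    rw [he, latticeVec_neg, smul_neg, sub_smul]; abel

/-- On the curve off the closed segment `φ` takes only the values 0 and `k * t`, so by continuity it
is locally constant there. It bends by `k` and `-k` at the ends of the segment. -/
lemma IsSeparator.sub_mem (hf : f.IsUnimodular) {P : Fin 2 → ℝ} {t : ℝ} {k : ℤ}
    {φ : (Fin 2 → ℝ) → ℝ} (ht : 0 < t) (hk : 0 < k) (h : IsSeparator f P u t k φ) {β : ℝ}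
    (hβ : t < β) (hedge : ∀ τ, 0 ≤ τ → τ < β → f.OnEdge (P + τ • latticeVec u) u) :
    k • (pointDiv f P - pointDiv f (P + t • latticeVec u)) ∈ principalSubgroup hf := by
  have hk' : (0 : ℝ) < k := by exact_mod_cast hk
  have hkt : (0 : ℝ) < k * t := by positivity
  have hP : f.OnEdge P u := by simpa using hedge 0 le_rfl (by linarith)
  have key := sum_pointDiv_mem hf (hP.isEdgeDirection_iff.2 (Or.inl rfl)) hβ
    (fun τ h0 => hedge τ h0.le) h.isTropRational ![0, t] ![k, -k] ?_ ?_ ?_ ?_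
  · rw [Fin.sum_univ_two] at key
    simpa [smul_sub, sub_eq_add_neg] using key
  · intro i
    fin_cases i <;> simp [ht.le]
  · intro τ h0 h1
    rw [h.line, Fin.sum_univ_two]
    simp only [Matrix.cons_val_zero, Matrix.cons_val_one]
    push_cast
    rw [sub_zero, max_eq_right h0]
    have : (0 : ℝ) ≤ k * τ := by positivity
    rcases le_total τ t with h2 | h2
    · rw [min_eq_left (by gcongr), max_eq_right this, max_eq_left (by linarith)]
      ring
    · rw [min_eq_right (by gcongr), max_eq_right hkt.le, max_eq_right (by linarith)]
      ring
  · intro q hq hn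
    have hval : ∀ y ∈ f.variety, (∀ τ, 0 ≤ τ → τ ≤ t → y ≠ P + τ • latticeVec u) →
        φ y = 0 ∨ φ y = k * t := by
      intro y hy hn
      by_contra! hcon
      obtain ⟨s, ⟨hs0, hs1⟩, he⟩ := h.eq_of_mem y hy
        (lt_of_le_of_ne (h.nonneg y) hcon.1.symm) (lt_of_le_of_ne (h.le y) hcon.2)
      exact hn s hs0.le hs1.le he
    have hcont := h.isTropRational.continuous.tendsto q
    rcases hval q hq hn with h0 | h0
    · filter_upwards [eventually_not_mem_segment f.variety hn, self_mem_nhdsWithin,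
        nhdsWithin_le_nhds (hcont.eventually_lt_const (show φ q < k * t by rw [h0]; exact hkt))]
        with y hy hyV hlt
      rw [h0]
      exact (hval y hyV hy).resolve_right hlt.ne
    · filter_upwards [eventually_not_mem_segment f.variety hn, self_mem_nhdsWithin,
        nhdsWithin_le_nhds (hcont.eventually_const_lt (show 0 < φ q by rw [h0]; exact hkt))]
        with y hy hyV hlt
      rw [h0]
      exact (hval y hyV hy).resolve_left hlt.ne'
  · intro v hv hvu
    obtain rfl := (hP.isEdgeDirection_iff.1 hv).resolve_left hvu
    filter_upwards [self_mem_nhdsWithin] with τ hτ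
    have hτ : 0 < τ := hτ
    have h1 : φ P = 0 := by
      have := h.line 0
      rwa [zero_smul, add_zero, mul_zero, min_eq_left hkt.le, max_self] at this
    have h2 := h.line (-τ)
    rw [neg_smul, ← smul_neg, ← latticeVec_neg] at h2
    rw [h2, h1, max_eq_left]
    · simp
    · refine (min_le_left _ _).trans ?_
      have : (0 : ℝ) < k * τ := by positivity
      linarith

/-- Moving from an edge into the region of one of its two exponents, in a direction in which
this region is unbounded, one leaves the curve. -/
lemma not_mem_variety_of_recession {x : Fin 2 → ℝ} {a b n : Fin 2 → ℤ} {r : ℝ}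
    (hx : f.activeSet x = {a, b}) (hn : ∀ c ∈ f.support, 0 ≤ idot (a - c) n)
    (hab : 0 < idot (a - b) n) (hr : 0 < r) : x + r • latticeVec n ∉ f.variety := by
  have ha : a ∈ f.activeSet x := by rw [hx]; simp
  have hb : b ∈ f.activeSet x := by rw [hx]; simp
  have key : ∀ c ∈ f.activeSet (x + r • latticeVec n), c = a := by
    intro c hc
    have h1 := (mem_activeSet.1 hc).2 a ha.1
    rw [term_add, term_add, dot_smul, dot_smul, dot_latticeVec, dot_latticeVec] at h1
    have h2 : (0 : ℝ) ≤ idot a n - idot c n := by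
      have := hn c hc.1
      rw [sub_idot] at this
      exact_mod_cast this
    by_contra hne
    by_cases hcx : c ∈ f.activeSet x
    · have hcb : c = b := by
        rw [hx] at hcx
        exact (hcx : c = a ∨ c = b).resolve_left hne
      subst hcb
      rw [term_eq_of_active ha hcx] at h1
      have h3 : (0 : ℝ) < idot a n - idot c n := by
        rw [sub_idot] at hab
        exact_mod_cast hab
      nlinarith
    · have := term_lt_of_not_active ha hc.1 hcx
      nlinarith
  rw [mem_variety_iff, Set.not_nontrivial_iff]
  exact fun c hc d hd => (key c hc).trans (key d hd).symm

/-- Here both normals are transverse to the edge and point to opposite sides. The separator is a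
truncation of a function, linear on each side, whose level sets are broken lines: a ray in direction
`na` on the side of `a` and one in direction `nb` on the side of `b`. Such rays leave the curve at
once. -/
lemma exists_separator_chord {a b na nb : Fin 2 → ℤ} (hu : IsPrimitiveVec u)
    (hab : a - b = perp u) (hna : ∀ c ∈ f.support, 0 ≤ idot (a - c) na)
    (hnb : ∀ c ∈ f.support, 0 ≤ idot (b - c) nb)
    (hda : 0 < latticeDet u na) (hdb : latticeDet u nb < 0) :
    ∃ k : ℤ, 0 < k ∧ ∀ (P : Fin 2 → ℝ) (t : ℝ), 0 < t →
      (∀ s ∈ Set.Icc 0 t, f.activeSet (P + s • latticeVec u) = {a, b}) →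
      ∃ φ, IsSeparator f P u t k φ := by
  obtain ⟨w, hw⟩ := hu.exists_idot
  set α := latticeDet u na with hα
  set β := -latticeDet u nb with hβ
  have hβ0 : 0 < β := by omega
  have hk : 0 < α * β := by positivity
  refine ⟨α * β, hk, fun P t ht hact => ?_⟩
  -- The functionals kill `na` and `nb` respectively and are scaled to have the same pairing `α * β`
  -- with `u`. They then agree along the edge and differ by a multiple of `perp u`.
  set Wa : Fin 2 → ℤ := (-β) • perp na with hWa
  set Wb : Fin 2 → ℤ := α • perp nb with hWb
  have hWau : idot Wa u = α * β := by
    rw [hWa, zsmul_idot, idot_perp, hα]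
    simp only [latticeDet]; ring
  have hWbu : idot Wb u = α * β := by
    rw [hWb, zsmul_idot, idot_perp, hβ]
    simp only [latticeDet]; ring
  obtain ⟨j, hj⟩ := exists_eq_zsmul_perp hu
    (show idot (Wa - Wb) u = 0 by rw [sub_idot, hWau, hWbu, sub_self])
  have hk' : (0 : ℝ) < ((α * β : ℤ) : ℝ) := by exact_mod_cast hk
  have hkt : (0 : ℝ) < ((α * β : ℤ) : ℝ) * t := by positivity
  set h : (Fin 2 → ℝ) → ℝ := fun x => dot Wb (x - P) + (j : ℝ) * max 0 (dot (perp u) (x - P))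
    with hh
  have hWadot : ∀ y, dot Wa y = dot Wb y + j * dot (perp u) y := by
    intro y
    have : dot (Wa - Wb) y = j * dot (perp u) y := by
      rw [hj]; simp [dot]; ring
    rw [sub_dot] at this
    linarith
  have hht : IsTropRational h := (IsTropRational.dot_sub Wb P).add
    (((IsTropRational.const 0).max (IsTropRational.dot_sub (perp u) P)).zsmul j)
  refine ⟨fun x => max 0 (min (h x) (((α * β : ℤ) : ℝ) * t)),
    (IsTropRational.const 0).max (hht.min (IsTropRational.const _)), fun x => le_max_left _ _,
    fun x => max_le hkt.le (min_le_right _ _), fun s => ?_, fun x hx h0 h1 => ?_⟩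
  · have : h (P + s • latticeVec u) = ((α * β : ℤ) : ℝ) * s := by
      simp only [hh, add_sub_cancel_left, dot_smul, dot_latticeVec, hWbu, idot_perp_self]
      simp; ring
    rw [this]
  · have h0' : 0 < h x := by
      rcases lt_max_iff.1 h0 with h | h
      · exact absurd h (lt_irrefl 0)
      · exact (lt_min_iff.1 h).1
    have h1' : h x < ((α * β : ℤ) : ℝ) * t := by
      by_contra! hge
      simp only [min_eq_right hge, max_eq_right hkt.le] at h1
      exact lt_irrefl _ h1
    set s := h x / ((α * β : ℤ) : ℝ) with hs
    have hs0 : 0 < s := by positivity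
    have hs1 : s < t := by rw [hs, div_lt_iff₀ hk', mul_comm]; exact h1'
    have hsk : ((α * β : ℤ) : ℝ) * s = h x := by rw [hs]; field_simp
    set y := x - P - s • latticeVec u with hy
    have hxy : x = P + s • latticeVec u + y := by rw [hy]; abel
    have hz : dot (perp u) (x - P) = dot (perp u) y := by
      rw [hy, dot_sub _ (x - P), dot_smul, dot_latticeVec, idot_perp_self]; simp
    have hA := hact s ⟨hs0.le, hs1.le⟩
    have side : ∀ n : Fin 2 → ℤ, dot (perp n) y = 0 → latticeDet u n ≠ 0 →
        y = (dot (perp u) y / (latticeDet u n : ℝ)) • latticeVec n := by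
      intro n hn hd
      have hd' : (latticeDet u n : ℝ) ≠ 0 := by exact_mod_cast hd
      have e : (latticeDet u n : ℝ) • y = dot (perp u) y • latticeVec n := by
        simp only [dot, perp_zero, perp_one] at hn ⊢
        push_cast at hn ⊢
        funext i
        fin_cases i
        · simp [latticeDet]; linear_combination -u 0 * hn
        · simp [latticeDet]; linear_combination -u 1 * hn
      rw [div_eq_inv_mul, ← smul_smul, ← e, smul_smul, inv_mul_cancel₀ hd', one_smul]
    rcases lt_trichotomy (dot (perp u) y) 0 with hneg | hzero | hpos
    · exfalso
      have e : dot Wb y = 0 := by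
        have : h x = dot Wb (x - P) := by
          simp only [hh, hz]
          rw [max_eq_left hneg.le]; ring
        rw [hy, dot_sub _ (x - P), dot_smul, dot_latticeVec, hWbu, ← this, ← hsk]; ring
      have e' : dot (perp nb) y = 0 := by
        have : (α : ℝ) * dot (perp nb) y = 0 := by
          rw [← e, hWb]; simp [dot]; ring
        exact (mul_eq_zero.1 this).resolve_left (by exact_mod_cast hda.ne')
      have hyn := side nb e' hdb.ne
      refine not_mem_variety_of_recession (x := P + s • latticeVec u) (a := b) (b := a) (n := nb)
        (r := dot (perp u) y / (latticeDet u nb : ℝ)) (by rw [hA, Set.pair_comm]) hnb ?_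
        (div_pos_of_neg_of_neg hneg (by exact_mod_cast hdb)) ?_
      · have : b - a = -perp u := by rw [← hab]; abel
        rw [this, idot_comm, idot_neg, idot_comm, idot_perp]; omega
      · rw [← hyn, ← hxy]; exact hx
    · obtain ⟨c, hc⟩ := exists_eq_smul_perp hu.perp hzero
      have hyc : y = (-c) • latticeVec u := by
        rw [hc]
        have : perp (perp u) = -u := by funext i; fin_cases i <;> simp
        rw [this, latticeVec_neg]; simp
      have hx' : x = P + (s - c) • latticeVec u := by rw [hxy, hyc, sub_smul, neg_smul]; abel
      have e : h x = ((α * β : ℤ) : ℝ) * (s - c) := by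
        rw [hx']
        simp only [hh, add_sub_cancel_left, dot_smul, dot_latticeVec, hWbu, idot_perp_self]
        simp; ring
      have : c = 0 := by
        rw [← hsk] at e
        have := mul_left_cancel₀ hk'.ne' e
        linarith
      refine ⟨s, ⟨hs0, hs1⟩, ?_⟩
      rw [hx', this, sub_zero]
    · exfalso
      have e : dot Wa y = 0 := by
        have : h x = dot Wa (x - P) := by
          rw [hWadot]
          simp only [hh, hz]
          rw [max_eq_right hpos.le]
        rw [hy, dot_sub _ (x - P), dot_smul, dot_latticeVec, hWau, ← this, ← hsk]; ring
      have e' : dot (perp na) y = 0 := by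
        have : (-(β : ℝ)) * dot (perp na) y = 0 := by
          rw [← e, hWa]; simp [dot]; ring
        have hb' : (-(β : ℝ)) ≠ 0 := neg_ne_zero.2 (by exact_mod_cast hβ0.ne')
        exact (mul_eq_zero.1 this).resolve_left hb'
      have hyn := side na e' hda.ne'
      refine not_mem_variety_of_recession (x := P + s • latticeVec u) (a := a) (b := b) (n := na)
        (r := dot (perp u) y / (latticeDet u na : ℝ)) hA hna ?_
        (div_pos hpos (by exact_mod_cast hda)) ?_
      · rw [hab, idot_perp]; exact hda
      · rw [← hyn, ← hxy]; exact hx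

/-- When the recession direction is `u`, the edge continues as an unbounded ray. A narrow ridge over
the ray, growing from 0 and constant after length `t`, meets the curve only in the ray. -/
lemma exists_separator_ray {a b : Fin 2 → ℤ} (hu : IsPrimitiveVec u)
    (hab : a - b = perp u ∨ b - a = perp u) (hrec : ∀ c ∈ f.support, 0 ≤ idot (a - c) u)
    (P : Fin 2 → ℝ) (t : ℝ) (ht : 0 < t)
    (hact : ∀ s ∈ Set.Icc 0 t, f.activeSet (P + s • latticeVec u) = {a, b}) :
    ∃ φ, IsSeparator f P u t 1 φ := by
  -- The two exponents have equal pairing with `u`, so the recession hypothesis passes from one to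
  -- the other.
  wlog hab' : a - b = perp u generalizing a b
  · have h1 := hab.resolve_left hab'
    refine this (a := b) (b := a) (Or.inl h1) (fun c hc => ?_)
      (fun s hs => by rw [hact s hs, Set.pair_comm]) h1
    have : b - c = perp u + (a - c) := by rw [← h1]; abel
    rw [this, add_idot, idot_perp_self, zero_add]
    exact hrec c hc
  obtain ⟨w, hw⟩ := hu.exists_idot
  have hrecb : ∀ c ∈ f.support, 0 ≤ idot (b - c) u := by
    intro c hc
    have : a - c = perp u + (b - c) := by rw [← hab']; abel
    have h := hrec c hc
    rwa [this, add_idot, idot_perp_self, zero_add] at h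
  have hgap : ∀ s ∈ Set.Icc 0 t, ∀ e : Fin 2 → ℤ, (e = a ∨ e = b) → ∀ c ∈ f.support,
      c ≠ a → c ≠ b → f.term c (P + s • latticeVec u) < f.term e (P + s • latticeVec u) := by
    intro s hs e he c hc hca hcb
    refine term_lt_of_not_active ?_ hc ?_
    · rw [hact s hs]; exact he
    · rw [hact s hs]; rintro (h | h)
      · exact hca h
      · exact hcb h
  have h0t : (0 : ℝ) ∈ Set.Icc 0 t := ⟨le_rfl, ht.le⟩
  have htt : t ∈ Set.Icc 0 t := ⟨ht.le, le_rfl⟩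
  -- The ridge must be so steep that within its support no third exponent overtakes `a` or `b`. The
  -- gaps are affine in `s` and positive on the segment, so it suffices to choose `N` for both ends
  -- and interpolate.
  obtain ⟨N, hN0, hN⟩ : ∃ N : ℤ, 0 < N ∧ ∀ e : Fin 2 → ℤ, (e = a ∨ e = b) → ∀ c ∈ f.support,
      c ≠ a → c ≠ b → ∀ s ∈ Set.Icc 0 t, t * |(idot (e - c) (perp w) : ℝ)| <
        N * (f.term e (P + s • latticeVec u) - f.term c (P + s • latticeVec u)) := by
    have hev : ∀ s ∈ ({0, t} : Finset ℝ), ∀ e ∈ ({a, b} : Finset (Fin 2 → ℤ)), ∀ c ∈ f.support,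
        ∀ᶠ N : ℤ in atTop, c ≠ a → c ≠ b → t * |(idot (e - c) (perp w) : ℝ)| <
        N * (f.term e (P + s • latticeVec u) - f.term c (P + s • latticeVec u)) := by
      intro s hs e he c hc
      by_cases hca : c = a
      · exact Eventually.of_forall fun _ h => absurd hca h
      by_cases hcb : c = b
      · exact Eventually.of_forall fun _ _ h => absurd hcb h
      have hs' : s ∈ Set.Icc 0 t := by
        rcases (by simpa using hs : s = 0 ∨ s = t) with rfl | rfl
        · exact h0t
        · exact htt
      have hpos := sub_pos.2 (hgap s hs' e (by simpa using he) c hc hca hcb)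
      have : Tendsto (fun N : ℤ => (N : ℝ) *
          (f.term e (P + s • latticeVec u) - f.term c (P + s • latticeVec u))) atTop atTop :=
        tendsto_intCast_atTop_atTop.atTop_mul_const hpos
      filter_upwards [this.eventually_gt_atTop (t * |(idot (e - c) (perp w) : ℝ)|)] with N hN _ _
      exact hN
    have hev2 : ∀ᶠ N : ℤ in atTop, ∀ s ∈ ({0, t} : Finset ℝ), ∀ e ∈ ({a, b} : Finset (Fin 2 → ℤ)),
        ∀ c ∈ f.support, c ≠ a → c ≠ b → t * |(idot (e - c) (perp w) : ℝ)| <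
        N * (f.term e (P + s • latticeVec u) - f.term c (P + s • latticeVec u)) := by
      rw [Finset.eventually_all]
      intro s hs
      rw [Finset.eventually_all]
      intro e he
      rw [Finset.eventually_all]
      intro c hc
      exact hev s hs e he c hc
    obtain ⟨N, hN, hN0⟩ := (hev2.and (eventually_gt_atTop 0)).exists
    refine ⟨N, hN0, fun e he c hc hca hcb s hs => ?_⟩
    have h1 := hN 0 (by simp) e (by simpa using he) c hc hca hcb
    have h2 := hN t (by simp) e (by simpa using he) c hc hca hcb
    simp only [term_add, dot_smul, dot_latticeVec] at h1 h2 ⊢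
    have hs0 := hs.1
    have hs1 := hs.2
    set B := t * |(idot (e - c) (perp w) : ℝ)|
    set X := f.term e P - f.term c P
    set Y : ℝ := idot e u - idot c u
    have h1' : B < N * X := by convert h1 using 2; simp [X]
    have h2' : B < N * (X + t * Y) := by convert h2 using 2; simp only [X, Y]; ring
    have e1 : (N : ℝ) * (f.term e P + s * idot e u - (f.term c P + s * idot c u)) =
        N * (X + s * Y) := by simp only [X, Y]; ring
    rw [e1]
    have : t * B < t * (N * (X + s * Y)) := by
      have e2 : t * ((N : ℝ) * (X + s * Y)) = (t - s) * (N * X) + s * (N * (X + t * Y)) := by ring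
      rw [e2]
      rcases hs0.eq_or_lt with rfl | hs0
      · simpa using mul_lt_mul_of_pos_left h1' ht
      · have h3 := mul_lt_mul_of_pos_left h2' hs0
        have h4 := mul_le_mul_of_nonneg_left h1'.le (sub_nonneg.2 hs1)
        linarith
    exact lt_of_mul_lt_mul_left this ht.le
  have hN0' : (0 : ℝ) < N := by exact_mod_cast hN0
  have hline : ∀ y, dot (perp u) y = 0 → y = dot w y • latticeVec u := by
    intro y hy
    conv_lhs => rw [eq_smul_add_smul hw y]
    rw [hy, zero_smul, add_zero]
  refine ⟨fun x => max 0 (min (dot w (x - P)) t - (N : ℝ) * |dot (perp u) (x - P)|),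
    (IsTropRational.const 0).max (((IsTropRational.dot_sub w P).min (IsTropRational.const t)).sub
      ((IsTropRational.dot_sub (perp u) P).abs.zsmul N)), fun x => le_max_left _ _,
    fun x => max_le (by simpa using ht.le) ?_, fun s => ?_, fun x hx h0 h1 => ?_⟩
  · have h1 := min_le_right (dot w (x - P)) t
    have h2 : 0 ≤ (N : ℝ) * |dot (perp u) (x - P)| := by positivity
    push_cast
    linarith
  · simp only [add_sub_cancel_left, dot_smul, dot_latticeVec, hw, idot_perp_self]
    simp
  · set y := x - P with hy
    have hxy : x = P + y := by rw [hy]; abel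
    have h0' : 0 < min (dot w y) t - (N : ℝ) * |dot (perp u) y| :=
      (lt_max_iff.1 h0).resolve_left (lt_irrefl 0)
    -- Off the line of the edge one of `a`, `b` strictly beats the other, since their monomials
    -- differ by `z`, and by the choice of `N` it beats all others too. So `x` would not lie on the
    -- curve.
    have hz0 : dot (perp u) y = 0 := by
      by_contra hne
      set z := dot (perp u) y with hz
      set s := min (dot w y) t with hs
      have hzN : 0 ≤ (N : ℝ) * |z| := by positivity
      have hs0 : 0 < s := by linarith
      have hst : s ≤ t := min_le_right _ _
      have hsw : s ≤ dot w y := min_le_left _ _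
      have hdec : x = P + s • latticeVec u +
          ((dot w y - s) • latticeVec u + z • latticeVec (perp w)) := by
        rw [hxy]
        conv_lhs => rw [eq_smul_add_smul hw y]
        rw [sub_smul]; abel
      have hterm : ∀ c, f.term c x = f.term c (P + s • latticeVec u) + (dot w y - s) * idot c u +
          z * idot c (perp w) := by
        intro c
        rw [hdec, term_add, dot_add, dot_smul, dot_smul, dot_latticeVec, dot_latticeVec, ← add_assoc]
      have hsI : s ∈ Set.Icc 0 t := ⟨hs0.le, hst⟩
      have hbig : ∀ e : Fin 2 → ℤ, (e = a ∨ e = b) → (∀ c ∈ f.support, 0 ≤ idot (e - c) u) →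
          ∀ c ∈ f.support, c ≠ a → c ≠ b → f.term c x < f.term e x := by
        intro e he hre c hc hca hcb
        have g1 := hN e he c hc hca hcb s hsI
        have g2 : (0 : ℝ) ≤ idot e u - idot c u := by
          have := hre c hc
          rw [sub_idot] at this
          exact_mod_cast this
        have g3 : 0 ≤ (dot w y - s) * (idot e u - idot c u : ℝ) :=
          mul_nonneg (by linarith) g2
        have g4 : (N : ℝ) * (-(z * (idot (e - c) (perp w) : ℝ))) ≤
            t * |(idot (e - c) (perp w) : ℝ)| := by
          calc (N : ℝ) * (-(z * (idot (e - c) (perp w) : ℝ)))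
              ≤ N * |z * (idot (e - c) (perp w) : ℝ)| := by
                gcongr; exact neg_le_abs _
            _ = (N * |z|) * |(idot (e - c) (perp w) : ℝ)| := by rw [abs_mul]; ring
            _ ≤ _ := by
                gcongr; linarith
        have g5 : (N : ℝ) * (-(z * (idot (e - c) (perp w) : ℝ))) <
            N * (f.term e (P + s • latticeVec u) - f.term c (P + s • latticeVec u)) :=
          g4.trans_lt g1
        have g6 := lt_of_mul_lt_mul_left g5 hN0'.le
        rw [sub_idot] at g6
        push_cast at g6
        rw [hterm, hterm]
        linarith
      have haA : a ∈ f.activeSet (P + s • latticeVec u) := by rw [hact s hsI]; simp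
      have hbA : b ∈ f.activeSet (P + s • latticeVec u) := by rw [hact s hsI]; simp
      have hdiff : f.term a x - f.term b x = z := by
        rw [hterm, hterm, term_eq_of_active haA hbA]
        have e1 : (idot a u : ℝ) - idot b u = 0 := by
          have : idot (a - b) u = 0 := by rw [hab', idot_perp_self]
          rw [sub_idot] at this
          exact_mod_cast this
        have e2 : (idot a (perp w) : ℝ) - idot b (perp w) = 1 := by
          have : idot (a - b) (perp w) = 1 := by
            rw [hab', ← hw]; simp [idot]; ring
          rw [sub_idot] at this
          exact_mod_cast this
        linear_combination (dot w y - s) * e1 + z * e2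
      have huniq : ∀ e d : Fin 2 → ℤ, (e = a ∧ d = b ∨ e = b ∧ d = a) →
          (∀ c ∈ f.support, 0 ≤ idot (e - c) u) → e ∈ f.support → f.term d x < f.term e x →
          x ∉ f.variety := by
        intro e d hed hre hes hlt
        have he : e = a ∨ e = b := hed.imp And.left And.left
        have key : ∀ c ∈ f.activeSet x, c = e := by
          intro c hc
          have hle := (mem_activeSet.1 hc).2 e hes
          by_contra hce
          by_cases hcd : c = d
          · rw [hcd] at hle; linarith
          · refine absurd (hbig e he hre c hc.1 ?_ ?_) (not_lt.2 hle)
            · rcases hed with ⟨rfl, rfl⟩ | ⟨rfl, rfl⟩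
              · exact hce
              · exact hcd
            · rcases hed with ⟨rfl, rfl⟩ | ⟨rfl, rfl⟩
              · exact hcd
              · exact hce
        rw [mem_variety_iff, Set.not_nontrivial_iff]
        exact fun c hc d hd => (key c hc).trans (key d hd).symm
      rcases lt_or_gt_of_ne hne with hz' | hz'
      · exact huniq b a (Or.inr ⟨rfl, rfl⟩) hrecb hbA.1 (by linarith) hx
      · exact huniq a b (Or.inl ⟨rfl, rfl⟩) hrec haA.1 (by linarith) hx
    rw [hz0, abs_zero, mul_zero, sub_zero] at h0' h1
    have hw0 : 0 < dot w y := lt_of_lt_of_le h0' (min_le_left _ _)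
    refine ⟨dot w y, ⟨hw0, ?_⟩, ?_⟩
    · by_contra! hge
      rw [min_eq_right hge, max_eq_right ht.le] at h1
      simp at h1
    · rw [← hline y hz0, hxy]

/-- An edge between the regions of two exponents that both lie on the boundary of the Newton
polygon separates the curve. -/
lemma exists_separator {a b na nb : Fin 2 → ℤ} (hu : IsPrimitiveVec u)
    (hab : a - b = perp u) (ha : a ∈ f.support) (hb : b ∈ f.support) (hna0 : na ≠ 0) (hnb0 : nb ≠ 0)
    (hna : ∀ c ∈ f.support, 0 ≤ idot (a - c) na) (hnb : ∀ c ∈ f.support, 0 ≤ idot (b - c) nb) :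
    ∃ k : ℤ, 0 < k ∧ ∀ (P : Fin 2 → ℝ) (t : ℝ), 0 < t →
      (∀ s ∈ Set.Icc 0 t, f.activeSet (P + s • latticeVec u) = {a, b}) →
      ∃ φ, IsSeparator f P u t k φ := by
  have hda : 0 ≤ latticeDet u na := by
    have := hna b hb
    rwa [hab, idot_perp] at this
  have hdb : latticeDet u nb ≤ 0 := by
    have := hnb a ha
    have e : b - a = -perp u := by rw [← hab]; abel
    rw [e, idot_comm, idot_neg, idot_comm, idot_perp] at this
    omega
  -- A vanishing determinant makes the normal a nonzero multiple of `u`; for a negative multiple the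
  -- segment is run backwards and the separator reversed.
  have ray : ∀ a b n : Fin 2 → ℤ, (a - b = perp u ∨ b - a = perp u) → n ≠ 0 →
      (∀ c ∈ f.support, 0 ≤ idot (a - c) n) → latticeDet u n = 0 →
      ∃ k : ℤ, 0 < k ∧ ∀ (P : Fin 2 → ℝ) (t : ℝ), 0 < t →
        (∀ s ∈ Set.Icc 0 t, f.activeSet (P + s • latticeVec u) = {a, b}) →
        ∃ φ, IsSeparator f P u t k φ := by
    intro a b n hab hn hrec hd
    refine ⟨1, one_pos, fun P t ht hact => ?_⟩
    obtain ⟨k, rfl⟩ := exists_eq_zsmul hu hd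
    have hrec' : ∀ c ∈ f.support, 0 ≤ k * idot (a - c) u := fun c hc => by
      have := hrec c hc
      rwa [idot_comm, zsmul_idot, idot_comm] at this
    rcases lt_trichotomy k 0 with hk | rfl | hk
    · have hneg : perp (-u) = -perp u := by funext i; fin_cases i <;> simp
      obtain ⟨φ, hφ⟩ := exists_separator_ray (f := f) (u := -u) (a := a) (b := b) hu.neg
        (by
          rw [hneg]
          rcases hab with h | h
          · right; rw [← h]; abel
          · left; rw [← h]; abel)
        (fun c hc => by
          rw [idot_neg]
          have := hrec' c hc
          by_contra! hlt
          nlinarith)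
        (P + t • latticeVec u) t ht (fun s hs => by
          have e : P + t • latticeVec u + s • latticeVec (-u) = P + (t - s) • latticeVec u := by
            rw [latticeVec_neg, smul_neg, sub_smul]; abel
          rw [e]
          exact hact _ ⟨by linarith [hs.2], by linarith [hs.1]⟩)
      have hr := hφ.reverse ht.le zero_le_one
      have e : P + t • latticeVec u + t • latticeVec (-u) = P := by
        rw [latticeVec_neg, smul_neg]; abel
      rw [e, neg_neg] at hr
      exact ⟨_, hr⟩
    · simp at hn
    · exact exists_separator_ray hu hab (fun c hc => nonneg_of_mul_nonneg_right (hrec' c hc) hk)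
        P t ht hact
  rcases hda.eq_or_lt with h | h
  · exact ray a b na (Or.inl hab) hna0 hna h.symm
  rcases hdb.eq_or_lt with h' | h'
  · obtain ⟨k, hk, hsep⟩ := ray b a nb (Or.inr hab) hnb0 hnb h'
    exact ⟨k, hk, fun P t ht hact => hsep P t ht fun s hs => by rw [hact s hs, Set.pair_comm]⟩
  exact exists_separator_chord hu hab hna hnb h h'

end TropPoly

/-! ### Integral outer normals of the Newton polygon -/

lemma one_le_norm_latticeVec {u : Fin 2 → ℤ} (hu : u ≠ 0) : 1 ≤ ‖latticeVec u‖ := by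
  obtain ⟨i, hi⟩ := Function.ne_iff.1 hu
  refine le_trans ?_ (norm_le_pi_norm (latticeVec u) i)
  rw [latticeVec_apply, Real.norm_eq_abs]
  exact_mod_cast Int.one_le_abs hi

/-- A rational polyhedral cone in the plane with a nonzero point has a nonzero integer point. -/
lemma exists_int_of_dot_nonneg (A : Finset (Fin 2 → ℤ)) {ν : Fin 2 → ℝ} (hν : ν ≠ 0)
    (h : ∀ d ∈ A, 0 ≤ dot d ν) : ∃ n : Fin 2 → ℤ, n ≠ 0 ∧ ∀ d ∈ A, 0 ≤ idot d n := by
  by_cases hA : ∀ d ∈ A, d = 0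
  · exact ⟨![1, 0], fun h0 => by simpa using congrFun h0 0, fun d hd => by simp [hA d hd, idot]⟩
  push Not at hA
  -- A tight nonzero constraint already puts `ν` on a rational line, so one of the two primitive
  -- vectors of that line works.
  by_cases htight : ∃ d ∈ A, d ≠ 0 ∧ dot d ν = 0
  · obtain ⟨d, hd, hd0, hdν⟩ := htight
    obtain ⟨k, m, hk, hm, rfl⟩ := exists_primitive hd0
    have hmν : dot m ν = 0 := by
      have : (k : ℝ) * dot m ν = 0 := by rw [← hdν]; simp [dot]; ring
      exact (mul_eq_zero.1 this).resolve_left (by exact_mod_cast hk.ne')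
    obtain ⟨c, hc⟩ := exists_eq_smul_perp hm hmν
    have hval : ∀ d ∈ A, 0 ≤ c * idot d (perp m) := by
      intro d hd
      have := h d hd
      rwa [hc, dot_smul, dot_latticeVec] at this
    rcases lt_trichotomy c 0 with h0 | h0 | h0
    · refine ⟨-perp m, hm.perp.neg.ne_zero, fun d hd => ?_⟩
      rw [idot_neg]
      have := hval d hd
      by_contra! hlt
      have : (0 : ℝ) < idot d (perp m) := by exact_mod_cast (by omega : 0 < idot d (perp m))
      nlinarith
    · exact absurd (by rw [hc, h0, zero_smul]) hν
    · refine ⟨perp m, hm.perp.ne_zero, fun d hd => ?_⟩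
      exact_mod_cast nonneg_of_mul_nonneg_right (hval d hd) h0
  · push Not at htight
    have hpos : ∀ d ∈ A, d ≠ 0 → 0 < dot d ν := fun d hd h0 =>
      lt_of_le_of_ne (h d hd) (htight d hd h0).symm
    have hev : ∀ᶠ M : ℝ in atTop, ∀ d ∈ A, d ≠ 0 → |(d 0 : ℝ)| + |(d 1 : ℝ)| < M * dot d ν := by
      rw [Finset.eventually_all]
      intro d hd
      by_cases h0 : d = 0
      · exact Eventually.of_forall fun _ h => absurd h0 h
      filter_upwards [(tendsto_id.atTop_mul_const (hpos d hd h0)).eventually_gt_atTop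
        (|(d 0 : ℝ)| + |(d 1 : ℝ)|)] with M hM _
      exact hM
    obtain ⟨M, hM⟩ := hev.exists
    -- With no nonzero constraint tight, rounding a large multiple of `ν` keeps the inequalities:
    -- the error in pairing with `d` is at most `|d 0| + |d 1|`.
    set n : Fin 2 → ℤ := fun i => ⌊M * ν i⌋ with hn
    have hlt : ∀ d ∈ A, d ≠ 0 → 0 < idot d n := by
      intro d hd h0
      have key : ∀ i, -|(d i : ℝ)| ≤ d i * n i - d i * (M * ν i) := by
        intro i
        have h1 : |(n i : ℝ) - M * ν i| ≤ 1 := by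
          rw [abs_le]
          exact ⟨by linarith [Int.lt_floor_add_one (M * ν i)], by linarith [Int.floor_le (M * ν i)]⟩
        rw [← mul_sub]
        have h2 : |(d i : ℝ) * ((n i : ℝ) - M * ν i)| ≤ |(d i : ℝ)| := by
          rw [abs_mul]
          exact mul_le_of_le_one_right (abs_nonneg _) h1
        exact (abs_le.1 h2).1
      have h1 := hM d hd h0
      have : (0 : ℝ) < idot d n := by
        simp only [idot, dot] at h1 ⊢
        push_cast
        have := key 0
        have := key 1
        linarith
      exact_mod_cast this
    obtain ⟨d0, hd0, hd0'⟩ := hA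
    refine ⟨n, fun h0 => ?_, fun d hd => ?_⟩
    · have := hlt d0 hd0 hd0'
      rw [h0] at this
      simp [idot] at this
    · by_cases h0 : d = 0
      · simp [h0, idot]
      · exact (hlt d hd h0).le

namespace TropPoly

variable {f : TropPoly 2} {u o : Fin 2 → ℤ}

/-- An exponent on the boundary of the Newton polygon has an integral outer normal. -/
lemma exists_outer_normal (hint : (interior f.newtonPolytope).Nonempty) {a : Fin 2 → ℤ}
    (hna : latticeVec a ∉ interior f.newtonPolytope) :
    ∃ n : Fin 2 → ℤ, n ≠ 0 ∧ ∀ c ∈ f.support, 0 ≤ idot (a - c) n := by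
  have hconv : Convex ℝ f.newtonPolytope := convex_convexHull _ _
  obtain ⟨l, hl⟩ := geometric_hahn_banach_open_point hconv.interior isOpen_interior hna
  set ν : Fin 2 → ℝ := fun i => l (Pi.single i 1) with hν
  have hlx : ∀ x : Fin 2 → ℝ, l x = ν 0 * x 0 + ν 1 * x 1 := by
    intro x
    have e : x = x 0 • (Pi.single 0 1 : Fin 2 → ℝ) + x 1 • (Pi.single 1 1 : Fin 2 → ℝ) := by
      funext i; fin_cases i <;> simp
    conv_lhs => rw [e]
    rw [map_add, map_smul, map_smul, smul_eq_mul, smul_eq_mul, hν]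
    ring
  have hle : ∀ x ∈ f.newtonPolytope, l x ≤ l (latticeVec a) := by
    intro x hx
    have hx' : x ∈ closure (interior f.newtonPolytope) := by
      rw [hconv.closure_interior_eq_closure_of_nonempty_interior hint]
      exact subset_closure hx
    exact closure_minimal (fun y hy => (hl y hy).le)
      (isClosed_le l.continuous continuous_const) hx'
  have hν0 : ν ≠ 0 := by
    intro h0
    obtain ⟨x, hx⟩ := hint
    have := hl x hx
    rw [hlx, hlx, h0] at this
    simp at this
  obtain ⟨n, hn0, hn⟩ := exists_int_of_dot_nonneg (f.support.image fun c => a - c) hν0 (by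
    intro d hd
    obtain ⟨c, hc, rfl⟩ := Finset.mem_image.1 hd
    have := hle _ (subset_convexHull ℝ _ (Set.mem_image_of_mem latticeVec (Finset.mem_coe.2 hc)))
    rw [hlx, hlx] at this
    rw [sub_dot]
    simp only [dot, latticeVec_apply] at this ⊢
    linarith)
  exact ⟨n, hn0, fun c hc => hn _ (Finset.mem_image_of_mem _ hc)⟩

/-- Every exponent other than `o` has an integral outer normal. -/
def HasOuterNormals (f : TropPoly 2) (o : Fin 2 → ℤ) : Prop :=
  ∀ a ∈ f.support, a ≠ o → ∃ n : Fin 2 → ℤ, n ≠ 0 ∧ ∀ c ∈ f.support, 0 ≤ idot (a - c) n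

/-- Weight one leaves exactly two active exponents, differing by `perp u`; both differ from `o`, so
both have outer normals. -/
lemma OnEdge.exists_separator (hf : f.IsUnimodular) (ho : f.HasOuterNormals o) {q : Fin 2 → ℝ}
    (hq : f.OnEdge q u) (hoq : o ∉ f.activeSet q) :
    ∃ k : ℤ, 0 < k ∧ ∀ (P : Fin 2 → ℝ) (t : ℝ), 0 < t →
      (∀ s ∈ Set.Icc 0 t, f.activeSet (P + s • latticeVec u) = f.activeSet q) →
      ∃ φ, IsSeparator f P u t k φ := by
  obtain ⟨b, w, -, hw, hb, ha, hall⟩ := hq.exists_weight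
  rw [hf.weight_eq_one q hq.mem_variety hq.not_isVertex] at hw
  subst hw
  set a := b + ((1 : ℕ) : ℤ) • perp u with ha'
  have hset : f.activeSet q = {a, b} := by
    ext c
    simp only [Set.mem_insert_iff, Set.mem_singleton_iff]
    constructor
    · intro hc
      obtain ⟨i, h0, h1, rfl⟩ := hall c hc
      have : i = 0 ∨ i = 1 := by omega
      rcases this with rfl | rfl
      · right; simp
      · left; rfl
    · rintro (rfl | rfl)
      · exact ha
      · exact hb
  obtain ⟨na, hna0, hna⟩ := ho a ha.1 fun h => hoq (h ▸ ha)
  obtain ⟨nb, hnb0, hnb⟩ := ho b hb.1 fun h => hoq (h ▸ hb)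
  rw [hset]
  exact TropPoly.exists_separator hq.1 (by rw [ha']; simp) ha.1 hb.1 hna0 hnb0 hna hnb

/-! ### Local equivalence off the region of the exponent `o` -/

/-- The separator gives only a multiple of a difference of points; the second-order relations among
equally spaced points turn that multiple into the full difference. -/
lemma exists_sub_mem_of_isEdgeDirection (hf : f.IsUnimodular) (ho : f.HasOuterNormals o)
    {x₀ : Fin 2 → ℝ} (hx : x₀ ∈ f.variety) (hox : o ∉ f.activeSet x₀)
    (hu : f.IsEdgeDirection x₀ u) : ∃ ε > 0, ∀ τ : ℝ, 0 < τ → τ < ε →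
      pointDiv f x₀ - pointDiv f (x₀ + τ • latticeVec u) ∈ principalSubgroup hf := by
  obtain ⟨ε₁, hε₁, -, hface⟩ := f.exists_ball_conic x₀
  obtain ⟨ε₂, hε₂, hbump⟩ := exists_bump hf hx hu
  set L := ‖latticeVec u‖ with hL
  have hL1 : 1 ≤ L := one_le_norm_latticeVec hu.1.ne_zero
  set ε := min (ε₁ / L) ε₂ with hε
  have hε0 : 0 < ε := lt_min (by positivity) hε₂
  have hact : ∀ τ, 0 < τ → τ < ε → f.activeSet (x₀ + τ • latticeVec u) = f.face x₀ u := by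
    intro τ h0 h1
    refine hface u τ h0 ?_
    rw [norm_smul, Real.norm_eq_abs, abs_of_pos h0, ← hL, ← lt_div_iff₀ (by positivity)]
    exact h1.trans_le (min_le_left _ _)
  have hedge : ∀ τ, 0 < τ → τ < ε → f.OnEdge (x₀ + τ • latticeVec u) u := fun τ h0 h1 =>
    onEdge_of_activeSet_eq_face hu (hact τ h0 h1)
  obtain ⟨k, hk, hsep⟩ := (hedge (ε / 2) (by linarith) (by linarith)).exists_separator hf ho
    (fun h => by
      rw [hact _ (by linarith) (by linarith)] at h
      exact hox h.1)
  rw [hact _ (by linarith) (by linarith)] at hsep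
  have hk1 : (1 : ℝ) ≤ k := by exact_mod_cast hk
  obtain ⟨K, rfl⟩ := Int.eq_ofNat_of_zero_le hk.le
  push_cast at hk1
  refine ⟨ε / 2, by linarith, fun τ h0 h1 => ?_⟩
  -- As many equal steps as the slope of the separator, so that the total difference is `K` times
  -- one step modulo principal divisors. Since `s ≤ τ < ε / 2`, the point at distance `2 * s` is
  -- still on the edge.
  set s := τ / K with hs
  have hs0 : 0 < s := by positivity
  have hsK : K * s = τ := by rw [hs]; field_simp
  have hsτ : s ≤ τ := div_le_self h0.le hk1
  set S := principalSubgroup hf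
  set y : ℕ → Divisor f := fun j => pointDiv f (x₀ + (j * s : ℝ) • latticeVec u) with hy
  have hsecond : ∀ j : ℕ, (j + 2 : ℝ) * s < ε → y j - (2 : ℤ) • y (j + 1) + y (j + 2) ∈ S := by
    intro j hj
    have hjs : 0 ≤ (j : ℝ) * s := by positivity
    have := hbump ((j + 1 : ℝ) * s) s hs0 (by linarith) (by
      have := min_le_right (ε₁ / L) ε₂
      linarith)
    have e1 : (j + 1 : ℝ) * s - s = j * s := by ring
    have e2 : (j + 1 : ℝ) * s + s = (j + 2) * s := by ring
    rw [e1, e2] at this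
    simpa only [hy, Nat.cast_add, Nat.cast_one, Nat.cast_ofNat] using this
  have hfirst : ∀ j : ℕ, (j + 1 : ℝ) * s < ε → y (j + 1) - y j - (y 1 - y 0) ∈ S := by
    intro j
    induction j with
    | zero => intro _; simp [S.zero_mem]
    | succ j ih =>
      intro hj
      push_cast at hj
      have h1 := ih (by linarith)
      have h2 := hsecond j (by linarith)
      have : y (j + 1 + 1) - y (j + 1) - (y 1 - y 0) =
          (y (j + 1) - y j - (y 1 - y 0)) + (y j - (2 : ℤ) • y (j + 1) + y (j + 2)) := by
        rw [two_smul]; abel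
      rw [this]
      exact S.add_mem h1 h2
  have htotal : ∀ j : ℕ, (j : ℝ) * s < ε → y j - y 0 - j • (y 1 - y 0) ∈ S := by
    intro j
    induction j with
    | zero => intro _; simp [S.zero_mem]
    | succ j ih =>
      intro hj
      push_cast at hj
      have h1 := ih (by linarith)
      have h2 := hfirst j hj
      have : y (j + 1) - y 0 - (j + 1) • (y 1 - y 0) =
          (y j - y 0 - j • (y 1 - y 0)) + (y (j + 1) - y j - (y 1 - y 0)) := by
        rw [add_smul, one_smul]; abel
      rw [this]
      exact S.add_mem h1 h2
  -- The separator is applied on the second step, because `x₀` may be a vertex; the second-order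
  -- relation carries the result back to the first step.
  have hslope : K • (y 1 - y 0) ∈ S := by
    obtain ⟨φ, hφ⟩ := hsep (x₀ + s • latticeVec u) s hs0 (fun r hr => by
      rw [add_assoc, ← add_smul]
      exact hact _ (by linarith [hr.1]) (by linarith [hr.2]))
    have h2 := hφ.sub_mem hf hs0 hk (β := ε - s) (by linarith) (fun r hr0 hr1 => by
      rw [add_assoc, ← add_smul]
      exact hedge _ (by linarith) (by linarith))
    rw [add_assoc, ← add_smul, ← two_mul] at h2
    have h2' : K • (y 1 - y 2) ∈ S := by
      simpa only [hy, Nat.cast_one, one_mul, Nat.cast_ofNat, natCast_zsmul] using h2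
    have h3 := hfirst 1 (by push_cast; linarith)
    have : K • (y 1 - y 0) = -(K • (y (1 + 1) - y 1 - (y 1 - y 0))) - K • (y 1 - y 2) := by
      rw [← smul_neg, ← smul_sub]
      congr 1
      abel
    rw [this]
    exact S.sub_mem (S.neg_mem (S.nsmul_mem h3 K)) h2'
  have hfin := S.add_mem (htotal K (by rw [hsK]; linarith)) hslope
  have e : pointDiv f x₀ - pointDiv f (x₀ + τ • latticeVec u) = -(y K - y 0) := by
    simp only [hy, hsK, Nat.cast_zero, zero_mul, zero_smul, add_zero]; abel
  rw [e]
  refine S.neg_mem ?_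
  simpa using hfin

/-- Points of the curve near a point outside the region of `o` are equivalent to it. -/
lemma eventually_sub_mem (hf : f.IsUnimodular) (ho : f.HasOuterNormals o)
    {x₀ : Fin 2 → ℝ} (hx : x₀ ∈ f.variety) (hox : o ∉ f.activeSet x₀) :
    ∀ᶠ x in 𝓝[f.variety] x₀, pointDiv f x₀ - pointDiv f x ∈ principalSubgroup hf := by
  obtain ⟨ε₁, hε₁, hcon, -⟩ := f.exists_ball_conic x₀
  have hev : ∀ᶠ ε in 𝓝[>] (0 : ℝ), ∀ u ∈ f.star x₀, ∀ τ : ℝ, 0 < τ → τ < ε →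
      pointDiv f x₀ - pointDiv f (x₀ + τ • latticeVec u) ∈ principalSubgroup hf := by
    rw [Finset.eventually_all]
    intro u hu
    obtain ⟨ε, hε, h⟩ := exists_sub_mem_of_isEdgeDirection hf ho hx hox ((hf.mem_star hx).1 hu)
    filter_upwards [Ioo_mem_nhdsGT hε] with ε' hε' τ h0 h1
    exact h τ h0 (h1.trans hε'.2)
  obtain ⟨ε, hε, hε0⟩ := (hev.and self_mem_nhdsWithin).exists
  have hε0 : 0 < ε := hε0
  filter_upwards [nhdsWithin_le_nhds (Metric.ball_mem_nhds x₀ (lt_min hε₁ hε0)),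
    self_mem_nhdsWithin] with x hxb hxV
  rw [Metric.mem_ball, dist_eq_norm] at hxb
  by_cases h0 : x - x₀ = 0
  · rw [sub_eq_zero] at h0
    rw [h0, sub_self]
    exact AddSubgroup.zero_mem _
  obtain ⟨u, hu, τ, hτ, he⟩ := hcon (x - x₀) (hxb.trans_le (min_le_left _ _)) h0
    (by rwa [add_sub_cancel])
  have hx' : x = x₀ + τ • latticeVec u := by rw [← he]; abel
  rw [hx']
  refine hε u ((hf.mem_star hx).2 hu) τ hτ ?_
  have h1 := hxb.trans_le (min_le_right ε₁ ε)
  rw [he, norm_smul, Real.norm_eq_abs, abs_of_pos hτ] at h1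
  nlinarith [one_le_norm_latticeVec hu.1.ne_zero]

end TropPoly

/-! ### Circles in the plane -/

/-- A periodic parametrisation based at `P` lets the intermediate value theorem on the real line be
used on the cycle. -/
lemma exists_circle_param {Z : Set (Fin 2 → ℝ)} (hZ : Nonempty (Z ≃ₜ Circle)) {P : Fin 2 → ℝ}
    (hP : P ∈ Z) : ∃ γ : ℝ → (Fin 2 → ℝ), Continuous γ ∧ (∀ θ, γ θ ∈ Z) ∧ γ 0 = P ∧
      ∀ θ θ', γ θ = γ θ' ↔ ∃ m : ℤ, θ = θ' + m * (2 * Real.pi) := by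
  obtain ⟨e⟩ := hZ
  refine ⟨fun θ => (e.symm (e ⟨P, hP⟩ * Circle.exp θ) : Fin 2 → ℝ), ?_, fun θ => Subtype.coe_prop _,
    by simp, fun θ θ' => ?_⟩
  · exact continuous_subtype_val.comp (e.symm.continuous.comp
      (continuous_const.mul Circle.exp.continuous))
  · rw [Subtype.coe_inj, e.symm.injective.eq_iff, mul_right_inj, Circle.exp_eq_exp]

lemma nonempty_of_circle {Z : Set (Fin 2 → ℝ)} (hZ : Nonempty (Z ≃ₜ Circle)) : Z.Nonempty := by
  obtain ⟨e⟩ := hZ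
  exact ⟨_, (e.symm 1).2⟩

/-- A circle does not embed in the line. -/
lemma not_injOn_of_circle {Z : Set (Fin 2 → ℝ)} (hZ : Nonempty (Z ≃ₜ Circle))
    {a : (Fin 2 → ℝ) → ℝ} (ha : ContinuousOn a Z) : ¬ Set.InjOn a Z := by
  intro hinj
  obtain ⟨P, hP⟩ := nonempty_of_circle hZ
  obtain ⟨γ, hγ, hmem, -, hiff⟩ := exists_circle_param hZ hP
  have hcont : Continuous fun θ => a (γ θ) := ha.comp_continuous hγ hmem
  have hF : Continuous fun θ => a (γ θ) - a (γ (θ + Real.pi)) :=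
    hcont.sub (hcont.comp (continuous_add_const Real.pi))
  have hper : γ (Real.pi + Real.pi) = γ 0 := (hiff _ _).2 ⟨1, by push_cast; ring⟩
  -- The difference of values at opposite points changes sign under a half turn, so it vanishes
  -- somewhere; injectivity would then make π a multiple of 2π.
  have hzero : ∃ θ, a (γ θ) - a (γ (θ + Real.pi)) = 0 := by
    have e0 : a (γ 0) - a (γ (0 + Real.pi)) = -(a (γ Real.pi) - a (γ (Real.pi + Real.pi))) := by
      rw [hper, zero_add]; ring
    rcases le_total 0 (a (γ 0) - a (γ (0 + Real.pi))) with h | h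
    · exact mem_range_of_exists_le_of_exists_ge hF ⟨Real.pi, by linarith⟩ ⟨0, h⟩
    · exact mem_range_of_exists_le_of_exists_ge hF ⟨0, h⟩ ⟨Real.pi, by linarith⟩
  obtain ⟨θ, hθ⟩ := hzero
  obtain ⟨m, hm⟩ := (hiff _ _).1 (hinj (hmem _) (hmem _) (sub_eq_zero.1 hθ))
  have hpi := Real.pi_pos
  have h1 : (2 * (m : ℝ) + 1) * Real.pi = 0 := by linarith
  have h2 : (2 * (m : ℝ) + 1) = 0 := (mul_eq_zero.1 h1).resolve_right hpi.ne'
  have h3 : 2 * m + 1 = 0 := by exact_mod_cast h2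
  omega

lemma eq_of_eq_add_two_pi {θ θ' : ℝ} {m : ℤ} (h : θ = θ' + m * (2 * Real.pi))
    (hlt : |θ - θ'| < 2 * Real.pi) : θ = θ' := by
  have hpi := Real.pi_pos
  have h1 : θ - θ' = m * (2 * Real.pi) := by linarith
  rw [h1, abs_mul, abs_of_pos (by linarith : (0 : ℝ) < 2 * Real.pi)] at hlt
  have h2 : |(m : ℝ)| < 1 := by
    by_contra! hge
    nlinarith
  have h3 : m = 0 := Int.abs_lt_one_iff.1 (by exact_mod_cast h2)
  rw [h3] at h
  simpa using h

/-- A continuous function on a circle that attains a value exactly once is not locally injective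
there. -/
lemma not_locally_injective_of_circle {γ : ℝ → (Fin 2 → ℝ)} (hγ : Continuous γ)
    (hiff : ∀ θ θ', γ θ = γ θ' ↔ ∃ m : ℤ, θ = θ' + m * (2 * Real.pi))
    {φ : (Fin 2 → ℝ) → ℝ} (hφ : Continuous φ) (honce : ∀ θ, φ (γ θ) = φ (γ 0) → γ θ = γ 0)
    {η : ℝ} (hη0 : 0 < η) (hη : η < Real.pi)
    (hinj : Set.InjOn (fun θ => φ (γ θ)) (Set.Icc (-η) η)) : False := by
  have hpi := Real.pi_pos
  have hne : ∀ θ, 0 < θ → θ < 2 * Real.pi → φ (γ θ) ≠ φ (γ 0) := by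
    intro θ h0 h1 h
    obtain ⟨m, hm⟩ := (hiff _ _).1 (honce θ h)
    have := eq_of_eq_add_two_pi hm (by rw [sub_zero, abs_of_pos h0]; exact h1)
    linarith
  have hper : γ (-η) = γ (2 * Real.pi - η) := (hiff _ _).2 ⟨-1, by push_cast; ring⟩
  -- As the value at 0 is not taken again in a full turn, `ψ` stays on one side of it. Values
  -- slightly above it are then taken on both sides of 0, against local injectivity.
  have main : ∀ ψ : ℝ → ℝ, Continuous ψ → (∀ θ, 0 < θ → θ < 2 * Real.pi → ψ θ ≠ ψ 0) →
      ψ (-η) = ψ (2 * Real.pi - η) → Set.InjOn ψ (Set.Icc (-η) η) → ψ 0 < ψ η → False := by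
    intro ψ hψ hne hper hinj hlt
    have hlt' : ψ 0 < ψ (-η) := by
      by_contra! hle
      rw [hper] at hle
      obtain ⟨θ, hθ, he⟩ := intermediate_value_Icc' (by linarith : η ≤ 2 * Real.pi - η)
        hψ.continuousOn ⟨hle, hlt.le⟩
      exact hne θ (by linarith [hθ.1]) (by linarith [hθ.2]) he
    have hmin : ψ 0 < min (ψ η) (ψ (-η)) := lt_min hlt hlt'
    obtain ⟨θ₁, h1, e1⟩ := intermediate_value_Icc hη0.le hψ.continuousOn
      ⟨hmin.le, min_le_left _ _⟩
    obtain ⟨θ₂, h2, e2⟩ := intermediate_value_Icc' (by linarith : -η ≤ 0) hψ.continuousOn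
      ⟨hmin.le, min_le_right _ _⟩
    have := hinj ⟨by linarith [h1.1], h1.2⟩ ⟨h2.1, by linarith [h2.2]⟩ (e1.trans e2.symm)
    have h0 : θ₁ = 0 := le_antisymm (this ▸ h2.2) h1.1
    rw [h0] at e1
    linarith
  have hψ : Continuous fun θ => φ (γ θ) := hφ.comp hγ
  rcases lt_trichotomy (φ (γ 0)) (φ (γ η)) with h | h | h
  · exact main _ hψ hne (by simp only [hper]) hinj h
  · exact hne η hη0 (by linarith) h.symm
  · exact main (fun θ => -φ (γ θ)) hψ.neg (fun θ h0 h1 h => hne θ h0 h1 (neg_injective h))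
      (by simp only [hper]) (fun x hx y hy h => hinj hx hy (neg_injective h)) (neg_lt_neg h)

lemma interior_nonempty_of_not_collinear {R : Set (Fin 2 → ℝ)} (hR : Convex ℝ R)
    (h : ¬ Collinear ℝ R) : (interior R).Nonempty := by
  rw [hR.interior_nonempty_iff_affineSpan_eq_top]
  have hne : R.Nonempty := by
    by_contra! hemp
    exact h (hemp ▸ collinear_empty ℝ _)
  have hv : vectorSpan ℝ R = ⊤ := by
    apply Submodule.eq_top_of_finrank_eq
    rw [collinear_iff_finrank_le_one] at h
    have h1 := Submodule.finrank_le (vectorSpan ℝ R)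
    have h2 : Module.finrank ℝ (Fin 2 → ℝ) = 2 := by simp
    omega
  rwa [AffineSubspace.affineSpan_eq_top_iff_vectorSpan_eq_top_of_nonempty ℝ _ _ hne]

/-! ### The cycle as the boundary of the region of `o` -/

namespace TropPoly

variable {f : TropPoly 2} {u o : Fin 2 → ℤ} {Z : Set (Fin 2 → ℝ)}

/-- A cycle does not meet the edges outside the region of `o`. -/
lemma not_mem_cycle_of_onEdge (hf : f.IsUnimodular) (ho : f.HasOuterNormals o)
    (hZ : IsCycleIn f.variety Z) {M : Fin 2 → ℝ} (hM : f.OnEdge M u) (hoM : o ∉ f.activeSet M) :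
    M ∉ Z := by
  intro hMZ
  obtain ⟨k, hk, hsep⟩ := hM.exists_separator hf ho hoM
  obtain ⟨ε, hε, -, hface⟩ := f.exists_ball_conic M
  set δ := ε / (2 * (‖latticeVec u‖ + 1)) with hδ
  have hδ0 : 0 < δ := by positivity
  have hδε : ∀ s : ℝ, |s| ≤ δ → ∀ v : Fin 2 → ℤ, (v = u ∨ v = -u) → ‖s • latticeVec v‖ < ε := by
    intro s hs v hv
    have hn : ‖latticeVec v‖ = ‖latticeVec u‖ := by
      rcases hv with rfl | rfl
      · rfl
      · rw [latticeVec_neg, norm_neg]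
    rw [norm_smul, Real.norm_eq_abs, hn]
    calc |s| * ‖latticeVec u‖ ≤ δ * (‖latticeVec u‖ + 1) := by gcongr; linarith
      _ = ε / 2 := by rw [hδ]; field_simp
      _ < ε := by linarith
  have hact : ∀ s ∈ Set.Icc 0 (2 * δ),
      f.activeSet (M - δ • latticeVec u + s • latticeVec u) = f.activeSet M := by
    intro s hs
    have e : M - δ • latticeVec u + s • latticeVec u = M + (s - δ) • latticeVec u := by
      rw [sub_smul]; abel
    rw [e]
    rcases lt_trichotomy (s - δ) 0 with h | h | h
    · have e2 : (s - δ) • latticeVec u = (δ - s) • latticeVec (-u) := by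
        rw [latticeVec_neg, smul_neg, ← neg_smul, neg_sub]
      rw [e2, hface _ _ (by linarith) (hδε _ (by rw [abs_le]; constructor <;> linarith [hs.1]) _
        (Or.inr rfl)), hM.neg.face_eq]
    · rw [h, zero_smul, add_zero]
    · rw [hface _ _ h (hδε _ (by rw [abs_le]; constructor <;> linarith [hs.2]) _
        (Or.inl rfl)), hM.face_eq]
  -- The segment is centred at `M`, so the value at `M` is strictly between the two constant ones,
  -- and points of the curve with such values are determined by them.
  obtain ⟨φ, hφ⟩ := hsep _ (2 * δ) (by linarith) hact
  have hk' : (0 : ℝ) < k := by exact_mod_cast hk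
  have hkδ : 0 < k * δ := by positivity
  have hval : ∀ s ∈ Set.Ioo 0 (2 * δ), φ (M - δ • latticeVec u + s • latticeVec u) = k * s := by
    intro s hs
    have h1 : (k * s : ℝ) ≤ k * (2 * δ) := by gcongr; exact hs.2.le
    have h2 : (0 : ℝ) ≤ k * s := mul_nonneg hk'.le hs.1.le
    rw [hφ.line, min_eq_left h1, max_eq_right h2]
  have hφM : φ M = k * δ := by
    have := hval δ ⟨hδ0, by linarith⟩
    rwa [sub_add_cancel] at this
  obtain ⟨γ, hγ, hmem, h0, hiff⟩ := exists_circle_param hZ.2 hMZ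
  have hinj : ∀ x ∈ f.variety, ∀ y ∈ f.variety, 0 < φ x → φ x < k * (2 * δ) → φ x = φ y →
      x = y := by
    intro x hx y hy hx0 hx1 hxy
    obtain ⟨s, hs, rfl⟩ := hφ.eq_of_mem x hx hx0 hx1
    obtain ⟨s', hs', rfl⟩ := hφ.eq_of_mem y hy (hxy ▸ hx0) (hxy ▸ hx1)
    rw [hval s hs, hval s' hs'] at hxy
    rw [mul_left_cancel₀ hk'.ne' hxy]
  have hφγ : Continuous fun θ => φ (γ θ) := hφ.isTropRational.continuous.comp hγ
  have hev : ∀ᶠ θ in 𝓝 (0 : ℝ), φ (γ θ) ∈ Set.Ioo 0 (k * (2 * δ)) := by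
    refine hφγ.continuousAt.eventually (Ioo_mem_nhds ?_ ?_)
    · simp only [h0, hφM]; exact hkδ
    · simp only [h0, hφM]; linarith
  obtain ⟨η, hη, hball⟩ := Metric.eventually_nhds_iff.1 hev
  have hpi := Real.pi_pos
  have hη' : min (η / 2) (Real.pi / 2) < η := (min_le_left _ _).trans_lt (by linarith)
  have hηpi : min (η / 2) (Real.pi / 2) ≤ Real.pi / 2 := min_le_right _ _
  refine not_locally_injective_of_circle hγ hiff hφ.isTropRational.continuous ?_
    (η := min (η / 2) (Real.pi / 2)) (lt_min (by linarith) (by linarith)) (by linarith) ?_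
  · intro θ hθ
    refine (hinj _ (hZ.1 (hmem 0)) _ (hZ.1 (hmem θ)) ?_ ?_ hθ.symm).symm
    · rw [h0, hφM]; exact hkδ
    · rw [h0, hφM]; linarith
  · intro θ hθ θ' hθ' he
    have hb := hball (y := θ) (by
      rw [Real.dist_eq, sub_zero, abs_lt]; constructor <;> linarith [hθ.1, hθ.2])
    obtain ⟨m, hm⟩ := (hiff _ _).1
      (hinj _ (hZ.1 (hmem θ)) _ (hZ.1 (hmem θ')) hb.1 hb.2 he)
    exact eq_of_eq_add_two_pi hm (by
      rw [abs_lt]; constructor <;> linarith [hθ.1, hθ.2, hθ'.1, hθ'.2])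

/-- Every cycle lies on the boundary of the region of `o`. -/
lemma active_of_mem_cycle (hf : f.IsUnimodular) (ho : f.HasOuterNormals o)
    (hZ : IsCycleIn f.variety Z) {P : Fin 2 → ℝ} (hP : P ∈ Z) : o ∈ f.activeSet P := by
  by_contra hoP
  obtain ⟨γ, hγ, hmem, h0, hiff⟩ := exists_circle_param hZ.2 hP
  have hev : ∀ᶠ θ in 𝓝 (0 : ℝ), o ∉ f.activeSet (γ θ) :=
    hγ.continuousAt.eventually ((f.isClosed_setOf_active o).isOpen_compl.mem_nhds
      (show γ 0 ∈ {x | o ∈ f.activeSet x}ᶜ by rw [h0]; exact hoP))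
  obtain ⟨η, hη, hball⟩ := Metric.eventually_nhds_iff.1 hev
  have hpi := Real.pi_pos
  -- A short arc of the cycle off the region of `o` meets no edge interior, so it would consist of
  -- infinitely many vertices.
  have hinf : (Set.Ioo 0 (min η Real.pi)).Infinite := Set.Ioo_infinite (lt_min hη hpi)
  refine Set.infinite_of_injOn_mapsTo (f := γ) (t := {p | f.IsVertex p}) ?_ ?_ hinf
    (finite_setOf_isVertex f)
  · intro θ hθ θ' hθ' he
    obtain ⟨m, hm⟩ := (hiff _ _).1 he
    have := min_le_right η Real.pi
    exact eq_of_eq_add_two_pi hm (by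
      rw [abs_lt]; constructor <;> linarith [hθ.1, hθ.2, hθ'.1, hθ'.2])
  · intro θ hθ
    by_contra hv
    obtain ⟨u, hu⟩ := exists_onEdge (hZ.1 (hmem θ)) hv
    refine not_mem_cycle_of_onEdge hf ho hZ hu (hball ?_) (hmem θ)
    rw [Real.dist_eq, sub_zero, abs_of_pos hθ.1]
    exact hθ.2.trans_le (min_le_left _ _)

lemma not_mem_variety_of_mem_interior {x : Fin 2 → ℝ}
    (hx : x ∈ interior {x | o ∈ f.activeSet x}) : x ∉ f.variety := by
  refine not_not.2 ⟨latticeVec o, f.coeff o, ?_⟩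
  filter_upwards [mem_interior_iff_mem_nhds.1 hx] with y hy
  have hy' : o ∈ f.activeSet y := hy
  rw [← hy'.2, term_eq]
  simp [dot, Fin.sum_univ_two, add_comm]

lemma convex_setOf_active (f : TropPoly 2) (o : Fin 2 → ℤ) :
    Convex ℝ {x | o ∈ f.activeSet x} := by
  intro x hx y hy a b ha hb hab
  have hx := mem_activeSet.1 hx
  have hy := mem_activeSet.1 hy
  refine mem_activeSet.2 ⟨hx.1, fun c hc => ?_⟩
  have e : ∀ c, f.term c (a • x + b • y) = a * f.term c x + b * f.term c y := by
    intro c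
    rw [term_eq, term_eq, term_eq, dot_add, dot_smul, dot_smul]
    linear_combination (-f.coeff c) * hab
  rw [e, e]
  have h1 := hx.2 c hc
  have h2 := hy.2 c hc
  gcongr

/-- Every cycle contains the boundary of the region of `o`. -/
lemma mem_cycle_of_active (hZ : IsCycleIn f.variety Z) (hZo : ∀ x ∈ Z, o ∈ f.activeSet x)
    {P : Fin 2 → ℝ} (hP : P ∈ f.variety) (hoP : o ∈ f.activeSet P) : P ∈ Z := by
  by_contra hPZ
  set R := {x | o ∈ f.activeSet x} with hR
  have hconv : Convex ℝ R := convex_setOf_active f o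
  -- A collinear region would contain the cycle in a line, on which the pairing with its direction
  -- is injective.
  by_cases hcol : Collinear ℝ R
  · obtain ⟨v, hv⟩ := (collinear_iff_of_mem (show P ∈ R from hoP)).1 hcol
    refine not_injOn_of_circle hZ.2 (a := fun x => v 0 * x 0 + v 1 * x 1)
      (by fun_prop) fun x hx y hy he => ?_
    obtain ⟨r, hr⟩ := hv x (hZo x hx)
    obtain ⟨s, hs⟩ := hv y (hZo y hy)
    rw [hr, hs] at he ⊢
    simp only [vadd_eq_add, Pi.add_apply, Pi.smul_apply, smul_eq_mul] at he ⊢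
    have h1 : (r - s) * (v 0 ^ 2 + v 1 ^ 2) = 0 := by linarith
    rcases mul_eq_zero.1 h1 with h | h
    · rw [sub_eq_zero.1 h]
    · have h0 : v 0 = 0 := by nlinarith [sq_nonneg (v 0), sq_nonneg (v 1)]
      have h1 : v 1 = 0 := by nlinarith [sq_nonneg (v 0), sq_nonneg (v 1)]
      have : v = 0 := by funext i; fin_cases i <;> simp [h0, h1]
      rw [this, smul_zero, smul_zero]
  obtain ⟨c₀, hc₀⟩ := interior_nonempty_of_not_collinear hconv hcol
  -- The open segment from an interior point to a point of a convex set is interior, hence off the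
  -- curve. So each ray from `c₀` meets the boundary of the region at most once.
  have hray : ∀ x ∈ f.variety, ∀ y ∈ R, ∀ r : ℝ, 0 < r → x - c₀ = r • (y - c₀) → 1 ≤ r := by
    intro x hx y hy r hr he
    by_contra! hlt
    have hseg : x ∈ openSegment ℝ c₀ y := by
      refine ⟨1 - r, r, by linarith, hr, by ring, ?_⟩
      rw [sub_eq_iff_eq_add.1 he, smul_sub, sub_smul, one_smul]; abel
    exact not_mem_variety_of_mem_interior
      (hconv.openSegment_interior_self_subset_interior hc₀ hy hseg) hx
  have huniq : ∀ x ∈ f.variety, o ∈ f.activeSet x → ∀ y ∈ f.variety, o ∈ f.activeSet y →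
      ∀ r : ℝ, 0 < r → x - c₀ = r • (y - c₀) → x = y := by
    intro x hx hxo y hy hyo r hr he
    have h1 := hray x hx y hyo r hr he
    have h2 := hray y hy x hxo r⁻¹ (by positivity) (by
      rw [he, smul_smul, inv_mul_cancel₀ hr.ne', one_smul])
    have h3 : r = 1 := by
      have : r * r⁻¹ = 1 := mul_inv_cancel₀ hr.ne'
      nlinarith
    rw [h3, one_smul] at he
    exact sub_left_injective he
  set ζ : (Fin 2 → ℝ) → ℂ := fun x => ⟨(x - c₀) 0, (x - c₀) 1⟩ with hζ
  have hζc : Continuous ζ := by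
    have : ζ = fun x => (((x - c₀) 0 : ℝ) : ℂ) + (((x - c₀) 1 : ℝ) : ℂ) * Complex.I := by
      funext x
      exact (Complex.mk_eq_add_mul_I _ _)
    rw [this]
    fun_prop
  have hζr : ∀ x y : Fin 2 → ℝ, ∀ r : ℝ, ζ x = r * ζ y → x - c₀ = r • (y - c₀) := by
    intro x y r h
    have h0 := congrArg Complex.re h
    have h1 := congrArg Complex.im h
    simp [hζ] at h0 h1
    funext i
    fin_cases i
    · simpa using h0
    · simpa using h1
  have hζ0 : ∀ x ∈ f.variety, ζ x ≠ 0 := by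
    intro x hx h0
    have h1 := hζr x x 0 (by rw [h0]; simp)
    rw [zero_smul, sub_eq_zero] at h1
    exact not_mem_variety_of_mem_interior hc₀ (h1 ▸ hx)
  -- A point of `Z` on the ray through `P` would be `P` itself. Turning that ray to the branch cut
  -- thus makes the argument continuous on `Z`, where it is also injective.
  have hslit : ∀ x ∈ Z, -(ζ x / ζ P) ∈ Complex.slitPlane := by
    intro x hx
    rw [Complex.mem_slitPlane_iff_not_le_zero]
    intro hle
    obtain ⟨hre, him⟩ := Complex.le_def.1 hle
    have hz : ζ x / ζ P = ((ζ x / ζ P).re : ℂ) := by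
      apply Complex.ext
      · simp
      · simpa using him
    have h1 : ζ x = ((ζ x / ζ P).re : ℂ) * ζ P := by
      rw [← hz, div_mul_cancel₀ _ (hζ0 P hP)]
    have h2 : 0 ≤ (ζ x / ζ P).re := by simpa using hre
    rcases h2.eq_or_lt with h2 | h2
    · rw [← h2] at h1
      exact hζ0 x (hZ.1 hx) (by simpa using h1)
    · exact hPZ (huniq x (hZ.1 hx) (hZo x hx) P hP hoP _ h2 (hζr _ _ _ h1) ▸ hx)
  refine not_injOn_of_circle hZ.2 (a := fun x => Complex.arg (-(ζ x / ζ P))) ?_ ?_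
  · intro x hx
    refine ContinuousAt.continuousWithinAt ?_
    have h1 : ContinuousAt (fun x => -(ζ x / ζ P)) x :=
      (hζc.div_const _).neg.continuousAt
    exact ContinuousAt.comp (f := fun x => -(ζ x / ζ P)) (Complex.continuousAt_arg (hslit x hx)) h1
  · intro x hx y hy he
    have hx0 : -(ζ x / ζ P) ≠ 0 := neg_ne_zero.2 (div_ne_zero (hζ0 x (hZ.1 hx)) (hζ0 P hP))
    have hy0 : -(ζ y / ζ P) ≠ 0 := neg_ne_zero.2 (div_ne_zero (hζ0 y (hZ.1 hy)) (hζ0 P hP))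
    have h1 := (Complex.arg_eq_arg_iff hx0 hy0).1 he
    set r : ℝ := ‖-(ζ y / ζ P)‖ / ‖-(ζ x / ζ P)‖ with hr
    have hr0 : 0 < r := div_pos (norm_pos_iff.2 hy0) (norm_pos_iff.2 hx0)
    have h2 : (r : ℂ) * -(ζ x / ζ P) = -(ζ y / ζ P) := by
      rw [hr]; push_cast; exact h1
    have h3 : ζ y = r * ζ x := by
      have hP0 := hζ0 P hP
      field_simp at h2
      linear_combination h2
    exact (huniq y (hZ.1 hy) (hZo y hy) x (hZ.1 hx) (hZo x hx) r hr0 (hζr _ _ _ h3)).symm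

/-! ### Equivalence along a tentacle -/

/-- On a smooth curve of genus one, points of the same tentacle are linearly equivalent. -/
theorem linearlyEquivalent_of_tentacle (hs : f.IsSmooth) (hg : f.genus = 1)
    (hZ : IsCycleIn f.variety Z) {T : Set (Fin 2 → ℝ)} (hT : IsTentacle f.variety Z T)
    (P Q : f.variety) (hP : (P : Fin 2 → ℝ) ∈ T) (hQ : (Q : Fin 2 → ℝ) ∈ T) :
    LinearlyEquivalent f (Finsupp.single P 1) (Finsupp.single Q 1) := by
  obtain ⟨o, ho⟩ := Set.ncard_eq_one.1 hg
  have hoint : latticeVec o ∈ interior f.newtonPolytope := by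
    have : o ∈ {a : Fin 2 → ℤ | latticeVec a ∈ interior f.newtonPolytope} := by rw [ho]; rfl
    exact this
  have hint : (interior f.newtonPolytope).Nonempty := ⟨_, hoint⟩
  have hf : f.IsUnimodular := isUnimodular_of_isSmooth hs fun u hu =>
    exists_idot_ne_of_interior_nonempty hint hu
  have hn : f.HasOuterNormals o := fun a _ hao =>
    exists_outer_normal hint fun h => hao (by
      have : a ∈ {a : Fin 2 → ℤ | latticeVec a ∈ interior f.newtonPolytope} := h
      rwa [ho] at this)
  have hZo : ∀ x ∈ Z, o ∈ f.activeSet x := fun x hx => active_of_mem_cycle hf hn hZ hx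
  obtain ⟨x, -, rfl⟩ := hT
  have hsub := connectedComponentIn_subset (f.variety \ Z) x
  have hmem : f.pointDiv P - f.pointDiv Q ∈ principalSubgroup hf := by
    -- Equivalence is symmetric and transitive and holds locally at every point of the tentacle,
    -- because points of the curve bordering the region of `o` lie on the cycle.
    refine (isPreconnected_connectedComponentIn (F := f.variety \ Z) (x := x)).induction₂
      (fun y z => f.pointDiv y - f.pointDiv z ∈ principalSubgroup hf) ?_ ?_ ?_ hP hQ
    · intro y hy
      obtain ⟨hyV, hyZ⟩ := hsub hy
      exact nhdsWithin_mono y (hsub.trans Set.sdiff_subset) (eventually_sub_mem hf hn hyV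
        fun h => hyZ (mem_cycle_of_active hZ hZo hyV h))
    · intro y z w _ _ _ h1 h2
      simpa using AddSubgroup.add_mem _ h1 h2
    · intro y z _ _ h
      simpa using AddSubgroup.neg_mem _ h
  rw [pointDiv_coe, pointDiv_coe] at hmem
  exact isPrincipal_of_mem hf hmem

end TropPoly

end

theorem mainTheorem6 (F : TropPoly 3) (d : ℤ) (hF : F.IsElliptic d)
    (Z : Set (Fin 2 → ℝ)) (hZ : IsCycleIn (F.dehomogenize d).variety Z)
    (T : Set (Fin 2 → ℝ)) (hT : IsTentacle (F.dehomogenize d).variety Z T)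
    (P Q : (F.dehomogenize d).variety) (hP : (P : Fin 2 → ℝ) ∈ T) (hQ : (Q : Fin 2 → ℝ) ∈ T) :
    TropPoly.LinearlyEquivalent (F.dehomogenize d)
      (Finsupp.single P 1) (Finsupp.single Q 1) := by
  exact TropPoly.linearlyEquivalent_of_tentacle hF.smooth hF.genus_one hZ hT P Q hP hQ
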